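/- **Conventions.** A finite graph is a 1-dimensional CW complex with finitely many vertices and finitely many edges (loops, multiple edges and disconnected graphs are allowed). An edge path is a finite, possibly empty, concatenation of oriented edges; it is tight if no oriented edge in it is immediately followed by its reverse. A continuous map $f\colon G\to H$ of finite graphs is tight if it takes vertices to vertices and its restriction to each edge is, up to orientation-preserving reparametrization, either constant or a tight edge path of $H$. Such a map is given to an algorithm as finite combinatorial data: the two graphs (their vertices, and their edges with initial and terminal vertices), the image of each vertex, and for each edge the tight edge path (a finite, possibly empty, word in the oriented edges of $H$) that is its image. Elements of the free group $F_n=F(s_1,\dots,s_n)$ are given as words in $s_1^{\pm1},\dots,s_n^{\pm1}$. The map $f$ is $\pi_1$-injective if $f_*\colon\pi_1(G,x)\to\pi_1(H,f(x))$ is injective for every $x\in G$. **Corollary.** The following problems are algorithmically solvable (i.e. solved by a computable function of the input data). 1. Given a tight map of finite graphs $f\colon G\to H$, decide whether $f$ is $\pi_1$-injective. 2. Given a tight map of finite graphs $f\colon G\to H$, decide whether $f$ is a homotopy equivalence. 3. Given $n$ and an $n$-tuple of elements of $F_n$, decide whether it is a free basis of $F_n$. 4. Given a tight map of finite graphs $f\colon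 G\to H$ and a vertex $v$ of $G$, compute a free basis of the image subgroup $f_*(\pi_1(G,v))\le\pi_1(H,f(v))$, each element being written as a closed tight edge path of $H$ based at $f(v)$, together with a Stallings graph of this subgroup. The latter is a finite connected graph $S$ with a base vertex $p$, all of whose vertices other than $p$ have valence at least $2$, and with each edge labelled by a single oriented edge of $H$, such that the labels define a locally injective tight map $g\colon S\to H$ with $g(p)=f(v)$ and $g_*(\pi_1(S,p))=f_*(\pi_1(G,v))$. 5. In particular, given $n$ and elements $w_1,\dots,w_k\in F_n$, compute reduced words that form a free basis of the subgroup $\langle w_1,\dots,w_k\rangle$ of $F_n$. -/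

import Mathlib

open scoped unitInterval

/-! ### Finite graphs and their geometric realizations -/

/-- A finite graph, given combinatorially: finitely many vertices, and finitely many edges, each with
an initial and a terminal vertex. Loop edges, multiple edges, isolated vertices and
disconnected (even empty) graphs are allowed. -/
structure FinGraph where
  numV : ℕ
  numE : ℕ
  init : Fin numE → Fin numV
  term : Fin numE → Fin numV

namespace FinGraph

/-- The vertices. -/
abbrev V (G : FinGraph) : Type := Fin G.numV

/-- The edges. -/
abbrev E (G : FinGraph) : Type := Fin G.numE

/-- The attaching relation: the ends of the interval of each edge are glued to its end vertices. -/
inductive Glue (G : FinGraph) : G.V ⊕ (G.E × I) → G.V ⊕ (G.E × I) → Prop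
  | init (e : G.E) : Glue G (Sum.inr (e, 0)) (Sum.inl (G.init e))
  | term (e : G.E) : Glue G (Sum.inr (e, 1)) (Sum.inl (G.term e))

/-- The 1-dimensional CW complex of `G`: the discrete set of vertices together with one unit interval
for each edge, glued along the attaching relation, with the quotient topology. -/
def Space (G : FinGraph) : Type := Quot G.Glue

instance (G : FinGraph) : TopologicalSpace G.Space :=
  inferInstanceAs (TopologicalSpace (Quot G.Glue))

/-- A vertex as a point of the CW complex. -/
def vert (G : FinGraph) (v : G.V) : G.Space := Quot.mk _ (Sum.inl v)

/-- The characteristic map of the edge `e`. -/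
def pt (G : FinGraph) (e : G.E) (t : I) : G.Space := Quot.mk _ (Sum.inr (e, t))

lemma pt_zero (G : FinGraph) (e : G.E) : G.pt e 0 = G.vert (G.init e) := Quot.sound (Glue.init e)

lemma pt_one (G : FinGraph) (e : G.E) : G.pt e 1 = G.vert (G.term e) := Quot.sound (Glue.term e)

lemma continuous_pt (G : FinGraph) (e : G.E) : Continuous (G.pt e) :=
  continuous_quot_mk.comp (continuous_inr.comp (Continuous.prodMk_right e))

/-- The edge `e` as a path from its initial to its terminal vertex. -/
def edgePath (G : FinGraph) (e : G.E) : Path (G.vert (G.init e)) (G.vert (G.term e)) where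
  toFun := G.pt e
  continuous_toFun := G.continuous_pt e
  source' := G.pt_zero e
  target' := G.pt_one e

/-! ### Edge paths -/

/-- The initial vertex of an oriented edge: `(e, true)` is `e` with its given orientation and
`(e, false)` is `e` with the opposite orientation. -/
def src (G : FinGraph) (d : G.E × Bool) : G.V := if d.2 then G.init d.1 else G.term d.1

/-- The terminal vertex of an oriented edge. -/
def tgt (G : FinGraph) (d : G.E × Bool) : G.V := if d.2 then G.term d.1 else G.init d.1

/-- The valence of a vertex: the number of oriented edges with that initial vertex. -/
def valence (G : FinGraph) (v : G.V) : ℕ := (Finset.univ.filter fun d => G.src d = v).card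

/-- The oriented edges from `u` to `v`. -/
def Dart (G : FinGraph) (u v : G.V) : Type := {d : G.E × Bool // G.src d = u ∧ G.tgt d = v}

/-- An oriented edge as a path in the CW complex. -/
def Dart.path {G : FinGraph} : {u v : G.V} → G.Dart u v → Path (G.vert u) (G.vert v)
  | _, _, ⟨(e, true), h⟩ =>
      (G.edgePath e).cast (congrArg G.vert h.1.symm) (congrArg G.vert h.2.symm)
  | _, _, ⟨(e, false), h⟩ =>
      (G.edgePath e).symm.cast (congrArg G.vert h.1.symm) (congrArg G.vert h.2.symm)

/-- Edge paths from one vertex to another, as finite sequences of composable oriented edges. -/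
inductive Walk (G : FinGraph) : G.V → G.V → Type
  | nil (u : G.V) : Walk G u u
  | cons {u v w : G.V} (d : G.Dart u v) (p : Walk G v w) : Walk G u w

namespace Walk

/-- The sequence of oriented edges of an edge path. -/
def word {G : FinGraph} : {u v : G.V} → G.Walk u v → List (G.E × Bool)
  | _, _, nil _ => []
  | _, _, cons d p => d.1 :: p.word

/-- An edge path as a continuous path: the concatenation of its oriented edges, without any
constant pieces unless the edge path is trivial. -/
noncomputable def toPath {G : FinGraph} : {u v : G.V} → G.Walk u v → Path (G.vert u) (G.vert v)
  | _, _, nil u => Path.refl (G.vert u)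
  | _, _, cons d (nil _) => d.path
  | _, _, cons d (cons d' p) => d.path.trans (cons d' p).toPath

/-- A tight edge path: no oriented edge is followed by its reverse. -/
def IsTight {G : FinGraph} {u v : G.V} (p : G.Walk u v) : Prop := FreeGroup.IsReduced p.word

/-- The element of the fundamental group represented by a closed edge path. -/
noncomputable def toPi {G : FinGraph} {v : G.V} (p : G.Walk v v) :
    FundamentalGroup G.Space (G.vert v) :=
  FundamentalGroup.fromPath (Path.Homotopic.Quotient.mk p.toPath)

end Walk

end FinGraph

/-! ### Tight maps -/

/-- The combinatorial data of a tight map of finite graphs: a vertex for each vertex, and for each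
edge a tight edge path, possibly trivial, between the images of its end vertices. -/
structure TightMap (G H : FinGraph) where
  onV : G.V → H.V
  onE : ∀ e : G.E, H.Walk (onV (G.init e)) (onV (G.term e))
  tight : ∀ e, (onE e).IsTight

/-- The continuous map `F` is a tight map with combinatorial data `f`: it takes each vertex `v` to
the vertex `f.onV v`, and its restriction to each edge `e` is, up to an orientation preserving
reparametrization, the tight edge path `f.onE e` (which is constant if that edge path is trivial). -/
def TightMap.Describes {G H : FinGraph} (f : TightMap G H) (F : C(G.Space, H.Space)) : Prop :=
  (∀ v, F (G.vert v) = H.vert (f.onV v)) ∧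
    ∀ e, ∃ r : I ≃o I, ∀ t, F (G.pt e t) = (f.onE e).toPath (r t)

/-- `F` is injective on fundamental groups, for every base point. -/
def PiOneInjective {X Y : Type*} [TopologicalSpace X] [TopologicalSpace Y] (F : C(X, Y)) : Prop :=
  ∀ x : X, Function.Injective (FundamentalGroup.map F x)

/-- `F` is a homotopy equivalence. -/
def IsHomotopyEquivalence {X Y : Type*} [TopologicalSpace X] [TopologicalSpace Y]
    (F : C(X, Y)) : Prop :=
  ∃ h : ContinuousMap.HomotopyEquiv X Y, h.toFun = F

/-- The elements `w 0, …, w (m - 1)` form a free basis of the subgroup `K` of `A`. -/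
def IsFreeBasisOf {A : Type*} [Group A] {m : ℕ} (w : Fin m → A) (K : Subgroup A) : Prop :=
  ∃ b : FreeGroupBasis (Fin m) K, ∀ i, (b i : A) = w i

/-- `g : S → H`, with base vertex `p` of `S`, is a Stallings graph of the subgroup `K` of the
fundamental group of `H` at `q`: `S` is connected and is a core graph relative to `p` (every vertex
of valence at most one equals `p`); its edges are labelled by single oriented edges of `H`; and the
map to `H` given by the labels is a local injection which takes `p` to `q` and has `K` as the image
of its induced homomorphism of fundamental groups. -/
structure IsStallingsGraph {S H : FinGraph} (g : TightMap S H) (p : S.V) (q : H.V)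
    (K : Subgroup (FundamentalGroup H.Space (H.vert q))) : Prop where
  connected : ConnectedSpace S.Space
  core : ∀ u : S.V, S.valence u ≤ 1 → u = p
  labels : ∀ e, (g.onE e).word.length = 1
  immersion : ∃ φ : C(S.Space, H.Space), g.Describes φ ∧ IsLocallyInjective φ ∧
    ∃ h : φ (S.vert p) = H.vert q, (FundamentalGroup.mapOfEq φ h).range = K

/-! ### Inputs and outputs of algorithms

All inputs and outputs are finite combinatorial objects, written out with lists of natural numbers
and Booleans. -/

/-- A word in letters and inverse letters, with the letters written as natural numbers. -/
def wordCode {n : ℕ} (w : List (Fin n × Bool)) : List (ℕ × Bool) := w.map fun d => (d.1.val, d.2)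

/-- The number of vertices, and the list of the initial and terminal vertices of the edges. -/
def FinGraph.code (G : FinGraph) : ℕ × List (ℕ × ℕ) :=
  (G.numV, List.ofFn fun e => ((G.init e).val, (G.term e).val))

/-- The type of the written-out tight maps. -/
abbrev TightMapCode : Type :=
  ((ℕ × List (ℕ × ℕ)) × (ℕ × List (ℕ × ℕ))) × (List ℕ × List (List (ℕ × Bool)))

/-- The two graphs, the list of the images of the vertices, and the list of the edge paths that are
the images of the edges. -/
def TightMap.code {G H : FinGraph} (f : TightMap G H) : TightMapCode :=
  ((G.code, H.code),
    (List.ofFn fun v => (f.onV v).val, List.ofFn fun e => wordCode (f.onE e).word))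

/-! ### Closure properties of computable predicates and functions -/

section Computability

variable {α β γ τ : Type*} [Primcodable α] [Primcodable β] [Primcodable γ] [Primcodable τ]

attribute [fun_prop] Computable Computable.id Computable.const Computable.comp
attribute [fun_prop] Primrec Primrec.id Primrec.const Primrec.comp

/-! All five problems reduce to two decision problems in the free group `FreeGroup ℕ` on the natural
numbers: membership in a finitely generated subgroup, and injectivity of a homomorphism on such a
subgroup. No folding procedure is analysed. A predicate is decidable once it and its negation both
have checkable finite certificates (`computablePred_of_certificates`), and an output that provably
exists and can be checked is found by unbounded search (`exists_computable_search`). What remains is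
to prove that certificates and outputs exist.

Membership is certified by a word in the generators. Non-membership is certified by an action on
states, given by a finite table, in which the generators fix a state that the given word moves. It
comes from the action on cosets: the finitely many cosets visited by the words carry partial
bijections, and these extend to permutations (Marshall Hall's argument, `ActionTable.exists_table`).
Non-injectivity is certified by a nontrivial element with trivial image. Injectivity is certified by
a finite table with output that reads the images of the generators and returns the generators. It is
a left inverse, obtained from the Schreier cocycle of the image subgroup
(`exists_cocycleAction_quotient`) and cut down to finitely many states in the same way. Finite bases
exist by the Nielsen–Schreier theorem and `finite_of_fg_freeGroup`. Stallings graphs exist as the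
subgraphs of coset graphs traversed by the reduced generators (`exists_isStallingsCode`).

The topology enters through a faithful functor, the holonomy `FinGraph.hol`, from path classes
between vertices of a graph to the free group on its edges. It is the monodromy of an explicit
covering with the free group as fibre, so it is a homotopy invariant, and on an edge path it is the
word of that path. Every path class between vertices contains an edge path (`FinGraph.isWalkClass`),
and cancellations in words are homotopies, so the holonomy is injective. Hence the fundamental group
at a vertex is identified with the group `walkGroup` of closed edge words, and a tight map acts on
it by substitution of words (`FinGraph.hol_map`). Injectivity and image subgroups thereby become
questions about free groups.

A map of graphs is a homotopy equivalence exactly when it is fully faithful on path classes of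
vertices and reaches every component. For the nontrivial direction the inverse is built edge by
edge, and homotopies come from squares over the edges (`FinGraph.isHomotopyEquivalence_of_vertMap`).
These conditions are again injectivity, containment of subgroups, and connectivity by edge paths. -/

@[fun_prop]
theorem Primrec.prodMk_fun {f : α → β} {g : α → γ} (hf : Primrec f) (hg : Primrec g) :
    Primrec fun a => (f a, g a) := hf.pair hg

@[fun_prop]
theorem Primrec.fst_fun {f : α → β × γ} (hf : Primrec f) : Primrec fun a => (f a).1 :=
  Primrec.fst.comp hf

@[fun_prop]
theorem Primrec.snd_fun {f : α → β × γ} (hf : Primrec f) : Primrec fun a => (f a).2 :=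
  Primrec.snd.comp hf

@[fun_prop]
theorem Primrec.not_fun {f : α → Bool} (hf : Primrec f) : Primrec fun a => !f a :=
  Primrec.not.comp hf

@[fun_prop]
theorem Primrec.cons_fun {f : α → β} {g : α → List β} (hf : Primrec f) (hg : Primrec g) :
    Primrec fun a => f a :: g a := Primrec.list_cons.comp hf hg

@[fun_prop]
theorem Primrec.append_fun {f g : α → List β} (hf : Primrec f) (hg : Primrec g) :
    Primrec fun a => f a ++ g a := Primrec.list_append.comp hf hg

@[fun_prop]
theorem Primrec.reverse_fun {f : α → List β} (hf : Primrec f) :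
    Primrec fun a => (f a).reverse := Primrec.list_reverse.comp hf

@[fun_prop]
theorem Primrec.getD_fun {f : α → List β} {g : α → ℕ} {h : α → β} (hf : Primrec f)
    (hg : Primrec g) (hh : Primrec h) : Primrec fun a => (f a).getD (g a) (h a) := by
  simp only [List.getD_eq_getElem?_getD]
  exact Primrec.option_getD.comp (Primrec.list_getElem?.comp hf hg) hh

@[fun_prop]
theorem Primrec.length_fun {f : α → List β} (hf : Primrec f) :
    Primrec fun a => (f a).length := Primrec.list_length.comp hf

@[fun_prop]
theorem Computable.prodMk_fun {f : α → β} {g : α → γ} (hf : Computable f) (hg : Computable g) :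
    Computable fun a => (f a, g a) := hf.pair hg

@[fun_prop]
theorem Computable.fst_fun {f : α → β × γ} (hf : Computable f) : Computable fun a => (f a).1 :=
  Computable.fst.comp hf

@[fun_prop]
theorem Computable.snd_fun {f : α → β × γ} (hf : Computable f) : Computable fun a => (f a).2 :=
  Computable.snd.comp hf

@[fun_prop]
theorem Computable.cons_fun {f : α → β} {g : α → List β} (hf : Computable f) (hg : Computable g) :
    Computable fun a => f a :: g a := Computable.list_cons.comp hf hg

@[fun_prop]
theorem Computable.append_fun {f g : α → List β} (hf : Computable f) (hg : Computable g) :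
    Computable fun a => f a ++ g a := Computable.list_append.comp hf hg

@[fun_prop]
theorem Computable.getD_fun {f : α → List β} {g : α → ℕ} {h : α → β} (hf : Computable f)
    (hg : Computable g) (hh : Computable h) : Computable fun a => (f a).getD (g a) (h a) :=
  (Primrec.getD_fun (f := fun p : List β × ℕ × β => p.1) (g := fun p => p.2.1)
    (h := fun p => p.2.2) (by fun_prop) (by fun_prop) (by fun_prop)).to_comp.comp
      (g := fun a => (f a, g a, h a)) (by fun_prop)

@[fun_prop]
theorem Computable.getElem?_fun {f : α → List β} {g : α → ℕ} (hf : Computable f)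
    (hg : Computable g) : Computable fun a => (f a)[g a]? := Computable.list_getElem?.comp hf hg

@[fun_prop]
theorem Computable.length_fun {f : α → List β} (hf : Computable f) :
    Computable fun a => (f a).length := Computable.list_length.comp hf

/-! ### Boolean operations and bounded quantifiers for decidable predicates -/

namespace ComputablePred

variable {p q : α → Prop}

theorem comp_fun {p : β → Prop} (hp : ComputablePred p) {f : α → β} (hf : Computable f) :
    ComputablePred fun a => p (f a) := by
  classical
  exact Computable.computablePred (hp.decide.comp hf)

theorem and (hp : ComputablePred p) (hq : ComputablePred q) :
    ComputablePred fun a => p a ∧ q a := by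
  classical
  refine Computable.computablePred ((Primrec.and.to_comp.comp hp.decide hq.decide).of_eq ?_)
  simp

theorem or (hp : ComputablePred p) (hq : ComputablePred q) :
    ComputablePred fun a => p a ∨ q a := by
  classical
  refine Computable.computablePred ((Primrec.or.to_comp.comp hp.decide hq.decide).of_eq ?_)
  simp

theorem imp (hp : ComputablePred p) (hq : ComputablePred q) :
    ComputablePred fun a => p a → q a :=
  (hp.not.or hq).of_eq fun _ => imp_iff_not_or.symm

theorem eq {f g : α → β} (hf : Computable f) (hg : Computable g) :
    ComputablePred fun a => f a = g a :=
  (PrimrecPred.computablePred (p := fun x : β × β => x.1 = x.2) Primrec.eq).comp_fun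
    (f := fun a => (f a, g a)) (by fun_prop)

theorem lt {f g : α → ℕ} (hf : Computable f) (hg : Computable g) :
    ComputablePred fun a => f a < g a :=
  (PrimrecPred.computablePred (p := fun x : ℕ × ℕ => x.1 < x.2) Primrec.nat_lt).comp_fun
    (f := fun a => (f a, g a)) (by fun_prop)

theorem of_bool {f : α → Bool} (hf : Computable f) : ComputablePred fun a => f a = true :=
  eq hf (by fun_prop)

theorem forall_lt {f : α → ℕ} {P : α → ℕ → Prop} (hf : Computable f)
    (hP : ComputablePred fun x : α × ℕ => P x.1 x.2) :
    ComputablePred fun a => ∀ i < f a, P a i := by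
  classical
  have h : Computable fun a => (Nat.rec true (fun i b => b && decide (P a i)) (f a) : Bool) := by
    refine Computable.nat_rec hf (by fun_prop) ?_ (h := fun a x => x.2 && decide (P a x.1))
    exact Primrec.and.to_comp.comp (by fun_prop)
      (hP.decide.comp (f := fun y => decide (P y.1 y.2)) (g := fun y : α × ℕ × Bool => (y.1, y.2.1))
        (by fun_prop))
  refine Computable.computablePred (h.of_eq fun a => ?_)
  induction f a with
  | zero => simp
  | succ n ih => simp only [ih]; grind

theorem exists_lt {f : α → ℕ} {P : α → ℕ → Prop} (hf : Computable f)
    (hP : ComputablePred fun x : α × ℕ => P x.1 x.2) :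
    ComputablePred fun a => ∃ i < f a, P a i :=
  (forall_lt (P := fun a i => ¬ P a i) hf hP.not).not.of_eq fun a => by simp

theorem option {P : α → β → Prop} {f : α → Option β} (hf : Computable f)
    (hP : ComputablePred fun x : α × β => P x.1 x.2) :
    ComputablePred fun a => ∀ b ∈ f a, P a b := by
  classical
  have h : Computable fun a => (Option.casesOn (f a) true fun b => decide (P a b) : Bool) :=
    Computable.option_casesOn hf (by fun_prop) hP.decide
  refine Computable.computablePred (h.of_eq fun a => ?_)
  cases f a <;> simp

theorem forall_mem {f : α → List β} {P : α → β → Prop} (hf : Computable f)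
    (hP : ComputablePred fun x : α × β => P x.1 x.2) :
    ComputablePred fun a => ∀ b ∈ f a, P a b := by
  have h : ComputablePred fun a => ∀ i < (f a).length, ∀ b ∈ (f a)[i]?, P a b := by
    refine forall_lt (by fun_prop) (option (P := fun (x : α × ℕ) b => P x.1 b)
      (f := fun x : α × ℕ => (f x.1)[x.2]?) (by fun_prop) ?_)
    exact hP.comp_fun (f := fun x : (α × ℕ) × β => (x.1.1, x.2)) (by fun_prop)
  refine h.of_eq fun a => ?_
  simp only [List.forall_mem_iff_getElem, Option.mem_def]
  exact ⟨fun h i hi => h i hi _ (List.getElem?_eq_getElem hi), fun h i hi b hb => by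
    obtain ⟨_, rfl⟩ := List.getElem?_eq_some_iff.1 hb
    exact h i hi⟩

end ComputablePred

/-- Unbounded search: if every input has an output in a decidable relation to it, then such an
output can be computed. -/
theorem exists_computable_search {R : α → τ → Prop}
    (hR : ComputablePred fun x : α × τ => R x.1 x.2) (h : ∀ a, ∃ s, R a s) :
    ∃ A : α → τ, Computable A ∧ ∀ a, R a (A a) := by
  classical
  -- The search runs through the codes of candidate outputs; numbers that code nothing fail the
  -- test.
  let P : α → ℕ → Prop := fun a n => ∃ s ∈ (Encodable.decode n : Option τ), R a s
  have hP : ComputablePred fun x : α × ℕ => P x.1 x.2 := by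
    refine (ComputablePred.option (f := fun x : α × ℕ => (Encodable.decode x.2 : Option τ))
      (P := fun x s => ¬ R x.1 s) (Computable.decode.comp (by fun_prop)) ?_).not.of_eq
        fun x => by simp [P]
    exact (hR.comp_fun (f := fun x : (α × ℕ) × τ => (x.1.1, x.2)) (by fun_prop)).not
  have hex : ∀ a, ∃ n, P a n := fun a =>
    (h a).imp' Encodable.encode fun s hs => ⟨s, by simp, hs⟩
  have hc := Computable.find (P := P) hP hex
  have hs : ∀ a, ((Encodable.decode (Nat.find (hex a)) : Option τ)).isSome := fun a => by
    obtain ⟨s, hs, -⟩ := Nat.find_spec (hex a)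
    simp [Option.mem_def.1 hs]
  refine ⟨fun a => (Encodable.decode (Nat.find (hex a)) : Option τ).get (hs a), ?_, fun a => ?_⟩
  · rw [← Computable.option_some_iff]
    simpa using Computable.decode.comp hc
  · obtain ⟨s, hs, hR⟩ := Nat.find_spec (hex a)
    simpa [Option.mem_def.1 hs] using hR

/-- A predicate is decidable if it and its negation are certified by decidable relations. -/
theorem computablePred_of_certificates {ρ : Type*} [Primcodable ρ] {P : α → Prop}
    {R : α → τ → Prop} {S : α → ρ → Prop} [Inhabited τ] [Inhabited ρ]
    (hR : ComputablePred fun x : α × τ => R x.1 x.2)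
    (hS : ComputablePred fun x : α × ρ => S x.1 x.2)
    (h1 : ∀ a, P a ↔ ∃ s, R a s) (h2 : ∀ a, ¬ P a ↔ ∃ s, S a s) : ComputablePred P := by
  classical
  -- One search looks for both kinds of certificate at once. The Boolean records which kind was
  -- found and is the decision; the unused slot holds a default value.
  obtain ⟨A, hA, hA'⟩ := exists_computable_search (τ := Bool × τ × ρ)
    (R := fun a x => (x.1 = true ∧ R a x.2.1) ∨ (x.1 = false ∧ S a x.2.2))
    (((ComputablePred.eq (f := fun x : α × Bool × τ × ρ => x.2.1) (g := fun _ => true)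
      (by fun_prop) (by fun_prop)).and
        (hR.comp_fun (f := fun x : α × Bool × τ × ρ => (x.1, x.2.2.1)) (by fun_prop))).or
      ((ComputablePred.eq (f := fun x : α × Bool × τ × ρ => x.2.1) (g := fun _ => false)
      (by fun_prop) (by fun_prop)).and
        (hS.comp_fun (f := fun x : α × Bool × τ × ρ => (x.1, x.2.2.2)) (by fun_prop))))
    (fun a => by
      by_cases ha : P a
      · obtain ⟨s, hs⟩ := (h1 a).1 ha
        exact ⟨(true, s, default), .inl ⟨rfl, hs⟩⟩
      · obtain ⟨s, hs⟩ := (h2 a).1 ha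
        exact ⟨(false, default, s), .inr ⟨rfl, hs⟩⟩)
  refine (ComputablePred.of_bool (f := fun a => (A a).1) (by fun_prop)).of_eq fun a => ?_
  rcases hA' a with ⟨h, h'⟩ | ⟨h, h'⟩
  · simp [h, (h1 a).2 ⟨_, h'⟩]
  · simp [h, (h2 a).2 ⟨_, h'⟩]

end Computability

/-! ### Words -/

/-- Words in letters and inverse letters, with the natural numbers as letters. -/
abbrev NatWord : Type := List (ℕ × Bool)

section Words

variable {α β γ τ : Type*} [Primcodable α] [Primcodable β] [Primcodable γ] [Primcodable τ]

theorem primrec_invRev : Primrec (FreeGroup.invRev : NatWord → NatWord) := by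
  have : Primrec fun w : NatWord => (w.map fun g => (g.1, !g.2)).reverse :=
    Primrec.reverse_fun (Primrec.list_map Primrec.id (by unfold Primrec₂; fun_prop))
  exact this

/-- Prepend a letter to a reduced word. -/
def consReduced (x : ℕ × Bool) (w : NatWord) : NatWord :=
  List.casesOn w [x] fun y t => if x.1 = y.1 ∧ x.2 = !y.2 then t else x :: y :: t

/-- Reduction treats the tail first and then prepends the head with at most one cancellation, so it
is a right fold of `consReduced`. -/
theorem primrec_reduce : Primrec (FreeGroup.reduce : NatWord → NatWord) := by
  have hc : Primrec fun p : (ℕ × Bool) × NatWord => consReduced p.1 p.2 := by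
    unfold consReduced
    refine Primrec.list_casesOn (f := fun p : (ℕ × Bool) × NatWord => p.2) (by fun_prop)
      (by fun_prop) (h := fun p q => if p.1.1 = q.1.1 ∧ p.1.2 = !q.1.2 then q.2 else
        p.1 :: q.1 :: q.2) ?_
    refine Primrec.ite (PrimrecPred.and ?_ ?_) (by fun_prop) (by fun_prop)
    · exact Primrec.eq.comp (by fun_prop) (by fun_prop)
    · exact Primrec.eq.comp (by fun_prop) (by fun_prop)
  refine (Primrec.list_foldr (f := id) (g := fun _ => []) (h := fun _ p => consReduced p.1 p.2)
    Primrec.id (by fun_prop) (hc.comp Primrec.snd)).of_eq fun w => ?_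
  induction w with
  | nil => rfl
  | cons x w ih =>
    rw [FreeGroup.reduce.cons]
    simp only [id] at ih ⊢
    rw [List.foldr_cons, ih]
    rfl

/-- Replace each letter `i` by the `i`-th word of `φ`. -/
def substWord (φ : List NatWord) (w : NatWord) : NatWord :=
  -- A letter beyond the end of `φ` is replaced by the empty word, that is, sent to the identity.
  w.flatMap fun d => if d.2 = true then φ.getD d.1 [] else FreeGroup.invRev (φ.getD d.1 [])

theorem primrec_substWord : Primrec fun x : List NatWord × NatWord => substWord x.1 x.2 := by
  refine Primrec.list_flatMap (by fun_prop) (Primrec.ite ?_ (by fun_prop) ?_)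
  · exact Primrec.eq.comp (by fun_prop) (by fun_prop)
  · exact primrec_invRev.comp (by fun_prop)

@[fun_prop]
theorem Computable.reduce_fun {f : α → NatWord} (hf : Computable f) :
    Computable fun a => FreeGroup.reduce (f a) := primrec_reduce.to_comp.comp hf

@[fun_prop]
theorem Computable.invRev_fun {f : α → NatWord} (hf : Computable f) :
    Computable fun a => FreeGroup.invRev (f a) := primrec_invRev.to_comp.comp hf

@[fun_prop]
theorem Computable.substWord_fun {f : α → List NatWord} {g : α → NatWord} (hf : Computable f)
    (hg : Computable g) : Computable fun a => substWord (f a) (g a) :=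
  primrec_substWord.to_comp.comp (hf.pair hg)

@[fun_prop]
theorem Computable.map_substWord_fun {f g : α → List NatWord} (hf : Computable f)
    (hg : Computable g) : Computable fun a => (g a).map (substWord (f a)) :=
  (Primrec.list_map (f := fun x : List NatWord × List NatWord => x.2)
    (g := fun x w => substWord x.1 w) (by fun_prop)
    (primrec_substWord.comp (f := fun x : List NatWord × NatWord => substWord x.1 x.2)
      (g := fun y : (List NatWord × List NatWord) × NatWord => (y.1.1, y.2))
        (by fun_prop))).to_comp.comp (hf.pair hg)

/-- The homomorphism taking the `i`-th generator to the `i`-th word of `φ`. -/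
def substHom (φ : List NatWord) : FreeGroup ℕ →* FreeGroup ℕ :=
  FreeGroup.lift fun i => FreeGroup.mk (φ.getD i [])

theorem mk_cons {ι : Type*} (d : ι × Bool) (w : List (ι × Bool)) :
    FreeGroup.mk (d :: w) = FreeGroup.mk [d] * FreeGroup.mk w := by
  rw [FreeGroup.mul_mk]; rfl

theorem mk_substWord (φ : List NatWord) (w : NatWord) :
    FreeGroup.mk (substWord φ w) = substHom φ (FreeGroup.mk w) := by
  induction w with
  | nil => simp [substWord, FreeGroup.one_eq_mk.symm]
  | cons d w ih =>
    rw [mk_cons d w, map_mul, ← ih, substWord, List.flatMap_cons, ← FreeGroup.mul_mk]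
    congr 1
    obtain ⟨i, _ | _⟩ := d
    · simp [substHom, ← FreeGroup.inv_mk]
    · simp [substHom]

/-- The subgroup of the free group generated by a list of words. -/
def wordClosure (L : List NatWord) : Subgroup (FreeGroup ℕ) :=
  Subgroup.closure (FreeGroup.mk '' {l | l ∈ L})

theorem mk_mem_wordClosure {L : List NatWord} {l : NatWord} (h : l ∈ L) :
    FreeGroup.mk l ∈ wordClosure L := Subgroup.subset_closure ⟨l, h, rfl⟩

theorem wordClosure_le {L : List NatWord} {K : Subgroup (FreeGroup ℕ)} :
    wordClosure L ≤ K ↔ ∀ l ∈ L, FreeGroup.mk l ∈ K := by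
  simp [wordClosure, Subgroup.closure_le, Set.subset_def]

/-- The letters beyond the length of the list go to the identity, so the images of all letters
generate the same subgroup as the listed words. Elements of a finitely generated subgroup are thus
parametrised by arbitrary words, which is what a search can run through. -/
theorem range_substHom (L : List NatWord) : (substHom L).range = wordClosure L := by
  refine le_antisymm ?_ (wordClosure_le.2 fun l hl => ?_)
  · rw [substHom, FreeGroup.range_lift_eq_closure, Subgroup.closure_le]
    rintro _ ⟨i, rfl⟩
    by_cases hi : i < L.length
    · simp only [List.getD_eq_getElem _ _ hi]
      exact mk_mem_wordClosure (List.getElem_mem hi)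
    · simp only [List.getD_eq_default _ _ (not_lt.1 hi), ← FreeGroup.one_eq_mk]
      exact one_mem _
  · obtain ⟨i, hi, rfl⟩ := List.mem_iff_getElem.1 hl
    exact ⟨FreeGroup.of i, by simp [substHom, hi]⟩

theorem map_substHom_wordClosure (φ L : List NatWord) :
    (wordClosure L).map (substHom φ) = wordClosure (L.map (substWord φ)) := by
  rw [wordClosure, MonoidHom.map_closure, wordClosure]
  congr 1
  ext x
  simp [mk_substWord]

end Words

/-! ### Free groups acting on products, and finite tables describing such actions -/

section Cocycles

variable {Y M : Type*} [Group M]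

/-- The permutation of `Y × M` covering a permutation `π` of `Y` and multiplying the second
coordinate on the left by a function on `Y`. -/
def cocyclePerm (π : Equiv.Perm Y) (o : Y → M) : Equiv.Perm (Y × M) where
  toFun x := (π x.1, o x.1 * x.2)
  invFun x := (π.symm x.1, (o (π.symm x.1))⁻¹ * x.2)
  left_inv x := by simp
  right_inv x := by simp

/-- The action of the free group in which the generators act by the permutations `cocyclePerm`. -/
def cocycleAction (π : ℕ → Equiv.Perm Y) (o : ℕ → Y → M) : FreeGroup ℕ →* Equiv.Perm (Y × M) :=
  FreeGroup.lift fun a => cocyclePerm (π a) (o a)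

/-- Each generator multiplies the second coordinate on the left, and this commutes with
multiplication on the right. The action is therefore determined by its values at second coordinate
`1`. -/
theorem cocycleAction_mul_right (π : ℕ → Equiv.Perm Y) (o : ℕ → Y → M) (x : FreeGroup ℕ)
    (y : Y) (g h : M) : cocycleAction π o x (y, g * h) =
      ((cocycleAction π o x (y, g)).1, (cocycleAction π o x (y, g)).2 * h) := by
  induction x using FreeGroup.induction_on generalizing y g h with
  | C1 => simp
  | of a => simp [cocycleAction, cocyclePerm, mul_assoc]
  | inv_of a _ => simp [cocycleAction, cocyclePerm, mul_assoc, Equiv.Perm.inv_def]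
  | mul a b ha hb => rw [map_mul, Equiv.Perm.mul_apply, hb, ha, Equiv.Perm.mul_apply]

theorem cocycleAction_eq (π : ℕ → Equiv.Perm Y) (o : ℕ → Y → M) (x : FreeGroup ℕ)
    (y : Y) (g : M) : cocycleAction π o x (y, g) =
      ((cocycleAction π o x (y, 1)).1, (cocycleAction π o x (y, 1)).2 * g) := by
  simpa using cocycleAction_mul_right π o x y 1 g

/-- A point together with a homomorphism to `M` which is computed by the second coordinate of the
action generates a left inverse. -/
theorem cocycleAction_closure {π : ℕ → Equiv.Perm Y} {o : ℕ → Y → M} {y : Y} {S : Set M}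
    (Φ : M →* FreeGroup ℕ) (h : ∀ m ∈ S, cocycleAction π o (Φ m) (y, 1) = (y, m)) {m : M}
    (hm : m ∈ Subgroup.closure S) : cocycleAction π o (Φ m) (y, 1) = (y, m) := by
  induction hm using Subgroup.closure_induction with
  | mem m hm => exact h m hm
  | one => simp
  | mul a b _ _ ha hb =>
    rw [map_mul, map_mul, Equiv.Perm.mul_apply, hb, cocycleAction_eq, ha]
  | inv a _ ha =>
    rw [map_inv, map_inv, Equiv.Perm.inv_eq_iff_eq, cocycleAction_eq, ha]
    simp

/-- The action of the free group on the cosets of a subgroup `K`, with second coordinate extending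
a given homomorphism `ρ` on `K`. -/
theorem exists_cocycleAction_quotient (K : Subgroup (FreeGroup ℕ)) (ρ : K →* M) :
    ∃ (π : ℕ → Equiv.Perm (FreeGroup ℕ ⧸ K)) (o : ℕ → FreeGroup ℕ ⧸ K → M),
      (∀ x y g, (cocycleAction π o x (y, g)).1 = x • y) ∧
      ∀ k : K, cocycleAction π o k (((1 : FreeGroup ℕ) : FreeGroup ℕ ⧸ K), 1) =
        (((1 : FreeGroup ℕ) : FreeGroup ℕ ⧸ K), ρ k) := by
  classical
  -- A transversal of the cosets, with `1` representing `K` itself. This normalisation makes an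
  -- element of `K` return its own value under `ρ` at the base coset, without a conjugation.
  let τ : FreeGroup ℕ ⧸ K → FreeGroup ℕ :=
    Function.update Quotient.out ((1 : FreeGroup ℕ) : FreeGroup ℕ ⧸ K) 1
  have hτ1 : τ ((1 : FreeGroup ℕ) : FreeGroup ℕ ⧸ K) = 1 := Function.update_self _ _ _
  have hτ : ∀ y, (τ y : FreeGroup ℕ ⧸ K) = y := fun y => by
    by_cases hy : y = ((1 : FreeGroup ℕ) : FreeGroup ℕ ⧸ K)
    · rw [hy, hτ1]
    · simp only [τ, Function.update_of_ne hy]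
      exact QuotientGroup.out_eq' y
  have hK : ∀ x y, (τ (x • y))⁻¹ * (x * τ y) ∈ K := fun x y => by
    rw [← QuotientGroup.eq, hτ]
    conv_lhs => rw [← hτ y]
    rfl
  -- The Schreier cocycle of the transversal. Its cocycle identity `hκ` says that multiplying by `ρ
  -- (κ x y)` over the coset action is an action of the whole free group.
  let κ : FreeGroup ℕ → FreeGroup ℕ ⧸ K → K := fun x y => ⟨_, hK x y⟩
  have hκ : ∀ x x' y, κ (x * x') y = κ x (x' • y) * κ x' y := fun x x' y => by
    apply Subtype.ext
    simp only [κ, Subgroup.coe_mul, mul_smul]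
    group
  let π : ℕ → Equiv.Perm (FreeGroup ℕ ⧸ K) := fun a => MulAction.toPerm (FreeGroup.of a)
  let o : ℕ → FreeGroup ℕ ⧸ K → M := fun a y => ρ (κ (FreeGroup.of a) y)
  have key : ∀ x y g, cocycleAction π o x (y, g) = (x • y, ρ (κ x y) * g) := by
    intro x
    have h1 : ∀ y, κ 1 y = 1 := fun y => by
      have := hκ 1 1 y
      simpa using this
    have hinv : ∀ x y, κ x⁻¹ y = (κ x (x⁻¹ • y))⁻¹ := fun x y => by
      rw [eq_inv_iff_mul_eq_one, ← h1 (x⁻¹ • y), ← inv_mul_cancel x, hκ, smul_inv_smul]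
    induction x using FreeGroup.induction_on with
    | C1 => simp [h1]
    | of a => intro y g; simp [cocycleAction, cocyclePerm, π, o]
    | inv_of a _ =>
      intro y g
      rw [hinv]
      simp [cocycleAction, cocyclePerm, π, o, Equiv.Perm.inv_def]
    | mul a b ha hb => intro y g; simp [hb, ha, mul_smul, hκ, mul_assoc]
  refine ⟨π, o, fun x y g => by rw [key], fun k => ?_⟩
  have hk : (k : FreeGroup ℕ) • ((1 : FreeGroup ℕ) : FreeGroup ℕ ⧸ K) =
      ((1 : FreeGroup ℕ) : FreeGroup ℕ ⧸ K) := by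
    change ((k * 1 : FreeGroup ℕ) : FreeGroup ℕ ⧸ K) = _
    rw [QuotientGroup.eq]
    simp
  rw [key, mul_one]
  refine Prod.ext hk ?_
  have : κ k ((1 : FreeGroup ℕ) : FreeGroup ℕ ⧸ K) = k := Subtype.ext (by simp only [κ, hk, hτ1]; simp)
  simp [this]

end Cocycles

/-- A table lists for each letter and each state the next state, the previous state, and a word. -/
abbrev ActionTable : Type := List (List (ℕ × ℕ × NatWord))

/-! ### Finite tables: evaluation on words, and extraction from infinite actions -/

namespace ActionTable

/-- An entry of the table; all missing entries are trivial. -/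
def entry (T : ActionTable) (a s : ℕ) : ℕ × ℕ × NatWord := (T.getD a []).getD s (s, s, [])

/-- The letters act by mutually inverse functions of the states. -/
def IsValid (T : ActionTable) : Prop := ∀ a < T.length, ∀ s < (T.getD a []).length,
  (T.entry a (T.entry a s).2.1).1 = s ∧ (T.entry a (T.entry a s).1).2.1 = s

/-- The action of one letter on a state and a word. -/
def step (T : ActionTable) (d : ℕ × Bool) (x : ℕ × NatWord) : ℕ × NatWord :=
  if d.2 = true then ((T.entry d.1 x.1).1, (T.entry d.1 x.1).2.2 ++ x.2)
  -- An inverse letter undoes the forward step that leads into the current state, so the word to be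
  -- inverted is the one stored at the previous state.
  else ((T.entry d.1 x.1).2.1,
    FreeGroup.invRev (T.entry d.1 (T.entry d.1 x.1).2.1).2.2 ++ x.2)

/-- The action of a word on a state, with the accumulated word. -/
def run (T : ActionTable) (w : NatWord) (s : ℕ) : ℕ × NatWord := w.foldr T.step (s, [])

section

variable {α : Type*} [Primcodable α]

@[fun_prop]
theorem primrec_entry {f : α → ActionTable} {g h : α → ℕ} (hf : Primrec f) (hg : Primrec g)
    (hh : Primrec h) : Primrec fun x => (f x).entry (g x) (h x) := by
  unfold entry
  fun_prop

@[fun_prop]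
theorem computable_entry {f : α → ActionTable} {g h : α → ℕ} (hf : Computable f)
    (hg : Computable g) (hh : Computable h) : Computable fun x => (f x).entry (g x) (h x) := by
  unfold entry
  fun_prop

@[fun_prop]
theorem computable_run {f : α → ActionTable} {g : α → NatWord} {h : α → ℕ} (hf : Computable f)
    (hg : Computable g) (hh : Computable h) : Computable fun x => (f x).run (g x) (h x) := by
  have hs : Primrec fun x : ActionTable × (ℕ × Bool) × ℕ × NatWord => x.1.step x.2.1 x.2.2 := by
    unfold step
    refine Primrec.ite (Primrec.eq.comp (by fun_prop) (by fun_prop)) (by fun_prop)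
      (Primrec.prodMk_fun (by fun_prop) (Primrec.append_fun (primrec_invRev.comp ?_) ?_))
    · fun_prop
    · fun_prop
  have : Primrec fun x : ActionTable × NatWord × ℕ => x.1.run x.2.1 x.2.2 := by
    refine Primrec.list_foldr (f := fun x : ActionTable × NatWord × ℕ => x.2.1)
      (g := fun x => (x.2.2, [])) (by fun_prop) (by fun_prop) (h := fun x y => x.1.step y.1 y.2) ?_
    exact hs.comp (g := fun z : (ActionTable × NatWord × ℕ) × (ℕ × Bool) × ℕ × NatWord =>
      (z.1.1, z.2)) (by fun_prop)
  exact this.to_comp.comp (g := fun x => (f x, g x, h x)) (by fun_prop)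

theorem computablePred_isValid : ComputablePred IsValid := by
  unfold IsValid
  refine .forall_lt (P := fun (T : ActionTable) a => ∀ s < (T.getD a []).length,
    (T.entry a (T.entry a s).2.1).1 = s ∧ (T.entry a (T.entry a s).1).2.1 = s) (by fun_prop) ?_
  refine .forall_lt (f := fun x : ActionTable × ℕ => (x.1.getD x.2 []).length)
    (P := fun (x : ActionTable × ℕ) s =>
    (x.1.entry x.2 (x.1.entry x.2 s).2.1).1 = s ∧ (x.1.entry x.2 (x.1.entry x.2 s).1).2.1 = s)
    (by fun_prop) ?_
  exact .and (.eq (by fun_prop) (by fun_prop)) (.eq (by fun_prop) (by fun_prop))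

end

variable {T : ActionTable}

/-- Entries missing from the table act trivially, so the finite check in `IsValid` covers all
letters and all states. -/
theorem IsValid.forall (hT : T.IsValid) (a s : ℕ) :
    (T.entry a (T.entry a s).2.1).1 = s ∧ (T.entry a (T.entry a s).1).2.1 = s := by
  by_cases h : a < T.length ∧ s < (T.getD a []).length
  · exact hT a h.1 s h.2
  · have : T.entry a s = (s, s, []) := by
      rw [entry]
      by_cases ha : a < T.length
      · exact List.getD_eq_default _ _ (by grind)
      · rw [List.getD_eq_default T _ (by omega)]
        simp
    simp [this]

/-- The permutation of the states given by a letter. -/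
def perm (hT : T.IsValid) (a : ℕ) : Equiv.Perm ℕ where
  toFun s := (T.entry a s).1
  invFun s := (T.entry a s).2.1
  left_inv s := (hT.forall a s).2
  right_inv s := (hT.forall a s).1

/-- The action of the free group described by a table. -/
def action (hT : T.IsValid) : FreeGroup ℕ →* Equiv.Perm (ℕ × FreeGroup ℕ) :=
  cocycleAction (perm hT) fun a s => FreeGroup.mk (T.entry a s).2.2

/-- This connects the computable evaluation with the group action. The right fold in `run` lets the
last letter act first, as in a left action. -/
theorem action_mk (hT : T.IsValid) (w : NatWord) (s : ℕ) :
    action hT (FreeGroup.mk w) (s, 1) = ((T.run w s).1, FreeGroup.mk (T.run w s).2) := by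
  induction w with
  | nil => simp [run, ← FreeGroup.one_eq_mk]
  | cons d w ih =>
    rw [mk_cons, map_mul, Equiv.Perm.mul_apply, ih]
    change _ = ((T.step d (T.run w s)).1, FreeGroup.mk (T.step d (T.run w s)).2)
    obtain ⟨a, _ | _⟩ := d
    · simp [step, action, cocycleAction, cocyclePerm, perm, ← FreeGroup.mul_mk,
        ← FreeGroup.inv_mk, Equiv.Perm.inv_def]
    · simp [step, action, cocycleAction, cocyclePerm, perm, ← FreeGroup.mul_mk]

/-- The table with given permutations and words. -/
def ofPerm {B N : ℕ} (p : Fin B → Equiv.Perm (Fin N)) (o : Fin B → Fin N → NatWord) :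
    ActionTable :=
  List.ofFn fun a => List.ofFn fun s => ((p a s).val, ((p a).symm s).val, o a s)

theorem entry_ofPerm {B N : ℕ} (p : Fin B → Equiv.Perm (Fin N)) (o : Fin B → Fin N → NatWord)
    (a : Fin B) (s : Fin N) :
    (ofPerm p o).entry a s = ((p a s).val, ((p a).symm s).val, o a s) := by
  have h : (ofPerm p o).getD a [] =
      List.ofFn fun s => ((p a s).val, ((p a).symm s).val, o a s) := by
    rw [ofPerm, List.getD_eq_getElem _ _ (by simp), List.getElem_ofFn]
  rw [entry, h, List.getD_eq_getElem _ _ (by simp), List.getElem_ofFn]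

theorem isValid_ofPerm {B N : ℕ} (p : Fin B → Equiv.Perm (Fin N))
    (o : Fin B → Fin N → NatWord) : (ofPerm p o).IsValid := by
  intro a ha s hs
  have ha' : a < B := by simpa [ofPerm] using ha
  have hs' : s < N := by
    rw [ofPerm, List.getD_eq_getElem _ _ (by simpa using ha'), List.getElem_ofFn] at hs
    simpa using hs
  have h := entry_ofPerm p o ⟨a, ha'⟩
  simp only at h
  constructor
  · rw [h ⟨s, hs'⟩, h ((p ⟨a, ha'⟩).symm ⟨s, hs'⟩)]
    simp
  · rw [h ⟨s, hs'⟩, h (p ⟨a, ha'⟩ ⟨s, hs'⟩)]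
    simp

/-- The orbit of a point under finitely many words in an action can be described by a table. -/
theorem exists_table {Y : Type*} (π : ℕ → Equiv.Perm Y) (o : ℕ → Y → FreeGroup ℕ) (y : Y)
    (L : List NatWord) : ∃ (T : ActionTable) (hT : T.IsValid) (c : Y → ℕ), ∀ w ∈ L,
      action hT (FreeGroup.mk w) (c y, 1) =
        (c (cocycleAction π o (FreeGroup.mk w) (y, 1)).1,
          (cocycleAction π o (FreeGroup.mk w) (y, 1)).2) ∧
      (c (cocycleAction π o (FreeGroup.mk w) (y, 1)).1 = c y →
        (cocycleAction π o (FreeGroup.mk w) (y, 1)).1 = y) := by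
  classical
  let ψ := cocycleAction π o
  -- The points visited while the words of `L` are read from the right, one for each suffix. The
  -- extra empty word puts `y` into the set even if `L` is empty.
  let X : Finset Y := ((([] :: L).flatMap List.tails).map fun v => (ψ (FreeGroup.mk v) (y, 1)).1).toFinset
  have hX : ∀ w ∈ L, ∀ v, v <:+ w → (ψ (FreeGroup.mk v) (y, 1)).1 ∈ X := fun w hw v hv => by
    simp only [X, List.mem_toFinset, List.mem_map, List.mem_flatMap]
    exact ⟨v, ⟨w, by simp [hw], (List.mem_tails _ _).2 hv⟩, rfl⟩
  have hy : y ∈ X := by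
    simp only [X, List.mem_toFinset, List.mem_map, List.mem_flatMap]
    exact ⟨[], ⟨[], by simp, by simp⟩, by simp [ψ, ← FreeGroup.one_eq_mk]⟩
  obtain ⟨B, hB⟩ : ∃ B, ∀ w ∈ L, ∀ d ∈ w, d.1 < B := by
    obtain ⟨B, hB⟩ := (L.flatten.map Prod.fst).toFinset.exists_nat_subset_range
    refine ⟨B, fun w hw d hd => ?_⟩
    have := @hB d.1 (by
      simp only [List.mem_toFinset, List.mem_map, List.mem_flatten]
      exact ⟨d, ⟨w, hw, hd⟩, rfl⟩)
    simpa using this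
  let e : X ≃ Fin X.card := X.equivFin
  -- Points outside `X` receive the number `X.card`, which is not the number of any point of `X`.
  let c : Y → ℕ := fun z => if hz : z ∈ X then (e ⟨z, hz⟩).val else X.card
  have hc : ∀ z (hz : z ∈ X), c z = (e ⟨z, hz⟩).val := fun z hz => dif_pos hz
  -- Each letter restricts to a bijection between two subsets of the finite set `X`. Any such
  -- partial bijection extends to a permutation of `X`, and the extension does not affect the
  -- transitions within `X`, which are the only ones used by the words of `L`.
  let r : ∀ a : ℕ, {x : X // π a x ∈ X} ≃ {x : X // (π a).symm x ∈ X} := fun a =>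
    { toFun := fun x => ⟨⟨π a x, x.2⟩, by simp⟩
      invFun := fun x => ⟨⟨(π a).symm x, x.2⟩, by simp⟩
      left_inv := fun x => by simp
      right_inv := fun x => by simp }
  let p : ℕ → Equiv.Perm (Fin X.card) := fun a => (e.symm.trans (r a).extendSubtype).trans e
  let T := ofPerm (B := B) (fun a => p a) fun a s => (o a (e.symm s)).toWord
  have hT : T.IsValid := isValid_ofPerm _ _
  have fwd : ∀ a < B, ∀ z ∈ X, π a z ∈ X → ∀ g, cocyclePerm (perm hT a)
      (fun s => FreeGroup.mk (T.entry a s).2.2) (c z, g) = (c (π a z), o a z * g) := by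
    intro a ha z hz hz' g
    have h := entry_ofPerm (B := B) (fun a => p a) (fun a s => (o a (e.symm s)).toWord) ⟨a, ha⟩
      (e ⟨z, hz⟩)
    simp only at h
    simp only [cocyclePerm, perm, Equiv.coe_fn_mk, hc z hz, hc _ hz', T, h]
    simp only [FreeGroup.mk_toWord, Equiv.symm_apply_apply, p, Equiv.trans_apply]
    rw [Equiv.extendSubtype_apply_of_mem (r a) ⟨z, hz⟩ hz']
    rfl
  refine ⟨T, hT, c, fun w hw => ⟨?_, fun h => ?_⟩⟩
  · have hX' : ∀ v, v <:+ w → (ψ (FreeGroup.mk v) (y, 1)).1 ∈ X := hX w hw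
    have hB' : ∀ d ∈ w, d.1 < B := hB w hw
    clear hX hw hB
    change action hT (FreeGroup.mk w) (c y, 1) =
      (c (ψ (FreeGroup.mk w) (y, 1)).1, (ψ (FreeGroup.mk w) (y, 1)).2)
    induction w with
    | nil => simp [← FreeGroup.one_eq_mk]
    | cons d w ih =>
      have h1 := hX' w (List.suffix_cons d w)
      have h2 := hX' (d :: w) List.suffix_rfl
      rw [mk_cons, map_mul, map_mul, Equiv.Perm.mul_apply, Equiv.Perm.mul_apply,
        ih (fun v hv => hX' v (hv.trans (List.suffix_cons d w)))
          (fun d' hd' => hB' d' (List.mem_cons_of_mem d hd'))]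
      rw [mk_cons, map_mul, Equiv.Perm.mul_apply] at h2
      generalize ψ (FreeGroup.mk w) (y, 1) = q at h1 h2 ⊢
      have hd : d.1 < B := hB' d (by simp)
      obtain ⟨z, g⟩ := q
      obtain ⟨a, _ | _⟩ := d
      -- For an inverse letter the point reached is again visited, so the step is the inverse of a
      -- forward step within `X`.
      · have h2' : (π a).symm z ∈ X := by
          simpa [ψ, cocycleAction, cocyclePerm, Equiv.Perm.inv_def] using h2
        have := fwd a hd _ h2' (by simpa using h1) ((o a ((π a).symm z))⁻¹ * g)
        simp only [Equiv.apply_symm_apply, mul_inv_cancel_left] at this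
        simp only [action, cocycleAction, ψ, FreeGroup.lift_mk, List.map_cons, List.map_nil,
          List.prod_cons, List.prod_nil, mul_one, cond_false]
        rw [Equiv.Perm.inv_eq_iff_eq]
        exact this.symm
      · have h2' : π a z ∈ X := by simpa [ψ, cocycleAction, cocyclePerm] using h2
        have := fwd a hd z h1 h2' g
        simp only [action, cocycleAction, ψ, FreeGroup.lift_mk, List.map_cons, List.map_nil,
          List.prod_cons, List.prod_nil, mul_one, cond_true]
        exact this
  · have h1 := hX w hw w List.suffix_rfl
    rw [hc _ h1, hc _ hy] at h
    simpa using e.injective (Fin.ext h)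

end ActionTable

/-! ### Decision problems in free groups -/

/-- Membership in a finitely generated subgroup of a free group is decidable. -/
theorem computablePred_mem_wordClosure : ComputablePred fun x : List NatWord × NatWord =>
    FreeGroup.mk x.2 ∈ wordClosure x.1 := by
  refine computablePred_of_certificates
    (R := fun x W => FreeGroup.reduce (substWord x.1 W) = FreeGroup.reduce x.2)
    (S := fun x (T : ActionTable × ℕ) => (T.1.IsValid ∧ ∀ l ∈ x.1, (T.1.run l T.2).1 = T.2) ∧
      ¬ (T.1.run x.2 T.2).1 = T.2)
    (.eq (by fun_prop) (by fun_prop)) (.and (.and ?_ ?_) ?_) (fun x => ?_) (fun x => ?_)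
  · exact ActionTable.computablePred_isValid.comp_fun (by fun_prop)
  · exact .forall_mem (f := fun x : (List NatWord × NatWord) × ActionTable × ℕ => x.1.1)
      (P := fun x l => (x.2.1.run l x.2.2).1 = x.2.2) (by fun_prop)
      (.eq (by fun_prop) (by fun_prop))
  · exact .not (.eq (by fun_prop) (by fun_prop))
  · rw [← range_substHom]
    constructor
    · rintro ⟨y, hy⟩
      refine ⟨y.toWord, FreeGroup.reduce.sound ?_⟩
      rw [mk_substWord, FreeGroup.mk_toWord, hy]
    · rintro ⟨W, hW⟩
      exact ⟨FreeGroup.mk W, by rw [← mk_substWord]; exact FreeGroup.reduce.exact hW⟩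
  · obtain ⟨L, w⟩ := x
    constructor
    · intro hw
      -- In the action on cosets the base coset is fixed by exactly the elements of the subgroup.
      -- The output words play no role here, so the trivial homomorphism is used.
      obtain ⟨π, o, h1, -⟩ := exists_cocycleAction_quotient (wordClosure L)
        (1 : wordClosure L →* FreeGroup ℕ)
      obtain ⟨T, hT, c, hc⟩ := ActionTable.exists_table π o
        ((1 : FreeGroup ℕ) : FreeGroup ℕ ⧸ wordClosure L) (w :: L)
      have key : ∀ l : NatWord, FreeGroup.mk l • ((1 : FreeGroup ℕ) : FreeGroup ℕ ⧸ wordClosure L) =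
          ((1 : FreeGroup ℕ) : FreeGroup ℕ ⧸ wordClosure L) ↔ FreeGroup.mk l ∈ wordClosure L :=
        fun l => by
          change ((FreeGroup.mk l * 1 : FreeGroup ℕ) : FreeGroup ℕ ⧸ wordClosure L) = _ ↔ _
          rw [QuotientGroup.eq, mul_one, mul_one, inv_mem_iff]
      refine ⟨(T, c ((1 : FreeGroup ℕ) : FreeGroup ℕ ⧸ wordClosure L)), ⟨hT, fun l hl => ?_⟩,
        fun h => hw ?_⟩
      · have := (hc l (List.mem_cons_of_mem _ hl)).1
        rw [ActionTable.action_mk, Prod.ext_iff, h1, (key l).2 (mk_mem_wordClosure hl)] at this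
        exact this.1
      · have := hc w (by simp)
        rw [ActionTable.action_mk, Prod.ext_iff, h1, key] at this
        exact this.2 (this.1.1.symm.trans h)
    · rintro ⟨⟨T, s⟩, ⟨hT, hL⟩, hw⟩ hmem
      refine hw ?_
      -- The stabiliser of the state `s`. Quantifying over the second coordinate makes closure under
      -- products immediate; since the first coordinate of the action does not depend on it, one
      -- value suffices for the generators.
      let K : Subgroup (FreeGroup ℕ) :=
        { carrier := {x | ∀ g, (ActionTable.action hT x (s, g)).1 = s}
          one_mem' := by simp
          mul_mem' := fun {a b} ha hb g => by
            have h := hb g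
            rw [map_mul, Equiv.Perm.mul_apply]
            generalize ActionTable.action hT b (s, g) = q at h ⊢
            obtain ⟨q1, q2⟩ := q
            obtain rfl : q1 = s := h
            exact ha q2
          inv_mem' := fun {a} ha g => by
            have h := ha ((ActionTable.action hT a (s, 1)).2⁻¹ * g)
            have : ActionTable.action hT a (s, (ActionTable.action hT a (s, 1)).2⁻¹ * g) =
                (s, g) := by
              refine Prod.ext h ?_
              rw [ActionTable.action, cocycleAction_eq]
              simp
            rw [map_inv, Equiv.Perm.inv_eq_iff_eq.2 this.symm] }
      have hK : wordClosure L ≤ K := wordClosure_le.2 fun l hl g => by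
        rw [ActionTable.action, cocycleAction_eq, ← ActionTable.action, ActionTable.action_mk]
        exact hL l hl
      have := hK hmem 1
      rwa [ActionTable.action_mk] at this

/-- Injectivity of a homomorphism on a finitely generated subgroup of a free group is decidable. -/
theorem computablePred_injective_wordClosure :
    ComputablePred fun x : List NatWord × List NatWord =>
      ∀ y ∈ wordClosure x.1, substHom x.2 y = 1 → y = 1 := by
  refine computablePred_of_certificates
    (R := fun x (T : ActionTable × ℕ) => T.1.IsValid ∧ ∀ l ∈ x.1,
      (T.1.run (substWord x.2 l) T.2).1 = T.2 ∧
      FreeGroup.reduce (T.1.run (substWord x.2 l) T.2).2 = FreeGroup.reduce l)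
    (S := fun x W => FreeGroup.reduce (substWord x.2 (substWord x.1 W)) = [] ∧
      ¬ FreeGroup.reduce (substWord x.1 W) = [])
    (.and ?_ ?_) (.and (.eq (by fun_prop) (by fun_prop)) (.not (.eq (by fun_prop) (by fun_prop))))
    (fun x => ?_) (fun x => ?_)
  · exact ActionTable.computablePred_isValid.comp_fun (by fun_prop)
  · exact .forall_mem (f := fun x : (List NatWord × List NatWord) × ActionTable × ℕ => x.1.1)
      (P := fun x l => (x.2.1.run (substWord x.1.2 l) x.2.2).1 = x.2.2 ∧
        FreeGroup.reduce (x.2.1.run (substWord x.1.2 l) x.2.2).2 = FreeGroup.reduce l)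
      (by fun_prop) (.and (.eq (by fun_prop) (by fun_prop)) (.eq (by fun_prop) (by fun_prop)))
  · obtain ⟨L, φ⟩ := x
    constructor
    · intro hinj
      let Φ : wordClosure L →* FreeGroup ℕ := (substHom φ).comp (wordClosure L).subtype
      have hΦ : Function.Injective Φ := (injective_iff_map_eq_one Φ).2 fun y hy =>
        Subtype.ext (hinj y y.2 hy)
      -- The inverse of the restricted homomorphism, as a map from its image. The cocycle action
      -- extending `ρ` reads `Φ y` at the base coset and outputs `y`; a finite table keeps this for
      -- the generators.
      let ρ : Φ.range →* FreeGroup ℕ :=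
        (wordClosure L).subtype.comp (MonoidHom.ofInjective hΦ).symm.toMonoidHom
      have hρ : ∀ y : wordClosure L, ρ ⟨Φ y, y, rfl⟩ = y := fun y => by
        have : (MonoidHom.ofInjective hΦ).symm ⟨Φ y, y, rfl⟩ = y :=
          (MonoidHom.ofInjective hΦ).symm_apply_apply y
        simp [ρ, this]
      obtain ⟨π, o, -, h2⟩ := exists_cocycleAction_quotient Φ.range ρ
      obtain ⟨T, hT, c, hc⟩ := ActionTable.exists_table π o
        ((1 : FreeGroup ℕ) : FreeGroup ℕ ⧸ Φ.range) (L.map (substWord φ))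
      refine ⟨(T, c ((1 : FreeGroup ℕ) : FreeGroup ℕ ⧸ Φ.range)), hT, fun l hl => ?_⟩
      have h3 : FreeGroup.mk (substWord φ l) = Φ ⟨_, mk_mem_wordClosure hl⟩ := mk_substWord φ l
      have h4 := h2 ⟨Φ ⟨_, mk_mem_wordClosure hl⟩, _, rfl⟩
      simp only at h4
      have := (hc (substWord φ l) (List.mem_map.2 ⟨l, hl, rfl⟩)).1
      rw [ActionTable.action_mk, h3, h4, hρ, Prod.ext_iff] at this
      exact ⟨this.1, FreeGroup.reduce.sound this.2⟩
    · rintro ⟨⟨T, s⟩, hT, hL⟩ y hy hy1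
      -- Soundness of the certificate: returning the generators implies returning every element `y`
      -- of the subgroup from its image. If the image is `1`, the output is `1`, so `y = 1`.
      have := cocycleAction_closure (y := s) (π := ActionTable.perm hT)
        (o := fun a s => FreeGroup.mk (T.entry a s).2.2) (S := FreeGroup.mk '' {l | l ∈ L})
        (substHom φ) (by
          rintro _ ⟨l, hl, rfl⟩
          rw [← mk_substWord, ← ActionTable.action, ActionTable.action_mk]
          exact Prod.ext (hL l hl).1 (FreeGroup.reduce.exact (hL l hl).2)) hy
      simp only at hy1
      rw [hy1] at this
      simpa using (congrArg Prod.snd this).symm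
  · obtain ⟨L, φ⟩ := x
    simp only [← range_substHom, MonoidHom.mem_range]
    constructor
    · intro h
      push Not at h
      obtain ⟨_, ⟨z, rfl⟩, h1, h2⟩ := h
      refine ⟨z.toWord, ?_, fun h => h2 ?_⟩
      · rw [← FreeGroup.toWord_mk, mk_substWord, mk_substWord, FreeGroup.mk_toWord, h1]
        simp
      · rw [← FreeGroup.toWord_mk, mk_substWord, FreeGroup.mk_toWord] at h
        exact FreeGroup.toWord_eq_nil_iff.1 h
    · rintro ⟨W, h1, h2⟩ h
      rw [← FreeGroup.toWord_mk, FreeGroup.toWord_eq_nil_iff, mk_substWord] at h1 h2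
      rw [mk_substWord] at h1
      exact h2 (h _ ⟨_, rfl⟩ h1)

/-! ### Free bases -/

/-- A basis is the same as an isomorphism from the free group onto `K`. In this form freeness is an
injectivity statement, accessible to the decision procedure. -/
theorem isFreeBasisOf_iff {A : Type*} [Group A] {m : ℕ} (w : Fin m → A) (K : Subgroup A) :
    IsFreeBasisOf w K ↔
      Function.Injective (FreeGroup.lift w) ∧ (FreeGroup.lift w).range = K := by
  constructor
  · rintro ⟨b, hb⟩
    have h : FreeGroup.lift w = K.subtype.comp b.repr.symm.toMonoidHom := by
      ext i
      simp only [FreeGroup.lift_apply_of]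
      exact (hb i).symm
    constructor
    · rw [h]
      exact K.subtype_injective.comp b.repr.symm.injective
    · rw [h, MonoidHom.range_comp]
      rw [MonoidHom.range_eq_top.2 b.repr.symm.surjective, ← MonoidHom.range_eq_map,
        Subgroup.range_subtype]
  · rintro ⟨h, rfl⟩
    refine ⟨.ofRepr (MonoidHom.ofInjective h).symm, fun i => ?_⟩
    change FreeGroup.lift w (FreeGroup.of i) = w i
    simp

/-- Every free generator occurs in one of the finitely many generating words. Otherwise the
homomorphism to `FreeGroup Unit` that keeps this generator and kills all others would be trivial on
a generating set, yet nontrivial. -/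
theorem finite_of_fg_freeGroup {ι : Type*} [hfg : Group.FG (FreeGroup ι)] : Finite ι := by
  classical
  obtain ⟨S, hS⟩ := hfg.out
  have hA : ∀ i, ∃ s ∈ S, i ∈ s.toWord.map Prod.fst := by
    intro i
    by_contra hi
    push Not at hi
    let f : FreeGroup ι →* FreeGroup Unit :=
      FreeGroup.lift fun j => if j = i then FreeGroup.of () else 1
    have hf : f = 1 := by
      refine MonoidHom.eq_of_eqOn_dense hS fun s hs => ?_
      have : f (FreeGroup.mk s.toWord) = 1 := by
        rw [FreeGroup.lift_mk]
        refine List.prod_eq_one fun x hx => ?_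
        obtain ⟨d, hd, rfl⟩ := List.mem_map.1 hx
        have : d.1 ≠ i := fun h => hi s hs (List.mem_map.2 ⟨d, hd, h⟩)
        simp [this]
      rwa [FreeGroup.mk_toWord] at this
    have h1 : f (FreeGroup.of i) = FreeGroup.of () := by simp [f]
    rw [hf] at h1
    exact FreeGroup.of_ne_one () h1.symm
  have : (Set.univ : Set ι) ⊆ (S.biUnion fun s => (s.toWord.map Prod.fst).toFinset : Finset ι) := by
    intro i _
    obtain ⟨s, hs, h⟩ := hA i
    simp only [Finset.coe_biUnion, Set.mem_iUnion]
    exact ⟨s, hs, by simpa using h⟩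
  exact Set.finite_univ_iff.1 ((Finset.finite_toSet _).subset this)

theorem wordClosure_ofFn {m : ℕ} (u : Fin m → NatWord) :
    wordClosure (List.ofFn u) = (FreeGroup.lift fun i => FreeGroup.mk (u i)).range := by
  rw [FreeGroup.range_lift_eq_closure, wordClosure]
  congr 1
  ext x
  simp [List.mem_ofFn]

/-- The one-letter words in the first `m` letters. -/
def letterWords (m : ℕ) : List NatWord := (List.range m).map fun i => [(i, true)]

@[fun_prop]
theorem Computable.letterWords_fun {α : Type*} [Primcodable α] {f : α → ℕ} (hf : Computable f) :
    Computable fun a => letterWords (f a) :=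
  (Primrec.list_map (f := List.range) (g := fun _ i => [(i, true)]) Primrec.list_range
    (by unfold Primrec₂; fun_prop)).to_comp.comp hf

theorem mem_wordClosure_letterWords {m : ℕ} {x : FreeGroup ℕ} :
    x ∈ wordClosure (letterWords m) ↔ ∃ y : FreeGroup (Fin m), FreeGroup.map Fin.val y = x := by
  have : letterWords m = List.ofFn fun i : Fin m => [(i.val, true)] := by
    rw [letterWords, ← List.map_coe_finRange_eq_range, List.map_map, List.ofFn_eq_map]
    rfl
  rw [this, wordClosure_ofFn]
  have h : (FreeGroup.lift fun i : Fin m => FreeGroup.mk [(i.val, true)]) =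
      FreeGroup.map Fin.val := by
    ext i; simp [FreeGroup.of]
  rw [h]
  rfl

theorem substHom_ofFn_map {m : ℕ} (u : Fin m → NatWord) (y : FreeGroup (Fin m)) :
    substHom (List.ofFn u) (FreeGroup.map Fin.val y) =
      FreeGroup.lift (fun i => FreeGroup.mk (u i)) y := by
  rw [← MonoidHom.comp_apply]
  congr 1
  ext i
  simp [substHom]

/-- The substitution by `u` kills all letters from `m` on, so it is never injective on `FreeGroup
ℕ`; freeness of the tuple is its injectivity on the subgroup of the first `m` letters. -/
theorem injective_lift_mk_iff {m : ℕ} (u : Fin m → NatWord) :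
    Function.Injective (FreeGroup.lift fun i => FreeGroup.mk (u i)) ↔
      ∀ y ∈ wordClosure (letterWords m), substHom (List.ofFn u) y = 1 → y = 1 := by
  rw [injective_iff_map_eq_one]
  constructor
  · rintro h _ hy h1
    obtain ⟨y, rfl⟩ := mem_wordClosure_letterWords.1 hy
    rw [substHom_ofFn_map] at h1
    rw [h y h1, map_one]
  · intro h y hy
    refine FreeGroup.map_injective Fin.val_injective ?_
    rw [map_one]
    exact h _ (mem_wordClosure_letterWords.2 ⟨y, rfl⟩) (by rw [substHom_ofFn_map, hy])

/-- A free basis of the subgroup generated by a list of words, consisting of reduced words, can be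
computed. -/
theorem exists_computable_basis : ∃ A : List NatWord → List NatWord, Computable A ∧
    ∀ L, ∃ (m : ℕ) (u : Fin m → NatWord), A L = List.ofFn u ∧ (∀ i, FreeGroup.IsReduced (u i)) ∧
      IsFreeBasisOf (fun i => FreeGroup.mk (u i)) (wordClosure L) := by
  -- Correctness of a proposed basis is decidable: mutual membership gives the right subgroup, and
  -- injectivity on the first letters gives freeness.
  let R : List NatWord → List NatWord → Prop := fun L u =>
    ((∀ x ∈ u, FreeGroup.reduce x = x) ∧ (∀ x ∈ u, FreeGroup.mk x ∈ wordClosure L)) ∧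
      (∀ x ∈ L, FreeGroup.mk x ∈ wordClosure u) ∧
      ∀ y ∈ wordClosure (letterWords u.length), substHom u y = 1 → y = 1
  have hR : ComputablePred fun x : List NatWord × List NatWord => R x.1 x.2 := by
    refine .and (.and ?_ ?_) (.and ?_ ?_)
    · exact .forall_mem (f := fun x : List NatWord × List NatWord => x.2)
        (P := fun _ x => FreeGroup.reduce x = x) (by fun_prop) (.eq (by fun_prop) (by fun_prop))
    · exact .forall_mem (f := fun x : List NatWord × List NatWord => x.2)
        (P := fun y x => FreeGroup.mk x ∈ wordClosure y.1) (by fun_prop)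
        (computablePred_mem_wordClosure.comp_fun
          (f := fun z : (List NatWord × List NatWord) × NatWord => (z.1.1, z.2)) (by fun_prop))
    · exact .forall_mem (f := fun x : List NatWord × List NatWord => x.1)
        (P := fun y x => FreeGroup.mk x ∈ wordClosure y.2) (by fun_prop)
        (computablePred_mem_wordClosure.comp_fun
          (f := fun z : (List NatWord × List NatWord) × NatWord => (z.1.2, z.2)) (by fun_prop))
    · exact computablePred_injective_wordClosure.comp_fun
        (f := fun z : List NatWord × List NatWord => (letterWords z.2.length, z.2)) (by fun_prop)
  have hex : ∀ L, ∃ u, R L u := by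
    intro L
    have hfg : Group.FG (wordClosure L) := by
      rw [wordClosure]
      have : {l | l ∈ L}.Finite := L.finite_toSet
      have := (this.image (FreeGroup.mk : NatWord → FreeGroup ℕ)).to_subtype
      exact Group.closure_finite_fg _
    -- The Nielsen–Schreier theorem supplies a basis; it is finite because the subgroup is finitely
    -- generated.
    let b := IsFreeGroup.basis (wordClosure L)
    have hfg' : Group.FG (FreeGroup (IsFreeGroup.Generators (wordClosure L))) :=
      Group.fg_of_surjective (f := b.repr.toMonoidHom) b.repr.surjective
    have := finite_of_fg_freeGroup (ι := IsFreeGroup.Generators (wordClosure L))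
    obtain ⟨m, ⟨e⟩⟩ := Finite.exists_equiv_fin (IsFreeGroup.Generators (wordClosure L))
    let u : Fin m → NatWord := fun i => ((b.reindex e i : wordClosure L) : FreeGroup ℕ).toWord
    have hb : IsFreeBasisOf (fun i => FreeGroup.mk (u i)) (wordClosure L) :=
      ⟨b.reindex e, fun i => by simp [u, FreeGroup.mk_toWord]⟩
    have hb' := (isFreeBasisOf_iff _ _).1 hb
    rw [injective_lift_mk_iff, ← wordClosure_ofFn] at hb'
    refine ⟨List.ofFn u, ⟨?_, ?_⟩, ?_, ?_⟩
    · rintro _ hx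
      obtain ⟨i, rfl⟩ := List.mem_ofFn.1 hx
      exact FreeGroup.reduce_toWord _
    · intro x hx
      exact hb'.2 ▸ mk_mem_wordClosure hx
    · intro x hx
      exact hb'.2 ▸ mk_mem_wordClosure hx
    · simpa using hb'.1
  obtain ⟨A, hA, h⟩ := exists_computable_search hR hex
  refine ⟨A, hA, fun L => ⟨_, (A L).get, by simp, fun i => ?_, ?_⟩⟩
  · exact FreeGroup.IsReduced.of_reduce_eq ((h L).1.1 _ (List.get_mem _ _))
  · rw [isFreeBasisOf_iff, injective_lift_mk_iff, ← wordClosure_ofFn, List.ofFn_get]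
    exact ⟨(h L).2.2, le_antisymm (wordClosure_le.2 (h L).1.2) (wordClosure_le.2 (h L).2.1)⟩

/-! ### Edge paths in graphs given by lists of edges -/

/-- The initial vertex of an oriented edge, for a list of edges. -/
def dartSrc (E : List (ℕ × ℕ)) (d : ℕ × Bool) : ℕ :=
  if d.2 = true then (E.getD d.1 (0, 0)).1 else (E.getD d.1 (0, 0)).2

/-- The terminal vertex of an oriented edge, for a list of edges. -/
def dartTgt (E : List (ℕ × ℕ)) (d : ℕ × Bool) : ℕ :=
  if d.2 = true then (E.getD d.1 (0, 0)).2 else (E.getD d.1 (0, 0)).1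

/-- One step of following an edge path. -/
def walkStep (E : List (ℕ × ℕ)) (x : Option ℕ) (d : ℕ × Bool) : Option ℕ :=
  if d.1 < E.length ∧ x = some (dartSrc E d) then some (dartTgt E d) else none

/-- The word `w` is an edge path from `u` to `v`. -/
def EdgeWalk (E : List (ℕ × ℕ)) (u : ℕ) (w : NatWord) (v : ℕ) : Prop :=
  w.foldl (walkStep E) (some u) = some v

section

variable {α : Type*} [Primcodable α]

theorem ComputablePred.edgeWalk {f : α → List (ℕ × ℕ)} {g h : α → ℕ} {w : α → NatWord}
    (hf : Computable f) (hg : Computable g) (hw : Computable w) (hh : Computable h) :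
    ComputablePred fun a => EdgeWalk (f a) (g a) (w a) (h a) := by
  have hs : Primrec fun x : List (ℕ × ℕ) × Option ℕ × (ℕ × Bool) =>
      walkStep x.1 x.2.1 x.2.2 := by
    have h1 : Primrec fun x : List (ℕ × ℕ) × Option ℕ × (ℕ × Bool) => dartSrc x.1 x.2.2 := by
      unfold dartSrc
      exact Primrec.ite (Primrec.eq.comp (by fun_prop) (by fun_prop)) (by fun_prop) (by fun_prop)
    have h2 : Primrec fun x : List (ℕ × ℕ) × Option ℕ × (ℕ × Bool) => dartTgt x.1 x.2.2 := by
      unfold dartTgt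
      exact Primrec.ite (Primrec.eq.comp (by fun_prop) (by fun_prop)) (by fun_prop) (by fun_prop)
    unfold walkStep
    exact Primrec.ite (.and (Primrec.nat_lt.comp (by fun_prop) (by fun_prop))
      (Primrec.eq.comp (by fun_prop) (Primrec.option_some.comp h1)))
      (Primrec.option_some.comp h2) (by fun_prop)
  have : Primrec fun x : List (ℕ × ℕ) × ℕ × NatWord =>
      x.2.2.foldl (walkStep x.1) (some x.2.1) := by
    refine Primrec.list_foldl (f := fun x : List (ℕ × ℕ) × ℕ × NatWord => x.2.2)
      (g := fun x => some x.2.1) (by fun_prop) (Primrec.option_some.comp (by fun_prop))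
      (h := fun x y => walkStep x.1 y.1 y.2) ?_
    exact hs.comp (g := fun z : (List (ℕ × ℕ) × ℕ × NatWord) × Option ℕ × (ℕ × Bool) =>
      (z.1.1, z.2)) (by fun_prop)
  exact .eq (this.to_comp.comp (g := fun a => (f a, g a, w a)) (by fun_prop))
    (Computable.option_some.comp hh)

end

/-! ### Composition, reversal and cancellation of edge paths -/

namespace EdgeWalk

variable {E : List (ℕ × ℕ)} {u v v' : ℕ} {w w' : NatWord}

@[simp]
theorem nil_iff : EdgeWalk E u [] v ↔ u = v := by simp [EdgeWalk]

theorem foldl_none (E : List (ℕ × ℕ)) (w : NatWord) : w.foldl (walkStep E) none = none := by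
  induction w with
  | nil => rfl
  | cons d w ih => simpa [walkStep] using ih

@[simp]
theorem cons_iff {d : ℕ × Bool} : EdgeWalk E u (d :: w) v ↔
    d.1 < E.length ∧ dartSrc E d = u ∧ EdgeWalk E (dartTgt E d) w v := by
  rw [EdgeWalk, List.foldl_cons, walkStep]
  split_ifs with h
  · simp_all [EdgeWalk]
  · rw [foldl_none]
    simp only [Option.some.injEq, not_and] at h
    simp only [reduceCtorEq, false_iff]
    rintro ⟨h1, h2, -⟩
    exact h h1 h2.symm

theorem append_iff : EdgeWalk E u (w ++ w') v ↔
    ∃ x, EdgeWalk E u w x ∧ EdgeWalk E x w' v := by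
  induction w generalizing u with
  | nil => simp
  | cons d w ih => simp [ih, and_assoc]

theorem append {x : ℕ} (h : EdgeWalk E u w x) (h' : EdgeWalk E x w' v) :
    EdgeWalk E u (w ++ w') v := append_iff.2 ⟨x, h, h'⟩

theorem unique (h : EdgeWalk E u w v) (h' : EdgeWalk E u w v') : v = v' := by
  rw [EdgeWalk] at h h'
  simpa [h] using h'

theorem dartSrc_not (d : ℕ × Bool) : dartSrc E (d.1, !d.2) = dartTgt E d := by
  obtain ⟨i, _ | _⟩ := d <;> simp [dartSrc, dartTgt]

theorem dartTgt_not (d : ℕ × Bool) : dartTgt E (d.1, !d.2) = dartSrc E d := by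
  obtain ⟨i, _ | _⟩ := d <;> simp [dartSrc, dartTgt]

theorem invRev (h : EdgeWalk E u w v) : EdgeWalk E v (FreeGroup.invRev w) u := by
  induction w generalizing u with
  | nil => simpa using h.symm
  | cons d w ih =>
    rw [cons_iff] at h
    have : FreeGroup.invRev (d :: w) = FreeGroup.invRev w ++ [(d.1, !d.2)] := by
      simp [FreeGroup.invRev]
    rw [this]
    exact (ih h.2.2).append (by simp [dartSrc_not, dartTgt_not, h.1, h.2.1])

/-- An oriented edge followed by its reverse returns to the vertex where it began, so deleting the
pair leaves an edge path with the same ends. -/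
theorem red (h : EdgeWalk E u w v) (hr : FreeGroup.Red w w') : EdgeWalk E u w' v := by
  induction hr with
  | refl => exact h
  | tail _ hs ih =>
    cases hs with
    | @not L₁ L₂ a b =>
      rw [append_iff] at ih ⊢
      obtain ⟨x, h1, h2⟩ := ih
      have h3 := dartTgt_not (E := E) (a, b)
      simp only at h3
      simp only [cons_iff] at h2
      refine ⟨x, h1, ?_⟩
      rw [← h2.2.1, ← h3]
      exact h2.2.2.2.2

theorem reduce (h : EdgeWalk E u w v) : EdgeWalk E u (FreeGroup.reduce w) v :=
  h.red FreeGroup.reduce.red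

/-- Both words reduce to the same edge path, and an edge path with given start has only one end. -/
theorem eq_of_mk_eq (h : EdgeWalk E u w v) (h' : EdgeWalk E u w' v')
    (hw : FreeGroup.mk w = FreeGroup.mk w') : v = v' := by
  have := h.reduce
  rw [FreeGroup.reduce.sound hw] at this
  exact this.unique h'.reduce

end EdgeWalk

/-- The group of homotopy classes of closed edge paths, as a subgroup of the free group on the
edges. -/
def walkGroup (E : List (ℕ × ℕ)) (v : ℕ) : Subgroup (FreeGroup ℕ) where
  carrier := {x | ∃ w, EdgeWalk E v w v ∧ FreeGroup.mk w = x}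
  one_mem' := ⟨[], by simp, rfl⟩
  mul_mem' := by
    rintro _ _ ⟨w, hw, rfl⟩ ⟨w', hw', rfl⟩
    exact ⟨w ++ w', hw.append hw', by rw [FreeGroup.mul_mk]⟩
  inv_mem' := by
    rintro _ ⟨w, hw, rfl⟩
    exact ⟨_, hw.invRev, FreeGroup.inv_mk.symm⟩

/-- A reduced word is the reduction of every edge path that represents the same element, and
reduction preserves edge paths. -/
theorem EdgeWalk.of_mk_mem_walkGroup {E : List (ℕ × ℕ)} {v : ℕ} {w : NatWord}
    (hr : FreeGroup.IsReduced w) (h : FreeGroup.mk w ∈ walkGroup E v) : EdgeWalk E v w v := by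
  obtain ⟨w', hw', h⟩ := h
  have := hw'.reduce
  rwa [FreeGroup.reduce.sound h, hr.reduce_eq] at this

/-- Two vertices can be joined by an edge path. -/
def EdgeJoined (E : List (ℕ × ℕ)) (u v : ℕ) : Prop := ∃ w, EdgeWalk E u w v

theorem EdgeJoined.refl (E : List (ℕ × ℕ)) (u : ℕ) : EdgeJoined E u u := ⟨[], by simp⟩

theorem EdgeJoined.trans {E : List (ℕ × ℕ)} {u v w : ℕ} (h : EdgeJoined E u v)
    (h' : EdgeJoined E v w) : EdgeJoined E u w :=
  h.elim fun x h => h'.elim fun y h' => ⟨x ++ y, h.append h'⟩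

theorem edgeJoined_edge {E : List (ℕ × ℕ)} {i : ℕ} (hi : i < E.length) (b : Bool) :
    EdgeJoined E (dartSrc E (i, b)) (dartTgt E (i, b)) := ⟨[(i, b)], by simpa⟩

/-- A positive answer is certified by an edge path, a negative one by a finite set of vertices that
is closed under adjacency, contains the first vertex and omits the second. -/
theorem computablePred_edgeJoined :
    ComputablePred fun x : List (ℕ × ℕ) × ℕ × ℕ => EdgeJoined x.1 x.2.1 x.2.2 := by
  have hmem : ∀ {α : Type} [Primcodable α] {f : α → List ℕ} {g : α → ℕ}, Computable f →
      Computable g → ComputablePred fun a => g a ∈ f a := fun {α} _ {f g} hf hg =>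
    (ComputablePred.forall_mem (P := fun a b => ¬ b = g a) hf
      (.not (.eq (by fun_prop) (by fun_prop)))).not.of_eq fun a => by simp
  refine computablePred_of_certificates
    (R := fun x w => EdgeWalk x.1 x.2.1 w x.2.2)
    (S := fun x (C : List ℕ) => (x.2.1 ∈ C ∧ ¬ x.2.2 ∈ C) ∧ ∀ e ∈ x.1,
      (e.1 ∈ C → e.2 ∈ C) ∧ (e.2 ∈ C → e.1 ∈ C))
    (.edgeWalk (by fun_prop) (by fun_prop) (by fun_prop) (by fun_prop))
    (.and (.and (hmem (by fun_prop) (by fun_prop)) (.not (hmem (by fun_prop) (by fun_prop)))) ?_)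
    (fun x => Iff.rfl) (fun x => ?_)
  · exact .forall_mem (f := fun x : (List (ℕ × ℕ) × ℕ × ℕ) × List ℕ => x.1.1)
      (P := fun x e => (e.1 ∈ x.2 → e.2 ∈ x.2) ∧ (e.2 ∈ x.2 → e.1 ∈ x.2)) (by fun_prop)
      (.and (.imp (hmem (by fun_prop) (by fun_prop)) (hmem (by fun_prop) (by fun_prop)))
        (.imp (hmem (by fun_prop) (by fun_prop)) (hmem (by fun_prop) (by fun_prop))))
  · classical
    obtain ⟨E, u, v⟩ := x
    constructor
    · intro h
      have hE : ∀ e ∈ E, EdgeJoined E e.1 e.2 ∧ EdgeJoined E e.2 e.1 := fun e he => by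
        obtain ⟨i, hi, rfl⟩ := List.mem_iff_getElem.1 he
        have h1 := edgeJoined_edge hi true
        have h2 := edgeJoined_edge hi false
        simp only [dartSrc, dartTgt, List.getD_eq_getElem _ _ hi] at h1 h2
        exact ⟨by simpa using h1, by simpa using h2⟩
      -- The component of `u`. It is found among `u` and the end vertices of edges, so the list is
      -- finite although all natural numbers are allowed as vertices.
      refine ⟨(u :: E.flatMap fun e => [e.1, e.2]).filter fun x => EdgeJoined E u x, ⟨?_, ?_⟩, ?_⟩
      · simp [EdgeJoined.refl]
      · simp only [List.mem_filter, decide_eq_true_eq, not_and]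
        exact fun _ => h
      · intro e he
        simp only [List.mem_filter, decide_eq_true_eq]
        constructor
        · rintro ⟨-, h1⟩
          exact ⟨List.mem_cons_of_mem _ (List.mem_flatMap.2 ⟨e, he, by simp⟩),
            h1.trans (hE e he).1⟩
        · rintro ⟨-, h1⟩
          exact ⟨List.mem_cons_of_mem _ (List.mem_flatMap.2 ⟨e, he, by simp⟩),
            h1.trans (hE e he).2⟩
    · rintro ⟨C, ⟨hu, hv⟩, hC⟩ ⟨w, hw⟩
      refine hv ?_
      simp only at hw hu hC ⊢
      clear hv
      induction w generalizing u with
      | nil => rwa [EdgeWalk.nil_iff.1 hw] at hu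
      | cons d w ih =>
        rw [EdgeWalk.cons_iff] at hw
        refine ih _ ?_ hw.2.2
        obtain ⟨hd, hs, -⟩ := hw
        have := hC _ (List.getElem_mem hd)
        rw [← hs] at hu
        unfold dartSrc at hu
        unfold dartTgt
        rw [List.getD_eq_getElem _ _ hd] at hu ⊢
        split_ifs at hu ⊢
        · exact this.1 hu
        · exact this.2 hu

/-- Generators of the group of closed edge paths can be computed. -/
theorem exists_computable_walkGroup_generators : ∃ A : List (ℕ × ℕ) × ℕ → List NatWord,
    Computable A ∧ ∀ x, wordClosure (A x) = walkGroup x.1 x.2 := by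
  classical
  -- The output sought is a list of closed edge paths together with a word for each vertex. Each
  -- edge in the component, prefixed by the word of its initial vertex and followed by the inverse
  -- word of its terminal vertex, must lie in the generated subgroup. The auxiliary words need not
  -- be edge paths for this to imply generation; only the word at the base vertex must be empty.
  let R : List (ℕ × ℕ) × ℕ → List NatWord × List NatWord → Prop := fun x y =>
    ((∀ l ∈ y.1, EdgeWalk x.1 x.2 l x.2) ∧ y.2.getD x.2 [] = []) ∧
      ∀ i < x.1.length, EdgeJoined x.1 x.2 (x.1.getD i (0, 0)).1 →
        FreeGroup.mk (y.2.getD (x.1.getD i (0, 0)).1 [] ++ ((i, true) ::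
          FreeGroup.invRev (y.2.getD (x.1.getD i (0, 0)).2 []))) ∈ wordClosure y.1
  have hR : ComputablePred fun z : (List (ℕ × ℕ) × ℕ) × List NatWord × List NatWord =>
      R z.1 z.2 := by
    refine .and (.and ?_ (.eq (by fun_prop) (by fun_prop))) ?_
    · exact .forall_mem (f := fun z : (List (ℕ × ℕ) × ℕ) × List NatWord × List NatWord => z.2.1)
        (P := fun z l => EdgeWalk z.1.1 z.1.2 l z.1.2) (by fun_prop)
        (.edgeWalk (by fun_prop) (by fun_prop) (by fun_prop) (by fun_prop))
    · refine .forall_lt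
        (f := fun z : (List (ℕ × ℕ) × ℕ) × List NatWord × List NatWord => z.1.1.length)
        (P := fun z i => EdgeJoined z.1.1 z.1.2 (z.1.1.getD i (0, 0)).1 →
          FreeGroup.mk (z.2.2.getD (z.1.1.getD i (0, 0)).1 [] ++ ((i, true) ::
            FreeGroup.invRev (z.2.2.getD (z.1.1.getD i (0, 0)).2 []))) ∈ wordClosure z.2.1)
        (by fun_prop) (.imp ?_ ?_)
      · exact computablePred_edgeJoined.comp_fun
          (f := fun z : ((List (ℕ × ℕ) × ℕ) × List NatWord × List NatWord) × ℕ =>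
            (z.1.1.1, z.1.1.2, (z.1.1.1.getD z.2 (0, 0)).1)) (by fun_prop)
      · exact computablePred_mem_wordClosure.comp_fun
          (f := fun z : ((List (ℕ × ℕ) × ℕ) × List NatWord × List NatWord) × ℕ =>
            (z.1.2.1, z.1.2.2.getD (z.1.1.1.getD z.2 (0, 0)).1 [] ++ ((z.2, true) ::
            FreeGroup.invRev (z.1.2.2.getD (z.1.1.1.getD z.2 (0, 0)).2 [])))) (by fun_prop)
  have hex : ∀ x, ∃ y, R x y := by
    rintro ⟨E, v⟩
    -- An arbitrary edge path from `v` to each reachable vertex. No spanning tree is needed, because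
    -- redundant generators are harmless.
    let t : ℕ → NatWord := fun x =>
      if x = v then [] else if h : EdgeJoined E v x then h.choose else []
    have ht : ∀ x, EdgeJoined E v x → EdgeWalk E v (t x) x := fun x hx => by
      by_cases hxv : x = v
      · simp [t, hxv]
      · simp only [t, if_neg hxv, dif_pos hx]
        exact hx.choose_spec
    obtain ⟨N, hN⟩ := ((E.map Prod.fst).toFinset ∪ (E.map Prod.snd).toFinset).exists_nat_subset_range
    have hN' : ∀ e ∈ E, e.1 < N ∧ e.2 < N := fun e he =>
      ⟨Finset.mem_range.1 (hN (Finset.mem_union_left _ (by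
        rw [List.mem_toFinset]; exact List.mem_map_of_mem he))),
      Finset.mem_range.1 (hN (Finset.mem_union_right _ (by
        rw [List.mem_toFinset]; exact List.mem_map_of_mem he)))⟩
    have hT : ∀ x < N, ((List.range N).map t).getD x [] = t x := fun x hx => by
      rw [List.getD_eq_getElem _ _ (by simpa using hx)]
      simp
    let gen : ℕ → NatWord := fun i => t (E.getD i (0, 0)).1 ++ ((i, true) ::
          FreeGroup.invRev (t (E.getD i (0, 0)).2))
    refine ⟨(((List.range E.length).filter fun i => EdgeJoined E v (E.getD i (0, 0)).1).map gen,
      (List.range N).map t), ⟨?_, ?_⟩, ?_⟩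
    · intro l hl
      simp only [List.mem_map, List.mem_filter, List.mem_range, decide_eq_true_eq] at hl
      obtain ⟨i, ⟨hi, hj⟩, rfl⟩ := hl
      refine (ht _ hj).append ?_
      rw [EdgeWalk.cons_iff]
      refine ⟨hi, rfl, (ht _ (hj.trans ?_)).invRev⟩
      exact edgeJoined_edge hi true
    · by_cases hv : v < N
      · simp only [hT v hv]
        simp [t]
      · exact List.getD_eq_default _ _ (by simpa using hv)
    · intro i hi hj
      simp only at hi hj ⊢
      have := hN' _ (List.getElem_mem hi)
      rw [← List.getD_eq_getElem _ (0, 0) hi] at this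
      rw [hT _ this.1, hT _ this.2]
      refine mk_mem_wordClosure (List.mem_map.2 ⟨i, ?_, rfl⟩)
      simp only [List.mem_filter, List.mem_range, decide_eq_true_eq]
      exact ⟨hi, hj⟩
  obtain ⟨A, hA, h⟩ := exists_computable_search hR hex
  refine ⟨fun x => (A x).1, by fun_prop, fun x => le_antisymm ?_ ?_⟩
  · exact wordClosure_le.2 fun l hl => ⟨l, (h x).1.1 l hl, rfl⟩
  · obtain ⟨E, v⟩ := x
    obtain ⟨⟨-, htv⟩, hE⟩ := h (E, v)
    change walkGroup E v ≤ wordClosure (A (E, v)).1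
    generalize A (E, v) = y at htv hE ⊢
    obtain ⟨L, t⟩ := y
    simp only at htv hE
    -- Telescoping: between consecutive edges of a path the inserted words of the intermediate
    -- vertices cancel. For a closed path at `v` the outer words are empty.
    suffices key : ∀ w u x, EdgeJoined E v u → EdgeWalk E u w x →
        FreeGroup.mk (t.getD u []) * FreeGroup.mk w * (FreeGroup.mk (t.getD x []))⁻¹ ∈
          wordClosure L by
      rintro _ ⟨w, hw, rfl⟩
      have := key w v v (.refl E v) hw
      simpa only [htv, ← FreeGroup.one_eq_mk, inv_one, one_mul, mul_one] using this
    intro w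
    induction w with
    | nil =>
      intro u x _ hw
      rw [EdgeWalk.nil_iff.1 hw, ← FreeGroup.one_eq_mk, mul_one, mul_inv_cancel]
      exact one_mem _
    | cons d w ih =>
      intro u x hu hw
      rw [EdgeWalk.cons_iff] at hw
      obtain ⟨hd, rfl, hw⟩ := hw
      have hstep := edgeJoined_edge hd d.2
      have h2 := ih _ x (hu.trans hstep) hw
      have h1 : FreeGroup.mk (t.getD (dartSrc E d) []) * FreeGroup.mk [d] *
          (FreeGroup.mk (t.getD (dartTgt E d) []))⁻¹ ∈ wordClosure L := by
        obtain ⟨i, _ | _⟩ := d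
        · have := hE i hd (hu.trans hstep)
          rw [← FreeGroup.mul_mk, mk_cons, ← FreeGroup.inv_mk] at this
          have := inv_mem this
          simp only [mul_inv_rev, inv_inv] at this
          rw [mul_assoc] at this
          have hinv : (FreeGroup.mk [(i, true)])⁻¹ = FreeGroup.mk [(i, false)] := rfl
          simpa only [dartSrc, dartTgt, mul_assoc, hinv, Bool.false_eq_true, if_false] using this
        · have := hE i hd hu
          rw [← FreeGroup.mul_mk, mk_cons, ← FreeGroup.inv_mk] at this
          simpa only [dartSrc, dartTgt, mul_assoc, if_true] using this
      have := mul_mem h1 h2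
      rw [mk_cons]
      convert this using 1
      group

/-! ### Stallings graphs, combinatorially -/

/-- The one-letter words with given letters. -/
def labelWords (lab : List ℕ) : List NatWord := lab.map fun a => [(a, true)]

theorem Computable.labelWords {α : Type*} [Primcodable α] {f : α → List ℕ} (hf : Computable f) :
    Computable fun a => labelWords (f a) :=
  (Primrec.list_map (f := id) (g := fun (_ : List ℕ) a => [(a, true)]) Primrec.id
    (by unfold Primrec₂; fun_prop)).to_comp.comp hf

/-- The list `ES` of edges with `n` vertices and base vertex `p`, labels `lab` and vertex images `onV`
describes a Stallings graph over the graph with edges `EH` and `nH` vertices, for the subgroup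
generated by a list `L` of closed edge paths at `q`. -/
def IsStallingsCode (nH : ℕ) (EH : List (ℕ × ℕ)) (q : ℕ) (L : List NatWord)
    (n : ℕ) (ES : List (ℕ × ℕ)) (lab onV : List ℕ) (p : ℕ) : Prop :=
  (∀ e ∈ ES, e.1 < n ∧ e.2 < n) ∧
  (p < n ∧ onV.length = n ∧ lab.length = ES.length) ∧
  (∀ x ∈ onV, x < nH) ∧
  onV.getD p 0 = q ∧
  (∀ i < ES.length, lab.getD i 0 < EH.length ∧
    (EH.getD (lab.getD i 0) (0, 0)).1 = onV.getD (ES.getD i (0, 0)).1 0 ∧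
    (EH.getD (lab.getD i 0) (0, 0)).2 = onV.getD (ES.getD i (0, 0)).2 0) ∧
  (∀ x < n, EdgeJoined ES p x) ∧
  -- Valence at least two: two distinct edge ends at `x`. In the first alternative `i = j` is
  -- allowed, since a loop contributes both of its ends.
  (∀ x < n, ¬ x = p → ∃ i < ES.length, ∃ j < ES.length,
    ((ES.getD i (0, 0)).1 = x ∧ (ES.getD j (0, 0)).2 = x) ∨
    (¬ i = j ∧ (ES.getD i (0, 0)).1 = x ∧ (ES.getD j (0, 0)).1 = x) ∨
    (¬ i = j ∧ (ES.getD i (0, 0)).2 = x ∧ (ES.getD j (0, 0)).2 = x)) ∧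
  -- The folding condition, which gives local injectivity of the labelling map.
  (∀ i < ES.length, ∀ j < ES.length, lab.getD i 0 = lab.getD j 0 →
    ((ES.getD i (0, 0)).1 = (ES.getD j (0, 0)).1 ∨ (ES.getD i (0, 0)).2 = (ES.getD j (0, 0)).2) →
    i = j) ∧
  (walkGroup ES p).map (substHom (labelWords lab)) = wordClosure L

/-- The arguments of `IsStallingsCode`. -/
abbrev StallingsArgs : Type :=
  (ℕ × List (ℕ × ℕ) × ℕ × List NatWord) × ℕ × List (ℕ × ℕ) × List ℕ × List ℕ × ℕ

theorem computablePred_isStallingsCode : ComputablePred fun x : StallingsArgs =>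
      IsStallingsCode x.1.1 x.1.2.1 x.1.2.2.1 x.1.2.2.2 x.2.1 x.2.2.1 x.2.2.2.1 x.2.2.2.2.1
        x.2.2.2.2.2 := by
  refine .and ?_ (.and ?_ (.and ?_ (.and ?_ (.and ?_ (.and ?_ (.and ?_ (.and ?_ ?_)))))))
  · exact .forall_mem (f := fun x : StallingsArgs => x.2.2.1) (P := fun x e => e.1 < x.2.1 ∧ e.2 < x.2.1)
      (by fun_prop) (.and (.lt (by fun_prop) (by fun_prop)) (.lt (by fun_prop) (by fun_prop)))
  · exact .and (.lt (by fun_prop) (by fun_prop)) (.and (.eq (by fun_prop) (by fun_prop))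
      (.eq (by fun_prop) (by fun_prop)))
  · exact .forall_mem (f := fun x : StallingsArgs => x.2.2.2.2.1) (P := fun x e => e < x.1.1)
      (by fun_prop) (.lt (by fun_prop) (by fun_prop))
  · exact .eq (by fun_prop) (by fun_prop)
  · exact .forall_lt (f := fun x : StallingsArgs => x.2.2.1.length)
      (P := fun x i => x.2.2.2.1.getD i 0 < x.1.2.1.length ∧
        (x.1.2.1.getD (x.2.2.2.1.getD i 0) (0, 0)).1 =
          x.2.2.2.2.1.getD (x.2.2.1.getD i (0, 0)).1 0 ∧
        (x.1.2.1.getD (x.2.2.2.1.getD i 0) (0, 0)).2 =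
          x.2.2.2.2.1.getD (x.2.2.1.getD i (0, 0)).2 0)
      (by fun_prop) (.and (.lt (by fun_prop) (by fun_prop)) (.and (.eq (by fun_prop) (by fun_prop))
        (.eq (by fun_prop) (by fun_prop))))
  · exact .forall_lt (f := fun x : StallingsArgs => x.2.1)
      (P := fun x i => EdgeJoined x.2.2.1 x.2.2.2.2.2 i)
      (by fun_prop) (computablePred_edgeJoined.comp_fun
        (f := fun y : StallingsArgs × ℕ => (y.1.2.2.1, y.1.2.2.2.2.2, y.2)) (by fun_prop))
  · refine .forall_lt (f := fun x : StallingsArgs => x.2.1)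
      (P := fun x v => ¬ v = x.2.2.2.2.2 → ∃ i < x.2.2.1.length, ∃ j < x.2.2.1.length,
        ((x.2.2.1.getD i (0, 0)).1 = v ∧ (x.2.2.1.getD j (0, 0)).2 = v) ∨
        (¬ i = j ∧ (x.2.2.1.getD i (0, 0)).1 = v ∧ (x.2.2.1.getD j (0, 0)).1 = v) ∨
        (¬ i = j ∧ (x.2.2.1.getD i (0, 0)).2 = v ∧ (x.2.2.1.getD j (0, 0)).2 = v))
      (by fun_prop) (.imp (.not (.eq (by fun_prop) (by fun_prop))) ?_)
    refine .exists_lt (f := fun y : StallingsArgs × ℕ => y.1.2.2.1.length)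
      (P := fun y i => ∃ j < y.1.2.2.1.length,
        ((y.1.2.2.1.getD i (0, 0)).1 = y.2 ∧ (y.1.2.2.1.getD j (0, 0)).2 = y.2) ∨
        (¬ i = j ∧ (y.1.2.2.1.getD i (0, 0)).1 = y.2 ∧ (y.1.2.2.1.getD j (0, 0)).1 = y.2) ∨
        (¬ i = j ∧ (y.1.2.2.1.getD i (0, 0)).2 = y.2 ∧ (y.1.2.2.1.getD j (0, 0)).2 = y.2))
      (by fun_prop) ?_
    refine .exists_lt (f := fun y : (StallingsArgs × ℕ) × ℕ => y.1.1.2.2.1.length)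
      (P := fun y j =>
        ((y.1.1.2.2.1.getD y.2 (0, 0)).1 = y.1.2 ∧ (y.1.1.2.2.1.getD j (0, 0)).2 = y.1.2) ∨
        (¬ y.2 = j ∧ (y.1.1.2.2.1.getD y.2 (0, 0)).1 = y.1.2 ∧
          (y.1.1.2.2.1.getD j (0, 0)).1 = y.1.2) ∨
        (¬ y.2 = j ∧ (y.1.1.2.2.1.getD y.2 (0, 0)).2 = y.1.2 ∧
          (y.1.1.2.2.1.getD j (0, 0)).2 = y.1.2))
      (by fun_prop) ?_
    exact .or (.and (.eq (by fun_prop) (by fun_prop)) (.eq (by fun_prop) (by fun_prop)))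
      (.or (.and (.not (.eq (by fun_prop) (by fun_prop))) (.and (.eq (by fun_prop) (by fun_prop))
        (.eq (by fun_prop) (by fun_prop)))) (.and (.not (.eq (by fun_prop) (by fun_prop)))
        (.and (.eq (by fun_prop) (by fun_prop)) (.eq (by fun_prop) (by fun_prop)))))
  · refine .forall_lt (f := fun x : StallingsArgs => x.2.2.1.length)
      (P := fun x i => ∀ j < x.2.2.1.length, x.2.2.2.1.getD i 0 = x.2.2.2.1.getD j 0 →
        ((x.2.2.1.getD i (0, 0)).1 = (x.2.2.1.getD j (0, 0)).1 ∨
          (x.2.2.1.getD i (0, 0)).2 = (x.2.2.1.getD j (0, 0)).2) → i = j)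
      (by fun_prop) ?_
    refine .forall_lt (f := fun y : StallingsArgs × ℕ => y.1.2.2.1.length)
      (P := fun y j => y.1.2.2.2.1.getD y.2 0 = y.1.2.2.2.1.getD j 0 →
        ((y.1.2.2.1.getD y.2 (0, 0)).1 = (y.1.2.2.1.getD j (0, 0)).1 ∨
          (y.1.2.2.1.getD y.2 (0, 0)).2 = (y.1.2.2.1.getD j (0, 0)).2) → y.2 = j)
      (by fun_prop) ?_
    exact .imp (.eq (by fun_prop) (by fun_prop)) (.imp (.or (.eq (by fun_prop) (by fun_prop))
      (.eq (by fun_prop) (by fun_prop))) (.eq (by fun_prop) (by fun_prop)))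
  -- Equality of the two subgroups is decided by testing the generators of each for membership in
  -- the other.
  · obtain ⟨A, hA, hA'⟩ := exists_computable_walkGroup_generators
    have h1 : Computable fun x : StallingsArgs => labelWords x.2.2.2.1 := .labelWords (by fun_prop)
    have h2 : Computable fun x : StallingsArgs => A (x.2.2.1, x.2.2.2.2.2) := by fun_prop
    have : ComputablePred fun x : StallingsArgs =>
        (∀ l ∈ (A (x.2.2.1, x.2.2.2.2.2)).map (substWord (labelWords x.2.2.2.1)),
          FreeGroup.mk l ∈ wordClosure x.1.2.2.2) ∧
        ∀ l ∈ x.1.2.2.2, FreeGroup.mk l ∈ wordClosure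
          ((A (x.2.2.1, x.2.2.2.2.2)).map (substWord (labelWords x.2.2.2.1))) := by
      refine .and ?_ ?_
      · exact .forall_mem (f := fun x : StallingsArgs => (A (x.2.2.1, x.2.2.2.2.2)).map
            (substWord (labelWords x.2.2.2.1)))
          (P := fun x l => FreeGroup.mk l ∈ wordClosure x.1.2.2.2)
          (by fun_prop) (computablePred_mem_wordClosure.comp_fun
            (f := fun y : StallingsArgs × NatWord => (y.1.1.2.2.2, y.2)) (by fun_prop))
      · refine .forall_mem (f := fun x : StallingsArgs => x.1.2.2.2)
          (P := fun x l => FreeGroup.mk l ∈ wordClosure ((A (x.2.2.1, x.2.2.2.2.2)).map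
            (substWord (labelWords x.2.2.2.1))))
          (by fun_prop) (computablePred_mem_wordClosure.comp_fun
            (f := fun y : StallingsArgs × NatWord => ((A (y.1.2.2.1, y.1.2.2.2.2.2)).map
            (substWord (labelWords y.1.2.2.2.1)), y.2)) ?_)
        have h3 : Computable fun x : StallingsArgs => (A (x.2.2.1, x.2.2.2.2.2)).map
            (substWord (labelWords x.2.2.2.1)) := by fun_prop
        exact (h3.comp Computable.fst).prodMk_fun (by fun_prop)
    refine this.of_eq fun x => ?_
    rw [← hA' (x.2.2.1, x.2.2.2.2.2), map_substHom_wordClosure, ← wordClosure_le,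
      ← wordClosure_le, ← le_antisymm_iff]

theorem substWord_append (φ : List NatWord) (w w' : NatWord) :
    substWord φ (w ++ w') = substWord φ w ++ substWord φ w' := List.flatMap_append

theorem substWord_labelWords_singleton {lab : List ℕ} {i : ℕ} (hi : i < lab.length) (b : Bool) :
    substWord (labelWords lab) [(i, b)] = [(lab.getD i 0, b)] := by
  have : (labelWords lab).getD i [] = [(lab.getD i 0, true)] := by
    rw [labelWords, List.getD_eq_getElem _ _ (by simpa), List.getElem_map,
      List.getD_eq_getElem _ _ hi]
  rw [substWord]
  simp only [List.flatMap_cons, List.flatMap_nil, this]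
  cases b <;> rfl

/-! ### The labelled graph of an action of the free group -/

namespace StallingsGraph

variable {Y : Type*} [MulAction (FreeGroup ℕ) Y]

/-- The terminal vertex of an edge in the graph of an action. -/
def actTgt (x : Y × ℕ) : Y := (FreeGroup.of x.2)⁻¹ • x.1

/-- The edge of the graph of an action traversed when a letter is read at a point. -/
def edgeOf (y : Y) (d : ℕ × Bool) : Y × ℕ :=
  if d.2 = true then (y, d.1) else (FreeGroup.of d.1 • y, d.1)

/-- The initial vertex of an oriented edge in the graph of an action. -/
def actSrc (x : Y × ℕ) (b : Bool) : Y := if b = true then x.1 else actTgt x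

theorem actSrc_edgeOf (y : Y) (d : ℕ × Bool) : actSrc (edgeOf y d) d.2 = y := by
  obtain ⟨a, _ | _⟩ := d <;> simp [edgeOf, actSrc, actTgt]

theorem actSrc_not (x : Y × ℕ) (b : Bool) :
    actSrc x (!b) = (FreeGroup.mk [(x.2, b)])⁻¹ • actSrc x b := by
  cases b
  · have : FreeGroup.mk [(x.2, false)] = (FreeGroup.of x.2)⁻¹ := rfl
    simp [actSrc, actTgt, this]
  · rfl

theorem edgeOf_snd (y : Y) (d : ℕ × Bool) : (edgeOf y d).2 = d.1 := by
  obtain ⟨a, _ | _⟩ := d <;> simp [edgeOf]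

theorem actSrc_not_edgeOf (y : Y) (d : ℕ × Bool) :
    actSrc (edgeOf y d) (!d.2) = (FreeGroup.mk [d])⁻¹ • y := by
  rw [actSrc_not, edgeOf_snd, actSrc_edgeOf]

/-- Letters act by bijections, so an edge is determined by its label and either end. Every subgraph
of the graph of an action is therefore folded. -/
theorem eq_of_actSrc_eq {x x' : Y × ℕ} (h : x.2 = x'.2) {b : Bool}
    (h' : actSrc x b = actSrc x' b) : x = x' := by
  cases b
  · have h'' : (FreeGroup.of x.2)⁻¹ • x.1 = (FreeGroup.of x'.2)⁻¹ • x'.1 := h'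
    rw [h] at h''
    exact Prod.ext (MulAction.injective _ h'') h
  · exact Prod.ext h' h

end StallingsGraph

open StallingsGraph in
/-- A Stallings graph exists for every finitely generated group of closed edge paths: the subgraph
of the graph of cosets which is spanned by the reduced generators. -/
theorem exists_isStallingsCode {nH : ℕ} {EH : List (ℕ × ℕ)} {q : ℕ} {L : List NatWord}
    (hEH : ∀ e ∈ EH, e.1 < nH ∧ e.2 < nH) (hq : q < nH) (hL : ∀ l ∈ L, EdgeWalk EH q l q) :
    ∃ n ES lab onV p, IsStallingsCode nH EH q L n ES lab onV p := by
  classical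
  let K := wordClosure L
  let Y := FreeGroup ℕ ⧸ K
  let y0 : Y := ((1 : FreeGroup ℕ) : Y)
  -- The vertex reached from the base by reading `P`. The inverse turns the left action into reading
  -- from left to right: appending a letter to `P` applies the inverse of that letter, see
  -- `hpt_snoc`.
  let pt : NatWord → Y := fun P => (FreeGroup.mk P)⁻¹ • y0
  have hpt_eq : ∀ P P', pt P = pt P' ↔ FreeGroup.mk P * (FreeGroup.mk P')⁻¹ ∈ K := fun P P' => by
    change (((FreeGroup.mk P)⁻¹ * 1 : FreeGroup ℕ) : Y) =
      (((FreeGroup.mk P')⁻¹ * 1 : FreeGroup ℕ) : Y) ↔ _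
    rw [QuotientGroup.eq, mul_one, mul_one, inv_inv]
  have hpt_nil : pt [] = y0 := by simp [pt, ← FreeGroup.one_eq_mk]
  have hpt_snoc : ∀ P d, pt (P ++ [d]) = (FreeGroup.mk [d])⁻¹ • pt P := fun P d => by
    simp only [pt]
    rw [← FreeGroup.mul_mk, mul_inv_rev, mul_smul]
  have hKw : K ≤ walkGroup EH q := wordClosure_le.2 fun l hl => ⟨l, hL l hl, rfl⟩
  -- The map to the vertices of the target graph. It is well defined: two edge paths reaching the
  -- same coset differ on the left by an element of `K`, which is represented by a closed edge path
  -- at `q`, so they end at the same vertex. Cosets not reached by edge paths get the value `0`.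
  obtain ⟨ν, hν⟩ : ∃ ν : Y → ℕ, ∀ P v, EdgeWalk EH q P v → ν (pt P) = v := by
    refine ⟨fun y => if h : ∃ v P, EdgeWalk EH q P v ∧ pt P = y then h.choose else 0,
      fun P v hP => ?_⟩
    have h : ∃ v P', EdgeWalk EH q P' v ∧ pt P' = pt P := ⟨v, P, hP, rfl⟩
    simp only [dif_pos h]
    obtain ⟨P', hP', hPP⟩ := h.choose_spec
    obtain ⟨k, hk, hk'⟩ := hKw ((hpt_eq _ _).1 hPP)
    refine hP'.eq_of_mk_eq (hk.append hP) ?_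
    rw [← FreeGroup.mul_mk, hk']
    group
  -- the edges and the vertices
  let EL : List (Y × ℕ) := (L.flatMap fun l => (List.range (FreeGroup.reduce l).length).map fun n =>
    edgeOf (pt ((FreeGroup.reduce l).take n)) ((FreeGroup.reduce l).getD n (0, true))).dedup
  let XL : List Y := (y0 :: L.flatMap fun l =>
    (List.range ((FreeGroup.reduce l).length + 1)).map fun n =>
      pt ((FreeGroup.reduce l).take n)).dedup
  have hEL : ∀ x, x ∈ EL ↔ ∃ l ∈ L, ∃ P d Q, FreeGroup.reduce l = P ++ d :: Q ∧
      edgeOf (pt P) d = x := fun x => by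
    simp only [EL, List.mem_dedup, List.mem_flatMap, List.mem_map, List.mem_range]
    constructor
    · rintro ⟨l, hl, n, hn, rfl⟩
      refine ⟨l, hl, _, _, (FreeGroup.reduce l).drop (n + 1), ?_, rfl⟩
      rw [List.getD_eq_getElem _ _ hn, ← List.drop_eq_getElem_cons hn, List.take_append_drop]
    · rintro ⟨l, hl, P, d, Q, h, rfl⟩
      refine ⟨l, hl, P.length, by simp [h], ?_⟩
      rw [h]
      simp
  have hXL : ∀ y, y ∈ XL ↔ y = y0 ∨ ∃ l ∈ L, ∃ P Q, FreeGroup.reduce l = P ++ Q ∧ pt P = y :=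
      fun y => by
    simp only [XL, List.mem_dedup, List.mem_cons, List.mem_flatMap, List.mem_map, List.mem_range]
    refine or_congr_right ⟨?_, ?_⟩
    · rintro ⟨l, hl, n, hn, rfl⟩
      exact ⟨l, hl, _, (FreeGroup.reduce l).drop n, (List.take_append_drop _ _).symm, rfl⟩
    · rintro ⟨l, hl, P, Q, h, rfl⟩
      exact ⟨l, hl, P.length, by simp [h], by rw [h]; simp⟩
  have hy0 : y0 ∈ XL := (hXL _).2 (.inl rfl)
  have hEX : ∀ x ∈ EL, ∀ b, actSrc x b ∈ XL := by
    intro x hx b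
    obtain ⟨l, hl, P, d, Q, h, rfl⟩ := (hEL x).1 hx
    rw [hXL]
    right
    by_cases hb : b = d.2
    · rw [hb, actSrc_edgeOf]
      exact ⟨l, hl, P, d :: Q, h, rfl⟩
    · rw [Bool.eq_not_of_ne hb, actSrc_not_edgeOf, ← hpt_snoc]
      exact ⟨l, hl, P ++ [d], Q, by simp [h], rfl⟩
  have hνlt : ∀ y ∈ XL, ν y < nH := by
    intro y hy
    have key : ∀ P v, EdgeWalk EH q P v → v < nH := by
      intro P
      suffices ∀ u v, u < nH → EdgeWalk EH u P v → v < nH from fun v h => this q v hq h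
      induction P with
      | nil => intro u v hu h; rwa [EdgeWalk.nil_iff.1 h] at hu
      | cons d P ih =>
        intro u v hu h
        rw [EdgeWalk.cons_iff] at h
        refine ih _ v ?_ h.2.2
        have := hEH _ (List.getElem_mem h.1)
        rw [dartTgt, List.getD_eq_getElem _ _ h.1]
        split_ifs
        · exact this.2
        · exact this.1
    rcases (hXL y).1 hy with rfl | ⟨l, hl, P, Q, h, rfl⟩
    · rw [← hpt_nil, hν [] q (by simp)]
      exact hq
    · have hw := (hL l hl).reduce
      rw [h, EdgeWalk.append_iff] at hw
      obtain ⟨v, hv, -⟩ := hw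
      rw [hν P v hv]
      exact key P v hv
  let c : Y → ℕ := fun y => XL.idxOf y
  have hc_lt : ∀ y ∈ XL, c y < XL.length := fun y hy => List.idxOf_lt_length_iff.2 hy
  have hc_get : ∀ y (hy : y ∈ XL), XL[c y]'(hc_lt y hy) = y := fun y hy => List.getElem_idxOf _
  have hc_inj : ∀ y ∈ XL, ∀ y' ∈ XL, c y = c y' → y = y' := fun y hy y' hy' h => by
    rw [← hc_get y hy, ← hc_get y' hy']
    simp only [h]
  have hc_surj : ∀ x < XL.length, ∃ y ∈ XL, c y = x := fun x hx =>
    ⟨XL[x], List.getElem_mem hx, (List.nodup_dedup _).idxOf_getElem x hx⟩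
  let ES : List (ℕ × ℕ) := EL.map fun x => (c (actSrc x true), c (actSrc x false))
  let lab : List ℕ := EL.map Prod.snd
  let onV : List ℕ := XL.map ν
  have hES : ∀ i (hi : i < EL.length), ES.getD i (0, 0) =
      (c (actSrc EL[i] true), c (actSrc EL[i] false)) := fun i hi => by
    rw [List.getD_eq_getElem _ _ (by simpa [ES] using hi), List.getElem_map]
  have hlab : ∀ i (hi : i < EL.length), lab.getD i 0 = EL[i].2 := fun i hi => by
    rw [List.getD_eq_getElem _ _ (by simpa [lab] using hi), List.getElem_map]
  have honV : ∀ y ∈ XL, onV.getD (c y) 0 = ν y := fun y hy => by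
    rw [List.getD_eq_getElem _ _ (by simpa [onV] using hc_lt y hy), List.getElem_map,
      hc_get y hy]
  have hlen : ES.length = EL.length := by simp [ES]
  have hdart : ∀ i (hi : i < EL.length) b, dartSrc ES (i, b) = c (actSrc EL[i] b) := by
    intro i hi b
    cases b <;> simp only [dartSrc, hES i hi] <;> rfl
  have hdart' : ∀ i (hi : i < EL.length) b, dartTgt ES (i, b) = c (actSrc EL[i] (!b)) := by
    intro i hi b
    cases b <;> simp only [dartTgt, hES i hi] <;> rfl
  have hget : ∀ x ∈ EL, ∃ i, ∃ hi : i < EL.length, EL[i] = x := fun x hx =>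
    List.mem_iff_getElem.1 hx
  -- A prefix of a reduced generator lifts to the graph letter by letter, since exactly the edges
  -- crossed by such words were included.
  have lift : ∀ l ∈ L, ∀ P Q, FreeGroup.reduce l = P ++ Q → ∃ P', EdgeWalk ES (c y0) P' (c (pt P)) ∧
      substWord (labelWords lab) P' = P := by
    intro l hl P
    induction P using List.reverseRecOn with
    | nil => exact fun Q _ => ⟨[], by rw [hpt_nil]; simp, rfl⟩
    | append_singleton P d ih =>
      intro Q h
      have h' : FreeGroup.reduce l = P ++ d :: Q := by simpa using h
      obtain ⟨P', h1, h2⟩ := ih (d :: Q) h'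
      obtain ⟨i, hi, hx⟩ := hget _ ((hEL _).2 ⟨l, hl, P, d, Q, h', rfl⟩)
      refine ⟨P' ++ [(i, d.2)], h1.append ?_, ?_⟩
      · rw [EdgeWalk.cons_iff, hdart i hi, hdart' i hi, hx, actSrc_edgeOf, actSrc_not_edgeOf,
          hpt_snoc, EdgeWalk.nil_iff]
        exact ⟨by rw [hlen]; exact hi, rfl, rfl⟩
      · rw [substWord_append, h2, substWord_labelWords_singleton (by simpa [lab] using hi),
          hlab i hi, hx, edgeOf_snd]
  -- Conversely, following an edge path in the graph acts on its starting coset by the inverse of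
  -- its label word.
  have read : ∀ W y x, y ∈ XL → EdgeWalk ES (c y) W x → ∃ y' ∈ XL, x = c y' ∧
      y' = (FreeGroup.mk (substWord (labelWords lab) W))⁻¹ • y := by
    intro W
    induction W with
    | nil =>
      intro y x hy h
      exact ⟨y, hy, (EdgeWalk.nil_iff.1 h).symm, by simp [substWord, ← FreeGroup.one_eq_mk]⟩
    | cons d W ih =>
      intro y x hy h
      obtain ⟨i, b⟩ := d
      rw [EdgeWalk.cons_iff, hlen] at h
      obtain ⟨hi, h1, h2⟩ := h
      simp only at hi
      rw [hdart i hi] at h1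
      rw [hdart' i hi] at h2
      have hm := List.getElem_mem hi
      have hy' := hc_inj _ (hEX _ hm b) y hy h1
      obtain ⟨y', h3, h4, h5⟩ := ih _ x (hEX _ hm (!b)) h2
      refine ⟨y', h3, h4, ?_⟩
      have hs : substWord (labelWords lab) ((i, b) :: W) =
          substWord (labelWords lab) [(i, b)] ++ substWord (labelWords lab) W :=
        substWord_append _ [(i, b)] W
      rw [h5, actSrc_not, hy', hs,
        substWord_labelWords_singleton (by simpa [lab] using hi), hlab i hi, ← FreeGroup.mul_mk,
        mul_inv_rev, mul_smul]
  refine ⟨XL.length, ES, lab, onV, c y0, ?_, ⟨hc_lt _ hy0, by simp [onV], by simp [lab, ES]⟩,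
    ?_, ?_, ?_, ?_, ?_, ?_, ?_⟩
  · intro e he
    obtain ⟨x, hx, rfl⟩ := List.mem_map.1 he
    exact ⟨hc_lt _ (hEX x hx _), hc_lt _ (hEX x hx _)⟩
  · intro x hx
    obtain ⟨y, hy, rfl⟩ := List.mem_map.1 hx
    exact hνlt y hy
  · rw [honV _ hy0, ← hpt_nil, hν [] q (by simp)]
  · intro i hi
    rw [hlen] at hi
    have hm := List.getElem_mem hi
    rw [hlab i hi, hES i hi, honV _ (hEX _ hm _), honV _ (hEX _ hm _)]
    obtain ⟨l, hl, P, d, Q, h, hx⟩ := (hEL _).1 hm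
    rw [← hx]
    have hw := (hL l hl).reduce
    rw [h, EdgeWalk.append_iff] at hw
    obtain ⟨v, hv, hw⟩ := hw
    rw [EdgeWalk.cons_iff] at hw
    have hP := hν P v hv
    have hP' := hν (P ++ [d]) (dartTgt EH d) (hv.append (by simp [hw.1, hw.2.1]))
    rw [hpt_snoc, ← actSrc_not_edgeOf] at hP'
    have hs := actSrc_edgeOf (pt P) d
    rw [edgeOf_snd]
    refine ⟨hw.1, ?_⟩
    have h2 := hw.2.1
    obtain ⟨a, _ | _⟩ := d
    · simp only [Bool.not_false] at hP' hs
      rw [hP', hs, hP]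
      exact ⟨rfl, h2⟩
    · simp only [Bool.not_true] at hP' hs
      rw [hP', hs, hP]
      exact ⟨h2, rfl⟩
  · intro x hx
    obtain ⟨y, hy, rfl⟩ := hc_surj x hx
    rcases (hXL y).1 hy with rfl | ⟨l, hl, P, Q, h, rfl⟩
    · exact .refl _ _
    · obtain ⟨P', hP', -⟩ := lift l hl P Q h
      exact ⟨P', hP'⟩
  · intro x hx hne
    obtain ⟨y, hy, rfl⟩ := hc_surj x hx
    rcases (hXL y).1 hy with rfl | ⟨l, hl, P, Q, h, rfl⟩
    · exact absurd rfl hne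
    · rcases List.eq_nil_or_concat P with rfl | ⟨P', d, rfl⟩
      · exact absurd (by rw [hpt_nil]) hne
      rw [List.concat_eq_append] at h hne hy ⊢
      cases Q with
      | nil =>
        -- If the prefix is the whole generator, its coset is the base coset. Thus a vertex other
        -- than the base is interior to some reduced generator, and the edges before and after it
        -- provide the two edge ends.
        refine absurd ?_ hne
        rw [List.append_nil] at h
        congr 1
        rw [← hpt_nil, hpt_eq, ← h, FreeGroup.reduce.self, ← FreeGroup.one_eq_mk, inv_one, mul_one]
        exact mk_mem_wordClosure hl
      | cons d' Q =>
        obtain ⟨i, hi, hxi⟩ := hget _ ((hEL _).2 ⟨l, hl, P', d, d' :: Q, by simpa using h, rfl⟩)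
        obtain ⟨j, hj, hxj⟩ := hget _ ((hEL _).2 ⟨l, hl, P' ++ [d], d', Q, h, rfl⟩)
        have hred : ¬ (d.1 = d'.1 ∧ d'.2 = !d.2) := by
          rintro ⟨h1, h2⟩
          obtain ⟨a, b⟩ := d
          obtain ⟨a', b'⟩ := d'
          simp only at h1 h2
          subst h1 h2
          exact FreeGroup.reduce.not (L₁ := l) (L₂ := P') (L₃ := Q) (x := a) (b := b)
            (by simpa using h)
        -- The two edges meet the vertex with the same kind of end exactly when the letters have
        -- opposite signs; then reducedness makes their labels differ. For equal signs one edge ends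
        -- and the other begins there, and they may coincide as a loop.
        have hij : d'.2 = (!d.2) → ¬ i = j := by
          rintro h2 rfl
          refine hred ⟨?_, h2⟩
          have h1 := congrArg Prod.snd (hxi.symm.trans hxj)
          rwa [edgeOf_snd, edgeOf_snd] at h1
        have h1 := actSrc_not_edgeOf (pt P') d
        have h2 := actSrc_edgeOf (pt (P' ++ [d])) d'
        rw [← hpt_snoc, ← hxi] at h1
        rw [← hxj] at h2
        clear hxi hxj
        simp only [hlen]
        obtain ⟨a, _ | _⟩ := d <;> obtain ⟨a', _ | _⟩ := d' <;>
          simp only [Bool.not_false, Bool.not_true] at h1 h2 hij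
        · exact ⟨i, hi, j, hj, .inl (by rw [hES i hi, hES j hj, h1, h2]; exact ⟨rfl, rfl⟩)⟩
        · exact ⟨i, hi, j, hj, .inr (.inl (by
            rw [hES i hi, hES j hj, h1, h2]; exact ⟨hij trivial, rfl, rfl⟩))⟩
        · exact ⟨i, hi, j, hj, .inr (.inr (by
            rw [hES i hi, hES j hj, h1, h2]; exact ⟨hij trivial, rfl, rfl⟩))⟩
        · exact ⟨j, hj, i, hi, .inl (by rw [hES i hi, hES j hj, h1, h2]; exact ⟨rfl, rfl⟩)⟩
  · intro i hi j hj hl h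
    rw [hlen] at hi hj
    rw [hlab i hi, hlab j hj] at hl
    rw [hES i hi, hES j hj] at h
    have hmi := List.getElem_mem hi
    have hmj := List.getElem_mem hj
    have : EL[i] = EL[j] := by
      rcases h with h | h
      · exact eq_of_actSrc_eq hl (hc_inj _ (hEX _ hmi _) _ (hEX _ hmj _) h)
      · exact eq_of_actSrc_eq hl (hc_inj _ (hEX _ hmi _) _ (hEX _ hmj _) h)
    exact (List.Nodup.getElem_inj_iff (List.nodup_dedup _)).1 this
  · refine le_antisymm ?_ (wordClosure_le.2 fun l hl => ?_)
    · rw [Subgroup.map_le_iff_le_comap]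
      rintro _ ⟨W, hW, rfl⟩
      rw [Subgroup.mem_comap, ← mk_substWord]
      obtain ⟨y', hy', h1, h2⟩ := read W y0 _ hy0 hW
      have h3 := hc_inj _ hy0 _ hy' h1
      rw [← h3] at h2
      have := (hpt_eq [] _).1 (hpt_nil.trans h2)
      rw [← FreeGroup.one_eq_mk, one_mul, inv_mem_iff] at this
      exact this
    · obtain ⟨P', hP', hP''⟩ := lift l hl _ [] (List.append_nil _).symm
      have : pt (FreeGroup.reduce l) = y0 := by
        rw [← hpt_nil, hpt_eq, FreeGroup.reduce.self, ← FreeGroup.one_eq_mk, inv_one, mul_one]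
        exact mk_mem_wordClosure hl
      rw [this] at hP'
      refine ⟨FreeGroup.mk P', ⟨P', hP', rfl⟩, ?_⟩
      rw [← mk_substWord, hP'', FreeGroup.reduce.self]

/-! ### The realization of a graph -/

/-! ### Functoriality of path classes and transport along equalities of end points -/

namespace Path.Homotopic.Quotient

variable {X Y : Type*} [TopologicalSpace X] [TopologicalSpace Y]

theorem map_trans {x y z : X} (p : Path.Homotopic.Quotient x y) (q : Path.Homotopic.Quotient y z)
    (f : C(X, Y)) : (p.trans q).map f = (p.map f).trans (q.map f) := by
  induction p using Path.Homotopic.Quotient.ind with | mk p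
  induction q using Path.Homotopic.Quotient.ind with | mk q
  exact congrArg mk (Path.map_trans p q f.continuous)

theorem map_symm {x y : X} (p : Path.Homotopic.Quotient x y) (f : C(X, Y)) :
    p.symm.map f = (p.map f).symm := by
  induction p using Path.Homotopic.Quotient.ind with | mk p
  rfl

theorem cast_trans_cast {x y z x' y' z' : X} (p : Path.Homotopic.Quotient x y)
    (q : Path.Homotopic.Quotient y z) (hx : x' = x) (hy : y' = y) (hz : z' = z) :
    (p.cast hx hy).trans (q.cast hy hz) = (p.trans q).cast hx hz := by
  subst hx hy hz
  simp

theorem cast_symm {x y x' y' : X} (p : Path.Homotopic.Quotient x y) (hx : x' = x) (hy : y' = y) :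
    (p.cast hx hy).symm = p.symm.cast hy hx := by
  subst hx hy
  simp

theorem mk_eq_cast_refl {x y z : X} (p : Path x y) (h : ∀ t, p t = z) :
    mk p = (refl z).cast (p.source.symm.trans (h 0)) (p.target.symm.trans (h 1)) := by
  rw [← mk_refl, ← mk_cast]
  congr 1
  ext t
  exact h t

end Path.Homotopic.Quotient

namespace FinGraph

variable {G : FinGraph} {X : Type*} [TopologicalSpace X]

theorem Space.ind {P : G.Space → Prop} (hv : ∀ v, P (G.vert v)) (he : ∀ e t, P (G.pt e t)) :
    ∀ x, P x := by
  rintro ⟨v | ⟨e, t⟩⟩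
  exacts [hv v, he e t]

/-- The function on the realization of a graph with given values on vertices and edges. -/
def Space.lift {X : Type*} (f : G.V → X) (g : G.E → I → X) (h0 : ∀ e, g e 0 = f (G.init e))
    (h1 : ∀ e, g e 1 = f (G.term e)) : G.Space → X :=
  Quot.lift (Sum.elim f fun y => g y.1 y.2) (by
    rintro _ _ (e | e)
    exacts [h0 e, h1 e])

/-- Vertices are discrete before gluing, so the quotient topology is tested on the edges alone. -/
theorem isOpen_iff {U : Set G.Space} : IsOpen U ↔ ∀ e, IsOpen {t | G.pt e t ∈ U} := by
  refine ⟨fun h e => h.preimage (G.continuous_pt e), fun h => ?_⟩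
  have : IsOpen (Quot.mk G.Glue ⁻¹' U) := by
    rw [isOpen_sum_iff]
    refine ⟨isOpen_discrete _, isOpen_iff_continuous_mem.2 ?_⟩
    exact continuous_prod_of_discrete_left.2 fun e => isOpen_iff_continuous_mem.1 (h e)
  exact this

theorem continuous_iff {f : G.Space → X} :
    Continuous f ↔ ∀ e, Continuous fun t => f (G.pt e t) := by
  refine ⟨fun h e => h.comp (G.continuous_pt e), fun h => continuous_def.2 fun U hU => ?_⟩
  exact isOpen_iff.2 fun e => hU.preimage (h e)

/-- The characteristic map of an edge, as a bundled continuous map. -/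
def ptMap (G : FinGraph) (e : G.E) : C(I, G.Space) := ⟨G.pt e, G.continuous_pt e⟩

open Classical in
/-- A vertex, or a point in the interior of an edge. -/
noncomputable def normalForm : G.Space → G.V ⊕ (G.E × I) :=
  Space.lift Sum.inl (fun e t => if t = 0 then .inl (G.init e) else if t = 1 then .inl (G.term e)
    else .inr (e, t)) (fun e => by simp) (fun e => by simp)

theorem normalForm_vert (v : G.V) : normalForm (G.vert v) = .inl v := rfl

/-- `normalForm` is well defined on the quotient and so separates points; the equivalence relation
generated by the gluing never has to be analysed. -/
theorem vert_injective : Function.Injective G.vert := fun v w h =>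
  Sum.inl_injective ((normalForm_vert v).symm.trans ((congrArg normalForm h).trans
    (normalForm_vert w)))

open Classical in
theorem normalForm_pt (e : G.E) (t : I) : normalForm (G.pt e t) =
    if t = 0 then .inl (G.init e) else if t = 1 then .inl (G.term e) else .inr (e, t) := rfl

theorem pt_eq_vert {e : G.E} {t : I} {v : G.V} (h : G.pt e t = G.vert v) :
    t = 0 ∧ G.init e = v ∨ t = 1 ∧ G.term e = v := by
  have := congrArg normalForm h
  rw [normalForm_vert, normalForm_pt] at this
  split_ifs at this with h0 h1
  · exact .inl ⟨h0, Sum.inl_injective this⟩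
  · exact .inr ⟨h1, Sum.inl_injective this⟩

theorem pt_eq_pt {e e' : G.E} {t t' : I} (h : G.pt e t = G.pt e' t') (h0 : t ≠ 0) (h1 : t ≠ 1) :
    e = e' ∧ t = t' := by
  have := congrArg normalForm h
  rw [normalForm_pt, normalForm_pt, if_neg h0, if_neg h1] at this
  split_ifs at this
  exact Prod.ext_iff.1 (Sum.inr_injective this)

/-- A map on the product of the interval with the realization of a graph, given on the vertices and
on the edges. -/
noncomputable def liftProd (δ : G.V → C(I, X)) (k : G.E → C(I × I, X))
    (h0 : ∀ e s, k e (s, 0) = δ (G.init e) s) (h1 : ∀ e s, k e (s, 1) = δ (G.term e) s) :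
    C(I × G.Space, X) :=
  -- The map is curried, so that the quotient stands alone as the source. This avoids having to show
  -- that the product of the interval with the quotient is again a quotient.
  let L : C(G.Space, C(I, X)) := ⟨Space.lift δ (fun e => ((k e).comp .prodSwap).curry)
    (fun e => ContinuousMap.ext fun s => h0 e s) (fun e => ContinuousMap.ext fun s => h1 e s),
    continuous_iff.2 fun e => ((k e).comp .prodSwap).curry.continuous⟩
  ⟨fun y => L y.2 y.1, by fun_prop⟩

theorem liftProd_pt (δ : G.V → C(I, X)) (k : G.E → C(I × I, X))
    (h0 : ∀ e s, k e (s, 0) = δ (G.init e) s) (h1 : ∀ e s, k e (s, 1) = δ (G.term e) s)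
    (s : I) (e : G.E) (t : I) : liftProd δ k h0 h1 (s, G.pt e t) = k e (s, t) := rfl

/-! ### The cover by stars of vertices and open edges -/

/-- The open star of radius one third around a vertex. -/
def star (v : G.V) : Set G.Space :=
  {x | Space.lift (· = v)
    (fun e t => ((t : ℝ) < 1 / 3 ∧ G.init e = v) ∨ (2 / 3 < (t : ℝ) ∧ G.term e = v))
    (fun e => by norm_num) (fun e => by norm_num) x}

theorem vert_mem_star {v w : G.V} : G.vert v ∈ star w ↔ v = w := Iff.rfl

theorem pt_mem_star {e : G.E} {t : I} {v : G.V} : G.pt e t ∈ star v ↔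
    ((t : ℝ) < 1 / 3 ∧ G.init e = v) ∨ (2 / 3 < (t : ℝ) ∧ G.term e = v) := Iff.rfl

theorem isOpen_star (v : G.V) : IsOpen (star v) := by
  refine isOpen_iff.2 fun e => ?_
  simp only [pt_mem_star]
  have h : IsOpen {t : I | (t : ℝ) < 1 / 3} := isOpen_lt (by fun_prop) (by fun_prop)
  have h' : IsOpen {t : I | 2 / 3 < (t : ℝ)} := isOpen_lt (by fun_prop) (by fun_prop)
  exact (h.inter (isOpen_const (p := G.init e = v))).union
    (h'.inter (isOpen_const (p := G.term e = v)))

/-- The interior of an edge. -/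
def openEdge (e : G.E) : Set G.Space :=
  {x | Space.lift (fun _ => False) (fun e' t => e' = e ∧ t ≠ 0 ∧ t ≠ 1)
    (fun e => by simp) (fun e => by simp) x}

theorem pt_mem_openEdge {e e' : G.E} {t : I} :
    G.pt e' t ∈ openEdge e ↔ e' = e ∧ t ≠ 0 ∧ t ≠ 1 := Iff.rfl

theorem isOpen_openEdge (e : G.E) : IsOpen (openEdge e) := by
  refine isOpen_iff.2 fun e' => ?_
  simp only [pt_mem_openEdge]
  exact isOpen_const.and (isOpen_ne.and isOpen_ne)

theorem mem_star_or_openEdge (x : G.Space) : (∃ v, x ∈ star v) ∨ ∃ e, x ∈ openEdge e := by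
  induction x using Space.ind with
  | hv v => exact .inl ⟨v, rfl⟩
  | he e t =>
    by_cases h0 : t = 0
    · exact .inl ⟨G.init e, by rw [h0, pt_zero]; rfl⟩
    by_cases h1 : t = 1
    · exact .inl ⟨G.term e, by rw [h1, pt_one]; rfl⟩
    exact .inr ⟨e, rfl, h0, h1⟩

/-- The characteristic map of an edge is an open embedding on the interior of the interval. -/
theorem isOpenEmbedding_pt (e : G.E) :
    Topology.IsOpenEmbedding fun t : {t : I // t ≠ 0 ∧ t ≠ 1} => G.pt e t := by
  refine .of_continuous_injective_isOpenMap ((G.continuous_pt e).comp continuous_subtype_val)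
    (fun t t' h => Subtype.ext (pt_eq_pt h t.2.1 t.2.2).2) fun U hU => isOpen_iff.2 fun e' => ?_
  have hU' : IsOpen (Subtype.val '' U : Set I) :=
    (isOpen_ne.and isOpen_ne).isOpenMap_subtype_val U hU
  by_cases he : e' = e
  · subst he
    convert hU' using 1
    ext t
    constructor
    · rintro ⟨t', ht', h⟩
      exact ⟨t', ht', (pt_eq_pt h t'.2.1 t'.2.2).2⟩
    · rintro ⟨t', ht', rfl⟩
      exact ⟨t', ht', rfl⟩
  · convert isOpen_empty using 1
    refine Set.eq_empty_of_forall_notMem fun t => ?_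
    rintro ⟨t', ht', h⟩
    exact he (pt_eq_pt h t'.2.1 t'.2.2).1.symm

/-- A continuous map into an open edge is given by a continuous coordinate. -/
theorem exists_coordinate {e : G.E} {γ : X → G.Space} (hγ : Continuous γ)
    (h : ∀ t, γ t ∈ openEdge e) :
    ∃ τ : X → I, Continuous τ ∧ ∀ t, γ t = G.pt e (τ t) ∧ τ t ≠ 0 ∧ τ t ≠ 1 := by
  have : ∀ x ∈ openEdge e, ∃ t : {t : I // t ≠ 0 ∧ t ≠ 1}, G.pt e t = x := by
    intro x
    induction x using Space.ind with
    | hv v => exact fun h => h.elim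
    | he e' t =>
      rintro ⟨rfl, ht⟩
      exact ⟨⟨t, ht⟩, rfl⟩
  choose τ hτ using fun t => this _ (h t)
  refine ⟨fun t => τ t, ?_, fun t => ⟨(hτ t).symm, (τ t).2⟩⟩
  refine continuous_subtype_val.comp ((isOpenEmbedding_pt e).isInducing.continuous_iff.2 ?_)
  convert hγ
  exact funext hτ

end FinGraph

/-! ### Every path between vertices is homotopic to an edge path -/

/-- This solves the naturality square of a homotopy for `m` when the path on the far side is
constant. -/
theorem Path.Homotopic.Quotient.eq_trans_symm_of_trans_cast {X : Type*} [TopologicalSpace X]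
    {x y x' y' z : X} {m : Path.Homotopic.Quotient x y} {a : Path.Homotopic.Quotient x x'}
    {b : Path.Homotopic.Quotient y y'} (hx : z = x') (hy : z = y')
    (h : m.trans b = a.trans ((refl z).cast hx.symm hy.symm)) :
    m = (a.cast rfl hx).trans (b.cast rfl hy).symm := by
  subst hx hy
  simp only [cast_rfl_rfl, trans_refl] at h ⊢
  rw [← h, trans_assoc, trans_symm, trans_refl]

namespace FinGraph

variable {G : FinGraph}

namespace Walk

theorem mk_toPath_cons {u v w : G.V} (d : G.Dart u v) (p : G.Walk v w) :
    Path.Homotopic.Quotient.mk (cons d p).toPath =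
      (Path.Homotopic.Quotient.mk d.path).trans (Path.Homotopic.Quotient.mk p.toPath) := by
  cases p with
  | nil => exact (Path.Homotopic.Quotient.trans_refl _).symm
  | cons d' p => rfl

/-- The concatenation of edge paths. -/
def append : {u v w : G.V} → G.Walk u v → G.Walk v w → G.Walk u w
  | _, _, _, nil _, q => q
  | _, _, _, cons d p, q => cons d (p.append q)

theorem mk_toPath_append {u v w : G.V} (p : G.Walk u v) (q : G.Walk v w) :
    Path.Homotopic.Quotient.mk (p.append q).toPath =
      (Path.Homotopic.Quotient.mk p.toPath).trans (Path.Homotopic.Quotient.mk q.toPath) := by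
  induction p with
  | nil => exact (Path.Homotopic.Quotient.refl_trans _).symm
  | cons d p ih =>
    rw [append, mk_toPath_cons, mk_toPath_cons, ih, Path.Homotopic.Quotient.trans_assoc]

end Walk

/-- Contractibility makes the class of a path in the interval depend only on its ends; this is used
through `Subsingleton.elim`. -/
instance : ContractibleSpace I := (convex_Icc (0 : ℝ) 1).contractibleSpace ⟨0, by simp⟩

/-- The class of a path within an edge. -/
def edgeClass (e : G.E) {s t : I} (q : Path.Homotopic.Quotient s t) :
    Path.Homotopic.Quotient (G.pt e s) (G.pt e t) := q.map (G.ptMap e)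

/-- A path within an edge. -/
def edgeSegment (e : G.E) {s t : I} (p : Path s t) : Path (G.pt e s) (G.pt e t) :=
  p.map (G.continuous_pt e)

theorem edgeClass_mk (e : G.E) {s t : I} (p : Path s t) :
    edgeClass e (.mk p) = .mk (edgeSegment e p) := rfl

theorem edgeClass_trans (e : G.E) {r s t : I} (p : Path.Homotopic.Quotient r s)
    (q : Path.Homotopic.Quotient s t) :
    (edgeClass e p).trans (edgeClass e q) = edgeClass e (p.trans q) :=
  (Path.Homotopic.Quotient.map_trans p q (G.ptMap e)).symm

theorem edgeClass_symm (e : G.E) {s t : I} (p : Path.Homotopic.Quotient s t) :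
    (edgeClass e p).symm = edgeClass e p.symm :=
  (Path.Homotopic.Quotient.map_symm p (G.ptMap e)).symm

/-- The path class is represented by an edge path. -/
def IsWalkClass {u v : G.V} (m : Path.Homotopic.Quotient (G.vert u) (G.vert v)) : Prop :=
  ∃ p : G.Walk u v, Path.Homotopic.Quotient.mk p.toPath = m

theorem IsWalkClass.refl (u : G.V) :
    IsWalkClass (Path.Homotopic.Quotient.refl (G.vert u)) := ⟨.nil u, rfl⟩

theorem IsWalkClass.trans {u v w : G.V} {m : Path.Homotopic.Quotient (G.vert u) (G.vert v)}
    {m' : Path.Homotopic.Quotient (G.vert v) (G.vert w)} (h : IsWalkClass m)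
    (h' : IsWalkClass m') : IsWalkClass (m.trans m') := by
  obtain ⟨p, rfl⟩ := h
  obtain ⟨q, rfl⟩ := h'
  exact ⟨p.append q, Walk.mk_toPath_append p q⟩

/-- The parameters of the two ends are each `0` or `1`, and the class depends on nothing else. The
four cases are a constant path, the edge, its reverse, and again a constant path. -/
theorem IsWalkClass.of_edge {e : G.E} {s t : I} (q : Path.Homotopic.Quotient s t) {u v : G.V}
    (hs : G.vert u = G.pt e s) (ht : G.vert v = G.pt e t) :
    IsWalkClass ((edgeClass e q).cast hs ht) := by
  have key : ∀ p : Path s t, ∀ p' : Path (G.vert u) (G.vert v), (∀ x, p' x = G.pt e (p x)) →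
      (edgeClass e q).cast hs ht = Path.Homotopic.Quotient.mk p' := by
    intro p p' h
    rw [Subsingleton.elim q (.mk p), edgeClass_mk,
      ← Path.Homotopic.Quotient.mk_cast]
    congr 1
    ext x
    exact (h x).symm
  rcases pt_eq_vert hs.symm with ⟨rfl, rfl⟩ | ⟨rfl, rfl⟩ <;>
    rcases pt_eq_vert ht.symm with ⟨rfl, h⟩ | ⟨rfl, h⟩
  · subst h
    rw [key (.refl 0) (.refl _) fun x => hs]
    exact .refl _
  · subst h
    let d : G.Dart (G.init e) (G.term e) := ⟨(e, true), rfl, rfl⟩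
    exact ⟨.cons d (.nil _), (key ⟨.id I, rfl, rfl⟩ d.path fun x => rfl).symm⟩
  · subst h
    let d : G.Dart (G.term e) (G.init e) := ⟨(e, false), rfl, rfl⟩
    refine ⟨.cons d (.nil _), (key (Path.symm ⟨.id I, rfl, rfl⟩) d.path fun x => rfl).symm⟩
  · subst h
    rw [key (.refl 1) (.refl _) fun x => hs]
    exact .refl _

/-- The arcs from a vertex to a point within one closed edge. -/
inductive IsArc : ∀ {u : G.V} {x : G.Space}, Path.Homotopic.Quotient (G.vert u) x → Prop
  | vert (u : G.V) : IsArc (Path.Homotopic.Quotient.refl (G.vert u))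
  | edge (e : G.E) (t : I) (q : Path.Homotopic.Quotient (0 : I) t) :
      IsArc ((edgeClass e q).cast (G.pt_zero e).symm (rfl : G.pt e t = _))

/-- The path class consists of an edge path and an arc. -/
def IsReach {u : G.V} {x : G.Space} (m : Path.Homotopic.Quotient (G.vert u) x) : Prop :=
  ∃ (v : G.V) (p : Path.Homotopic.Quotient (G.vert u) (G.vert v))
    (a : Path.Homotopic.Quotient (G.vert v) x), IsWalkClass p ∧ IsArc a ∧ m = p.trans a

theorem IsReach.trans {u v : G.V} {x : G.Space} {m : Path.Homotopic.Quotient (G.vert u) (G.vert v)}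
    {m' : Path.Homotopic.Quotient (G.vert v) x} (h : IsWalkClass m) (h' : IsReach m') :
    IsReach (m.trans m') := by
  obtain ⟨w, p, a, hp, ha, rfl⟩ := h'
  exact ⟨w, _, a, h.trans hp, ha, by rw [Path.Homotopic.Quotient.trans_assoc]⟩

theorem IsReach.refl_cast {u : G.V} {x : G.Space} (h : G.vert u = x) :
    IsReach ((Path.Homotopic.Quotient.refl x).cast h rfl) := by
  subst h
  exact ⟨u, _, _, .refl u, .vert u, by simp⟩

theorem IsReach.of_edge {e : G.E} {s t : I} (q : Path.Homotopic.Quotient s t) {u : G.V}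
    (h : G.vert u = G.pt e s) :
    IsReach ((edgeClass e q).cast h (rfl : G.pt e t = _)) := by
  -- The path is rerouted through parameter `0`. The first piece joins vertices, and the second is
  -- an arc in the normal form of `IsArc`.
  obtain ⟨q1⟩ : Nonempty (Path s (0 : I)) := PathConnectedSpace.joined _ _
  obtain ⟨q2⟩ : Nonempty (Path (0 : I) t) := PathConnectedSpace.joined _ _
  rw [Subsingleton.elim q ((Path.Homotopic.Quotient.mk q1).trans (.mk q2)),
    ← edgeClass_trans]
  exact ⟨_, _, _, .of_edge (.mk q1) h (G.pt_zero e).symm, .edge e t (.mk q2),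
    (Path.Homotopic.Quotient.cast_trans_cast _ _ _ _ _).symm⟩

/-- The homotopy which shrinks the stars of the vertices. -/
noncomputable def shrink (G : FinGraph) : C(I × G.Space, G.Space) :=
  liftProd (fun v => .const I (G.vert v))
    (fun e => (G.ptMap e).comp
      -- At time `1` the parameter `t` has moved to `3t - 1`, clamped to the interval, so the outer
      -- thirds of the edge collapse to its ends.
      ⟨fun y => Set.projIcc 0 1 zero_le_one ((y.2 : ℝ) + y.1 * (2 * y.2 - 1)), by fun_prop⟩)
    (fun e s => by
      have : Set.projIcc (0 : ℝ) 1 zero_le_one (((0 : I) : ℝ) + s * (2 * ((0 : I) : ℝ) - 1)) = 0 :=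
        Set.projIcc_of_le_left _ (by simpa using s.2.1)
      exact (congrArg (G.pt e) this).trans (G.pt_zero e))
    (fun e s => by
      have : Set.projIcc (0 : ℝ) 1 zero_le_one (((1 : I) : ℝ) + s * (2 * ((1 : I) : ℝ) - 1)) = 1 :=
        Set.projIcc_of_right_le _ (by have := s.2.1; norm_num; exact this)
      exact (congrArg (G.pt e) this).trans (G.pt_one e))

/-- The track of a point in an edge under `shrink`. -/
noncomputable def shrinkPath (t : I) :
    Path t (Set.projIcc (0 : ℝ) 1 zero_le_one ((t : ℝ) + 1 * (2 * t - 1))) where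
  toFun s := Set.projIcc 0 1 zero_le_one ((t : ℝ) + s * (2 * t - 1))
  continuous_toFun := by fun_prop
  source' := by simp
  target' := by simp

theorem shrink_zero (x : G.Space) : shrink G (0, x) = x := by
  induction x using Space.ind with
  | hv v => rfl
  | he e t =>
    refine (liftProd_pt _ _ _ _ _ _ _).trans ?_
    simp [ptMap]

theorem shrink_one {x : G.Space} {v : G.V} (hx : x ∈ star v) : shrink G (1, x) = G.vert v := by
  induction x using Space.ind with
  | hv u => exact congrArg G.vert (vert_mem_star.1 hx)
  | he e t =>
    refine (liftProd_pt _ _ _ _ _ _ _).trans ?_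
    rcases pt_mem_star.1 hx with ⟨h, rfl⟩ | ⟨h, rfl⟩
    · rw [← pt_zero]
      refine congrArg (G.pt e) (Set.projIcc_of_le_left zero_le_one ?_)
      simp only [Set.Icc.coe_one]
      linarith
    · rw [← pt_one]
      refine congrArg (G.pt e) (Set.projIcc_of_right_le zero_le_one ?_)
      simp only [Set.Icc.coe_one]
      linarith

/-- The track of a point in a star under `shrink`. -/
noncomputable def track {v : G.V} {x : G.Space} (hx : x ∈ star v) : Path x (G.vert v) where
  toFun s := shrink G (s, x)
  continuous_toFun := by fun_prop
  source' := shrink_zero x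
  target' := shrink_one hx

/-- At the end of `shrink` the path `m` has become constant at the centre of the star. Naturality of
the homotopy along `m` then replaces it by the track into the centre followed by the track out. -/
theorem mk_eq_track_trans {v : G.V} {x y : G.Space} (m : Path x y) (hm : ∀ t, m t ∈ star v)
    (hx : x ∈ star v) (hy : y ∈ star v) : Path.Homotopic.Quotient.mk m =
      (Path.Homotopic.Quotient.mk (track hx)).trans (.symm (.mk (track hy))) := by
  let R : C(G.Space, G.Space) := ⟨fun x => shrink G (1, x), by fun_prop⟩
  let H : ContinuousMap.Homotopy (ContinuousMap.id G.Space) R :=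
    ⟨shrink G, fun x => shrink_zero x, fun x => rfl⟩
  have h := Path.Homotopic.Quotient.eq.2 (Path.Homotopic.map_trans_evalAt H m)
  rw [Path.Homotopic.Quotient.mk_trans, Path.Homotopic.Quotient.mk_trans,
    Path.Homotopic.Quotient.mk_eq_cast_refl (m.map (map_continuous R)) (z := G.vert v)
      fun t => shrink_one (hm t)] at h
  exact Path.Homotopic.Quotient.eq_trans_symm_of_trans_cast (m := .mk m) (shrink_one hx).symm
    (shrink_one hy).symm h

theorem pt_shrinkPath {v : G.V} {e : G.E} {t : I} (h : G.pt e t ∈ star v) :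
    G.vert v = G.pt e (Set.projIcc (0 : ℝ) 1 zero_le_one ((t : ℝ) + 1 * (2 * t - 1))) :=
  (shrink_one h).symm

theorem mk_track_pt {v : G.V} {e : G.E} {t : I} (h : G.pt e t ∈ star v) :
    Path.Homotopic.Quotient.mk (track h) =
      (edgeClass e (Path.Homotopic.Quotient.mk (shrinkPath t))).cast rfl (pt_shrinkPath h) := rfl

theorem mk_track_vert {u : G.V} (h : G.vert u ∈ star u) :
    Path.Homotopic.Quotient.mk (track h) = .refl (G.vert u) := rfl

theorem IsArc.trans_track {u v : G.V} {x : G.Space} {a : Path.Homotopic.Quotient (G.vert u) x}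
    (ha : IsArc a) (hx : x ∈ star v) :
    IsWalkClass (a.trans (Path.Homotopic.Quotient.mk (track hx))) := by
  cases ha with
  | vert =>
    obtain rfl := vert_mem_star.1 hx
    rw [mk_track_vert, Path.Homotopic.Quotient.trans_refl]
    exact .refl _
  | edge e t q =>
    rw [mk_track_pt]
    refine (congrArg IsWalkClass (Path.Homotopic.Quotient.cast_trans_cast _ _ _ _ _)).mpr ?_
    rw [edgeClass_trans]
    exact .of_edge _ _ _

theorem IsReach.symm_track {v : G.V} {x : G.Space} (hx : x ∈ star v) :
    IsReach (Path.Homotopic.Quotient.mk (track hx)).symm := by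
  induction x using Space.ind with
  | hv u =>
    obtain rfl := vert_mem_star.1 hx
    exact .refl_cast rfl
  | he e t =>
    rw [mk_track_pt, Path.Homotopic.Quotient.cast_symm, edgeClass_symm]
    exact .of_edge (Path.Homotopic.Quotient.mk (shrinkPath t)).symm (pt_shrinkPath hx)

/-- This is the induction step along a subdivided path. In a star, the piece is rerouted through the
centre, which completes the previous arc to an edge path. In an open edge, the previous arc lies in
that same edge and is prolonged. -/
theorem IsReach.trans_mk {u : G.V} {x y : G.Space} {a : Path.Homotopic.Quotient (G.vert u) x}
    (ha : IsReach a) (m : Path x y)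
    (hm : (∃ v, ∀ t, m t ∈ star v) ∨ ∃ e, ∀ t, m t ∈ openEdge e) :
    IsReach (a.trans (.mk m)) := by
  obtain ⟨v, p, a, hp, ha, rfl⟩ := ha
  rw [Path.Homotopic.Quotient.trans_assoc]
  refine .trans hp ?_
  clear hp p u
  rcases hm with ⟨w, hm⟩ | ⟨e, hm⟩
  · have hx : x ∈ star w := by simpa using hm 0
    have hy : y ∈ star w := by simpa using hm 1
    rw [mk_eq_track_trans m hm hx hy, ← Path.Homotopic.Quotient.trans_assoc]
    exact .trans (ha.trans_track hx) (.symm_track hy)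
  · obtain ⟨τ, hτ, h⟩ := exists_coordinate m.continuous hm
    have h0 : x = G.pt e (τ 0) := by rw [← (h 0).1, m.source]
    have h1 : y = G.pt e (τ 1) := by rw [← (h 1).1, m.target]
    obtain ⟨q, hq⟩ : ∃ q : Path.Homotopic.Quotient (τ 0) (τ 1),
        Path.Homotopic.Quotient.mk m = (edgeClass e q).cast h0 h1 := by
      refine ⟨.mk ⟨⟨τ, hτ⟩, rfl, rfl⟩, ?_⟩
      rw [edgeClass_mk, ← Path.Homotopic.Quotient.mk_cast]
      congr 1
      ext t
      exact (h t).1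
    rw [hq]
    have hne := (h 0).2
    clear hq h hm
    generalize τ 0 = s at *
    generalize τ 1 = t at *
    subst h1
    cases ha with
    | vert =>
      rcases pt_eq_vert h0.symm with h | h
      · exact absurd h.1 hne.1
      · exact absurd h.1 hne.2
    | edge e' t' q' =>
      obtain ⟨rfl, rfl⟩ := pt_eq_pt h0.symm hne.1 hne.2
      rw [Path.Homotopic.Quotient.cast_trans_cast, edgeClass_trans]
      exact .of_edge _ _

theorem IsArc.isWalkClass {u v : G.V} {x : G.Space} {a : Path.Homotopic.Quotient (G.vert u) x}
    (ha : IsArc a) (hx : G.vert v = x) : IsWalkClass (a.cast rfl hx) := by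
  cases ha with
  | vert =>
    obtain rfl := vert_injective hx
    exact .refl _
  | edge e t q =>
    rw [Path.Homotopic.Quotient.cast_cast]
    exact .of_edge _ _ _

theorem IsReach.isWalkClass {u v : G.V} {m : Path.Homotopic.Quotient (G.vert u) (G.vert v)}
    (h : IsReach m) : IsWalkClass m := by
  obtain ⟨w, p, a, hp, ha, rfl⟩ := h
  simpa using hp.trans (ha.isWalkClass rfl)

/-- A Lebesgue subdivision cuts the path into pieces within stars or open edges. The invariant along
the subdivision is `IsReach`: an edge path followed by an arc in a single edge. -/
theorem isWalkClass {u v : G.V} (m : Path.Homotopic.Quotient (G.vert u) (G.vert v)) :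
    IsWalkClass m := by
  induction m using Path.Homotopic.Quotient.ind with | mk γ
  obtain ⟨t, ht0, ht, ⟨N, hN⟩, hc⟩ := exists_monotone_Icc_subset_open_cover_unitInterval
    (c := fun i : G.V ⊕ G.E => Sum.elim (fun v => γ ⁻¹' star v) (fun e => γ ⁻¹' openEdge e) i)
    (by
      rintro (v | e)
      exacts [(isOpen_star v).preimage γ.continuous, (isOpen_openEdge e).preimage γ.continuous])
    (fun s _ => by
      rcases mem_star_or_openEdge (γ s) with ⟨v, h⟩ | ⟨e, h⟩
      exacts [Set.mem_iUnion.2 ⟨.inl v, h⟩, Set.mem_iUnion.2 ⟨.inr e, h⟩])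
  have key : ∀ n, IsReach ((Path.Homotopic.Quotient.mk (γ.subpath 0 (t n))).cast γ.source.symm
      rfl) := by
    intro n
    induction n with
    | zero =>
      rw [ht0, Path.subpath_self]
      exact .refl_cast γ.source.symm
    | succ n ih =>
      have h := ih.trans_mk (γ.subpath (t n) (t (n + 1))) (by
        obtain ⟨i, hi⟩ := hc n
        have hr : ∀ s, ∃ s' ∈ Set.Icc (t n) (t (n + 1)), γ s' = γ.subpath (t n) (t (n + 1)) s := by
          intro s
          have := Path.range_subpath_of_le γ _ _ (ht n.le_succ)
          have h2 := Set.mem_range_self (f := γ.subpath (t n) (t (n + 1))) s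
          rw [this] at h2
          exact h2
        rcases i with v | e
        · refine .inl ⟨v, fun s => ?_⟩
          obtain ⟨s', h1, h2⟩ := hr s
          rw [← h2]
          exact hi h1
        · refine .inr ⟨e, fun s => ?_⟩
          obtain ⟨s', h1, h2⟩ := hr s
          rw [← h2]
          exact hi h1)
      rw [← Path.Homotopic.Quotient.cast_rfl_rfl (.mk (γ.subpath (t n) (t (n + 1)))),
        Path.Homotopic.Quotient.cast_trans_cast, ← Path.Homotopic.Quotient.mk_trans,
        Path.Homotopic.Quotient.eq.2 ⟨Path.Homotopy.subpathTransSubpath γ _ _ _⟩] at h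
      exact h
  have h := key N
  rw [hN N le_rfl] at h
  refine IsReach.isWalkClass ?_
  have h1 : γ 1 = G.vert v := γ.target
  have h2 : IsReach ((Path.Homotopic.Quotient.mk (γ.subpath 0 1)).cast γ.source.symm
      h1.symm) := by
    generalize Path.Homotopic.Quotient.mk (γ.subpath 0 1) = q at *
    generalize γ 1 = y at *
    subst h1
    exact h
  rw [Path.subpath_zero_one] at h2
  simpa using h2

end FinGraph

/-! ### The universal covering and the holonomy of paths -/

/-- The free group as a discrete space. -/
def DiscreteFreeGroup : Type := FreeGroup ℕ

instance : Group DiscreteFreeGroup := inferInstanceAs (Group (FreeGroup ℕ))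

instance : TopologicalSpace DiscreteFreeGroup := ⊥

instance : DiscreteTopology DiscreteFreeGroup := ⟨rfl⟩

namespace FinGraph

variable {G : FinGraph}

/-- A generator of the free group, as an element of the discrete free group. -/
def letter (e : G.E) : DiscreteFreeGroup := FreeGroup.of e.val

open Classical in
/-- The change of coordinates from an open edge to the star of a vertex. -/
noncomputable def gauge : G.Space → DiscreteFreeGroup :=
  -- The terminal end is excluded because the value there must agree with the value `1` at the
  -- vertex.
  Space.lift (fun _ => 1) (fun e t => if 2 / 3 < (t : ℝ) ∧ t ≠ 1 then letter e else 1)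
    (fun e => by norm_num) (fun e => by simp)

open Classical in
theorem gauge_pt (e : G.E) (t : I) :
    gauge (G.pt e t) = if 2 / 3 < (t : ℝ) ∧ t ≠ 1 then letter e else 1 := rfl

/-- The gauge may jump at parameter `2/3` and at the terminal vertex, but neither point lies in the
overlap of a star with an open edge, where it is locally constant. -/
theorem continuousAt_gauge {x : G.Space} {v : G.V} {e : G.E} (hv : x ∈ star v)
    (he : x ∈ openEdge e) : ContinuousAt gauge x := by
  induction x using Space.ind with
  | hv v => exact he.elim
  | he e' t =>
    obtain ⟨rfl, ht⟩ := pt_mem_openEdge.1 he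
    rw [← (isOpenEmbedding_pt e').continuousAt_iff (x := ⟨t, ht⟩)]
    rcases pt_mem_star.1 hv with ⟨h, -⟩ | ⟨h, -⟩
    · refine ContinuousAt.congr (f := fun _ => (1 : DiscreteFreeGroup)) continuousAt_const ?_
      have : ∀ᶠ t' : {t : I // t ≠ 0 ∧ t ≠ 1} in nhds ⟨t, ht⟩, ((t' : I) : ℝ) < 1 / 3 :=
        (isOpen_lt (by fun_prop) (by fun_prop)).mem_nhds h
      filter_upwards [this] with t' h'
      simp only [Function.comp, gauge_pt]
      rw [if_neg fun h => by linarith [h.1]]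
    · refine ContinuousAt.congr (f := fun _ => letter e') continuousAt_const ?_
      have : ∀ᶠ t' : {t : I // t ≠ 0 ∧ t ≠ 1} in nhds ⟨t, ht⟩, 2 / 3 < ((t' : I) : ℝ) :=
        (isOpen_lt (by fun_prop) (by fun_prop)).mem_nhds h
      filter_upwards [this] with t' h'
      simp only [Function.comp, gauge_pt]
      rw [if_pos ⟨h', t'.2.2⟩]

/-- The gauge on the stars of the vertices, and the trivial gauge on the open edges. -/
noncomputable def chartGauge (i : Bool) (x : G.Space) : DiscreteFreeGroup :=
  if i = true then gauge x else 1

open Classical in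
/-- The bundle of coordinates with the stars of the vertices, and the open edges, as charts. -/
noncomputable def coverCore (G : FinGraph) : FiberBundleCore Bool G.Space DiscreteFreeGroup where
  baseSet i := if i = true then ⋃ v, star v else ⋃ e, openEdge e
  isOpen_baseSet i := by
    cases i
    · exact isOpen_iUnion isOpen_openEdge
    · exact isOpen_iUnion isOpen_star
  indexAt x := decide (∃ v, x ∈ star v)
  mem_baseSet_at x := by
    by_cases h : ∃ v, x ∈ star v
    · simp [h]
    · simpa [h] using (mem_star_or_openEdge x).resolve_left h
  -- The transition functions have coboundary form, so the cocycle identities are formal. The bundle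
  -- need not be trivial, because the gauge is continuous only on overlaps.
  coordChange i j x g := g * (chartGauge i x)⁻¹ * chartGauge j x
  coordChange_self i x _ g := by simp
  continuousOn_coordChange i j := by
    have key : ∀ f : DiscreteFreeGroup → DiscreteFreeGroup → DiscreteFreeGroup,
        ContinuousOn (fun p : G.Space × DiscreteFreeGroup => f (gauge p.1) p.2)
          (((⋃ v, star v) ∩ ⋃ e, openEdge e) ×ˢ Set.univ) := by
      rintro f ⟨x, g⟩ ⟨⟨hv, he⟩, -⟩
      obtain ⟨v, hv⟩ := Set.mem_iUnion.1 hv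
      obtain ⟨e, he⟩ := Set.mem_iUnion.1 he
      refine ContinuousAt.continuousWithinAt ?_
      have h1 : ContinuousAt (fun p : G.Space × DiscreteFreeGroup => (gauge p.1, p.2)) (x, g) :=
        ((continuousAt_gauge hv he).comp continuousAt_fst).prodMk continuousAt_snd
      exact ContinuousAt.comp (g := fun p : DiscreteFreeGroup × DiscreteFreeGroup => f p.1 p.2)
        continuous_of_discreteTopology.continuousAt h1
    cases i <;> cases j
    · simpa [chartGauge] using continuousOn_snd
    · rw [Set.inter_comm]
      simpa [chartGauge] using key fun a g => g * a
    · simpa [chartGauge] using key fun a g => g * a⁻¹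
    · simpa [chartGauge] using continuousOn_snd
  coordChange_comp i j k x _ g := by group

/-- The point of the bundle over `x` with a given coordinate. -/
def coverPoint (x : G.Space) (g : DiscreteFreeGroup) : (coverCore G).TotalSpace := ⟨x, g⟩

theorem isCoveringMap_proj (G : FinGraph) :
    IsCoveringMap (Bundle.TotalSpace.proj : (coverCore G).TotalSpace → G.Space) :=
  FiberBundle.isCoveringMap

/-- The point of the fibre over `x` with a given coordinate. -/
def fiberPoint (x : G.Space) (g : DiscreteFreeGroup) :
    (Bundle.TotalSpace.proj : (coverCore G).TotalSpace → G.Space) ⁻¹' {x} := ⟨coverPoint x g, rfl⟩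

open Classical in
/-- The coordinates of a lift of an edge. -/
noncomputable def liftCoord (e : G.E) (g : DiscreteFreeGroup) (t : I) : DiscreteFreeGroup :=
  if 2 / 3 < (t : ℝ) then g * letter e else g

theorem coverCore_indexAt_pt {e : G.E} {t : I} :
    (coverCore G).indexAt (G.pt e t) = true ↔ (t : ℝ) < 1 / 3 ∨ 2 / 3 < (t : ℝ) := by
  simp only [coverCore, decide_eq_true_eq, pt_mem_star]
  constructor
  · rintro ⟨v, h | h⟩
    exacts [.inl h.1, .inr h.1]
  · rintro (h | h)
    exacts [⟨_, .inl ⟨h, rfl⟩⟩, ⟨_, .inr ⟨h, rfl⟩⟩]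

/-- The jump of `liftCoord` at `2/3` compensates the change from the chart of the open edge to the
chart of the terminal star. Read in the chart belonging to any one parameter, the coordinate is
locally constant near it. Crossing an edge thus multiplies the coordinate by its letter. -/
theorem continuous_lift_edge (e : G.E) (g : DiscreteFreeGroup) :
    Continuous fun t => coverPoint (G.pt e t) (liftCoord e g t) := by
  refine continuous_iff_continuousAt.2 fun t₀ => ?_
  rw [FiberBundle.continuousAt_totalSpace]
  refine ⟨(G.continuous_pt e).continuousAt, ?_⟩
  have key : ∀ t, ((trivializationAt DiscreteFreeGroup (coverCore G).Fiber (G.pt e t₀))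
      (coverPoint (G.pt e t) (liftCoord e g t))).2 = liftCoord e g t *
        (chartGauge ((coverCore G).indexAt (G.pt e t)) (G.pt e t))⁻¹ *
        chartGauge ((coverCore G).indexAt (G.pt e t₀)) (G.pt e t) := fun t => rfl
  change ContinuousAt (fun t => ((trivializationAt DiscreteFreeGroup (coverCore G).Fiber
    (G.pt e t₀)) (coverPoint (G.pt e t) (liftCoord e g t))).2) t₀
  simp only [key]
  have h13 : IsOpen {t : I | (t : ℝ) < 1 / 3} := isOpen_lt (by fun_prop) (by fun_prop)
  have h23 : IsOpen {t : I | 2 / 3 < (t : ℝ)} := isOpen_lt (by fun_prop) (by fun_prop)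
  by_cases h1 : (t₀ : ℝ) < 1 / 3
  · refine ContinuousAt.congr (f := fun _ => g) continuousAt_const ?_
    filter_upwards [h13.mem_nhds h1] with t ht
    have ht' : (t : ℝ) < 1 / 3 := ht
    rw [coverCore_indexAt_pt.2 (.inl h1), coverCore_indexAt_pt.2 (.inl ht'), inv_mul_cancel_right,
      liftCoord, if_neg (by linarith)]
  by_cases h2 : 2 / 3 < (t₀ : ℝ)
  · refine ContinuousAt.congr (f := fun _ => g * letter e) continuousAt_const ?_
    filter_upwards [h23.mem_nhds h2] with t ht
    have ht' : 2 / 3 < (t : ℝ) := ht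
    rw [coverCore_indexAt_pt.2 (.inr h2), coverCore_indexAt_pt.2 (.inr ht'), inv_mul_cancel_right,
      liftCoord, if_pos ht']
  · refine ContinuousAt.congr (f := fun _ => g) continuousAt_const ?_
    have hne : t₀ ≠ 1 := by
      rintro rfl
      norm_num at h2
    filter_upwards [isOpen_ne.mem_nhds hne] with t ht
    have hi : (coverCore G).indexAt (G.pt e t₀) = false :=
      Bool.eq_false_iff.2 fun h => (coverCore_indexAt_pt.1 h).elim h1 h2
    have hc : ∀ x : G.Space, chartGauge false x = 1 := fun x => rfl
    have hc' : ∀ x : G.Space, chartGauge true x = gauge x := fun x => rfl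
    rw [hi, hc, mul_one]
    by_cases h : 2 / 3 < (t : ℝ)
    · rw [coverCore_indexAt_pt.2 (.inr h), liftCoord, if_pos h, hc', gauge_pt, if_pos ⟨h, ht⟩,
        mul_inv_cancel_right]
    · rw [liftCoord, if_neg h]
      cases h' : (coverCore G).indexAt (G.pt e t)
      · rw [hc, inv_one, mul_one]
      · rw [hc', gauge_pt, if_neg fun h' => h h'.1, inv_one, mul_one]

theorem monodromy_edgePath (e : G.E) (g : DiscreteFreeGroup) :
    (isCoveringMap_proj G).monodromy (.mk (G.edgePath e)) (fiberPoint (G.vert (G.init e)) g) =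
      fiberPoint (G.vert (G.term e)) (g * letter e) := by
  let Γ : Path (coverPoint (G.vert (G.init e)) g)
      (coverPoint (G.vert (G.term e)) (g * letter e)) :=
    { toFun := fun t => coverPoint (G.pt e t) (liftCoord e g t)
      continuous_toFun := continuous_lift_edge e g
      source' := by rw [pt_zero, liftCoord, if_neg (by norm_num)]
      target' := by rw [pt_one, liftCoord, if_pos (by norm_num)] }
  exact (isCoveringMap_proj G).monodromy_eq_of_map_eq (ex := fiberPoint (G.vert (G.init e)) g)
    (ey := fiberPoint (G.vert (G.term e)) (g * letter e)) (.mk Γ) rfl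

theorem monodromy_edgePath_symm (e : G.E) (g : DiscreteFreeGroup) :
    (isCoveringMap_proj G).monodromy (.mk (G.edgePath e).symm) (fiberPoint (G.vert (G.term e)) g) =
      fiberPoint (G.vert (G.init e)) (g * (letter e)⁻¹) := by
  have h := monodromy_edgePath e (g * (letter e)⁻¹)
  rw [inv_mul_cancel_right] at h
  rw [← h, ← IsCoveringMap.monodromy_trans_apply, Path.Homotopic.Quotient.mk_symm,
    Path.Homotopic.Quotient.trans_symm, IsCoveringMap.monodromy_refl]
  rfl

theorem monodromy_dart {u v : G.V} (d : G.Dart u v) (g : FreeGroup ℕ) :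
    (isCoveringMap_proj G).monodromy (.mk d.path) (fiberPoint (G.vert u) g) =
      fiberPoint (G.vert v) (g * FreeGroup.mk (wordCode [d.1]) : FreeGroup ℕ) := by
  obtain ⟨⟨e, _ | _⟩, rfl, rfl⟩ := d
  · exact monodromy_edgePath_symm e g
  · exact monodromy_edgePath e g

theorem monodromy_walk {u v : G.V} (p : G.Walk u v) (g : FreeGroup ℕ) :
    (isCoveringMap_proj G).monodromy (.mk p.toPath) (fiberPoint (G.vert u) g) =
      fiberPoint (G.vert v) (g * FreeGroup.mk (wordCode p.word) : FreeGroup ℕ) := by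
  induction p generalizing g with
  | nil u =>
    change (isCoveringMap_proj G).monodromy (.refl _) _ = _
    rw [IsCoveringMap.monodromy_refl]
    exact congrArg (fiberPoint (G.vert u)) (mul_one g).symm
  | cons d p ih =>
    rw [Walk.mk_toPath_cons, IsCoveringMap.monodromy_trans_apply, monodromy_dart, ih]
    congr 1
    rw [mul_assoc, FreeGroup.mul_mk]
    rfl

/-- The holonomy of a path class between vertices. -/
noncomputable def hol {u v : G.V} (m : Path.Homotopic.Quotient (G.vert u) (G.vert v)) :
    FreeGroup ℕ :=
  ((isCoveringMap_proj G).monodromy m (fiberPoint (G.vert u) 1)).1.2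

/-- Since monodromy depends only on the homotopy class, this shows that the free group element of an
edge path is a homotopy invariant. -/
theorem hol_walk {u v : G.V} (p : G.Walk u v) :
    hol (.mk p.toPath) = FreeGroup.mk (wordCode p.word) := by
  rw [hol]
  erw [monodromy_walk p 1]
  exact one_mul _

end FinGraph

/-! ### The fundamental groupoid of a graph -/

theorem Path.Homotopic.Quotient.eq_refl_of_cast {X : Type*} [TopologicalSpace X] {x y : X}
    {q : Path.Homotopic.Quotient y y} (h : x = y) (hq : q.cast h h = refl x) : q = refl y := by
  subst h
  simpa using hq

namespace FinGraph

variable {G H : FinGraph}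

theorem length_code (G : FinGraph) : G.code.2.length = G.numE := by simp [code]

theorem getD_code (e : G.E) : G.code.2.getD e.val (0, 0) = ((G.init e).val, (G.term e).val) := by
  simp [code]

theorem dartSrc_code (e : G.E) (b : Bool) : dartSrc G.code.2 (e.val, b) = (G.src (e, b)).val := by
  cases b <;> simp only [dartSrc, getD_code, src] <;> rfl

theorem dartTgt_code (e : G.E) (b : Bool) : dartTgt G.code.2 (e.val, b) = (G.tgt (e, b)).val := by
  cases b <;> simp only [dartTgt, getD_code, tgt] <;> rfl

theorem wordCode_cons {n : ℕ} (d : Fin n × Bool) (w : List (Fin n × Bool)) :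
    wordCode (d :: w) = (d.1.val, d.2) :: wordCode w := rfl

theorem Walk.word_cons {u v w : G.V} (d : G.Dart u v) (p : G.Walk v w) :
    (Walk.cons d p).word = d.1 :: p.word := rfl

theorem Walk.edgeWalk {u v : G.V} (p : G.Walk u v) :
    EdgeWalk G.code.2 u.val (wordCode p.word) v.val := by
  induction p with
  | nil => exact EdgeWalk.nil_iff.2 rfl
  | cons d p ih =>
    obtain ⟨⟨e, b⟩, rfl, rfl⟩ := d
    change EdgeWalk _ _ ((e.val, b) :: wordCode p.word) _
    rw [EdgeWalk.cons_iff, length_code, dartSrc_code, dartTgt_code]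
    exact ⟨e.2, rfl, ih⟩

theorem exists_walk_of_edgeWalk {u : G.V} {w : NatWord} {x : ℕ}
    (h : EdgeWalk G.code.2 u.val w x) :
    ∃ (v : G.V) (p : G.Walk u v), v.val = x ∧ wordCode p.word = w := by
  induction w generalizing u with
  | nil => exact ⟨u, .nil u, EdgeWalk.nil_iff.1 h, rfl⟩
  | cons d w ih =>
    obtain ⟨i, b⟩ := d
    rw [EdgeWalk.cons_iff, length_code] at h
    obtain ⟨hi, h1, h2⟩ := h
    let e : G.E := ⟨i, hi⟩
    have h1' : G.src (e, b) = u := Fin.ext ((dartSrc_code e b).symm.trans h1)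
    rw [show dartTgt G.code.2 (i, b) = _ from dartTgt_code e b] at h2
    obtain ⟨v, p, hv, hp⟩ := ih h2
    exact ⟨v, .cons ⟨(e, b), h1', rfl⟩ p, hv, congrArg _ hp⟩

theorem exists_walk_of_edgeWalk' {u v : G.V} {w : NatWord}
    (h : EdgeWalk G.code.2 u.val w v.val) : ∃ p : G.Walk u v, wordCode p.word = w := by
  obtain ⟨v', p, hv, hp⟩ := exists_walk_of_edgeWalk h
  obtain rfl := Fin.ext hv
  exact ⟨p, hp⟩

theorem Walk.nil_of_word_eq_nil {u v : G.V} (p : G.Walk u v) (h : wordCode p.word = []) :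
    ∃ huv : v = u, Path.Homotopic.Quotient.mk p.toPath =
      (Path.Homotopic.Quotient.refl (G.vert u)).cast rfl (congrArg G.vert huv) := by
  cases p with
  | nil => exact ⟨rfl, rfl⟩
  | cons d p => exact absurd h (List.cons_ne_nil _ _)

theorem Dart.trans_path_eq_refl {u v w : G.V} (d : G.Dart u v) (d' : G.Dart v w)
    (h : d'.1 = (d.1.1, !d.1.2)) : ∃ huw : w = u,
      (Path.Homotopic.Quotient.mk d.path).trans (.mk d'.path) =
        (Path.Homotopic.Quotient.refl (G.vert u)).cast rfl (congrArg G.vert huw) := by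
  obtain ⟨⟨e, b⟩, rfl, rfl⟩ := d
  obtain ⟨⟨e', b'⟩, h1, rfl⟩ := d'
  obtain ⟨rfl, rfl⟩ : e' = e ∧ b' = !b := Prod.mk.inj h
  cases b
  · exact ⟨rfl, Path.Homotopic.Quotient.symm_trans (.mk (G.edgePath e'))⟩
  · exact ⟨rfl, Path.Homotopic.Quotient.trans_symm (.mk (G.edgePath e'))⟩

/-- A cancelling pair is an oriented edge followed by its reverse, which is null-homotopic, so
cancellation does not change the path class. -/
theorem Walk.exists_of_red_step {u v : G.V} (p : G.Walk u v) {w : NatWord}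
    (h : FreeGroup.Red.Step (wordCode p.word) w) : ∃ p' : G.Walk u v, wordCode p'.word = w ∧
      Path.Homotopic.Quotient.mk p'.toPath = .mk p.toPath := by
  generalize hw : wordCode p.word = w₀ at h
  obtain @⟨L₁, L₂, x, b⟩ := h
  induction L₁ generalizing u with
  | nil =>
    cases p with
    | nil => exact absurd hw (List.cons_ne_nil _ _).symm
    | cons d p =>
      cases p with
      | nil => simp [Walk.word, wordCode] at hw
      | cons d' p =>
        simp only [Walk.word_cons, wordCode_cons, List.nil_append, List.cons.injEq] at hw
        obtain ⟨h1, h2, h3⟩ := hw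
        have hd : d'.1 = (d.1.1, !d.1.2) := by
          obtain ⟨h4, h5⟩ := Prod.ext_iff.1 h1
          obtain ⟨h6, h7⟩ := Prod.ext_iff.1 h2
          simp only at h4 h5 h6 h7
          exact Prod.ext (Fin.ext (h6.trans h4.symm)) (by simp only [h7, h5])
        obtain ⟨rfl, h⟩ := Dart.trans_path_eq_refl d d' hd
        refine ⟨p, h3, ?_⟩
        rw [mk_toPath_cons, mk_toPath_cons, ← Path.Homotopic.Quotient.trans_assoc, h]
        simp
  | cons y L₁ ih =>
    cases p with
    | nil => exact absurd hw (List.cons_ne_nil _ _).symm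
    | cons d p =>
      simp only [Walk.word_cons, wordCode_cons, List.cons_append, List.cons.injEq] at hw
      obtain ⟨p', hp', h⟩ := ih p hw.2
      exact ⟨.cons d p', by rw [Walk.word_cons, wordCode_cons, hw.1, hp', List.cons_append],
        by rw [mk_toPath_cons, mk_toPath_cons, h]⟩

theorem Walk.exists_of_red {u v : G.V} (p : G.Walk u v) {w : NatWord}
    (h : FreeGroup.Red (wordCode p.word) w) : ∃ p' : G.Walk u v, wordCode p'.word = w ∧
      Path.Homotopic.Quotient.mk p'.toPath = .mk p.toPath := by
  induction h with
  | refl => exact ⟨p, rfl, rfl⟩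
  | tail _ hs ih =>
    obtain ⟨p', rfl, h⟩ := ih
    obtain ⟨p'', h', h''⟩ := p'.exists_of_red_step hs
    exact ⟨p'', h', h''.trans h⟩

theorem hol_refl (u : G.V) : hol (.refl (G.vert u)) = 1 := hol_walk (.nil u)

theorem wordCode_append {n : ℕ} (w w' : List (Fin n × Bool)) :
    wordCode (w ++ w') = wordCode w ++ wordCode w' := List.map_append

theorem Walk.word_append {u v w : G.V} (p : G.Walk u v) (q : G.Walk v w) :
    (p.append q).word = p.word ++ q.word := by
  induction p with
  | nil => rfl
  | cons d p ih => rw [append, word_cons, word_cons, ih, List.cons_append]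

theorem hol_trans {u v w : G.V} (m : Path.Homotopic.Quotient (G.vert u) (G.vert v))
    (m' : Path.Homotopic.Quotient (G.vert v) (G.vert w)) : hol (m.trans m') = hol m * hol m' := by
  obtain ⟨p, rfl⟩ := isWalkClass m
  obtain ⟨q, rfl⟩ := isWalkClass m'
  rw [← Walk.mk_toPath_append, hol_walk, hol_walk, hol_walk, Walk.word_append, wordCode_append,
    FreeGroup.mul_mk]

theorem hol_symm {u v : G.V} (m : Path.Homotopic.Quotient (G.vert u) (G.vert v)) :
    hol m.symm = (hol m)⁻¹ := by
  rw [eq_inv_iff_mul_eq_one, ← hol_trans, Path.Homotopic.Quotient.symm_trans, hol_refl]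

/-- An edge path in the class has a word that reduces to the empty word, and the whole reduction is
carried out by homotopies. -/
theorem eq_refl_of_hol_eq_one {u : G.V} {m : Path.Homotopic.Quotient (G.vert u) (G.vert u)}
    (h : hol m = 1) : m = .refl (G.vert u) := by
  obtain ⟨p, rfl⟩ := isWalkClass m
  rw [hol_walk, FreeGroup.one_eq_mk] at h
  have hr : FreeGroup.Red (wordCode p.word) [] := by
    have := FreeGroup.reduce.red (L := wordCode p.word)
    rwa [FreeGroup.reduce.sound h, FreeGroup.reduce_nil] at this
  obtain ⟨p', hp', h'⟩ := p.exists_of_red hr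
  obtain ⟨_, h2⟩ := p'.nil_of_word_eq_nil hp'
  rw [← h', h2]
  simp

theorem hol_injective {u v : G.V} :
    Function.Injective (hol (G := G) (u := u) (v := v)) := by
  intro m m' h
  have h1 : m.trans m'.symm = .refl _ := by
    apply eq_refl_of_hol_eq_one
    rw [hol_trans, hol_symm, h, mul_inv_cancel]
  rw [← Path.Homotopic.Quotient.trans_refl m, ← Path.Homotopic.Quotient.symm_trans m',
    ← Path.Homotopic.Quotient.trans_assoc, h1, Path.Homotopic.Quotient.refl_trans]

theorem exists_edgeWalk_hol {u v : G.V} (m : Path.Homotopic.Quotient (G.vert u) (G.vert v)) :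
    ∃ w, EdgeWalk G.code.2 u.val w v.val ∧ FreeGroup.mk w = hol m := by
  obtain ⟨p, rfl⟩ := isWalkClass m
  exact ⟨_, p.edgeWalk, (hol_walk p).symm⟩

theorem exists_hol_eq {u v : G.V} {w : NatWord} (h : EdgeWalk G.code.2 u.val w v.val) :
    ∃ m : Path.Homotopic.Quotient (G.vert u) (G.vert v), hol m = FreeGroup.mk w := by
  obtain ⟨p, rfl⟩ := exists_walk_of_edgeWalk' h
  exact ⟨_, hol_walk p⟩

/-- The holonomy representation of the fundamental group. The inverse is due to the order of
composition in the fundamental group. -/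
noncomputable def holHom (v : G.V) : FundamentalGroup G.Space (G.vert v) →* FreeGroup ℕ where
  toFun m := (hol (FundamentalGroup.toPath m))⁻¹
  map_one' := by
    rw [inv_eq_one]
    exact hol_refl v
  map_mul' m m' := by
    rw [← mul_inv_rev, ← hol_trans]
    rfl

theorem holHom_apply {v : G.V} (m : FundamentalGroup G.Space (G.vert v)) :
    holHom v m = (hol (FundamentalGroup.toPath m))⁻¹ := rfl

theorem holHom_injective (v : G.V) : Function.Injective (holHom (G := G) v) := fun _ _ h =>
  hol_injective (inv_injective h)

theorem holHom_toPi {v : G.V} (p : G.Walk v v) :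
    holHom v p.toPi = (FreeGroup.mk (wordCode p.word))⁻¹ := by
  rw [← hol_walk]
  rfl

theorem range_holHom (v : G.V) : (holHom v).range = walkGroup G.code.2 v.val := by
  ext x
  constructor
  · rintro ⟨m, rfl⟩
    rw [holHom_apply, inv_mem_iff]
    exact exists_edgeWalk_hol _
  · intro h
    obtain ⟨w, hw, h⟩ := inv_mem h
    obtain ⟨m, hm⟩ := exists_hol_eq hw
    refine ⟨FundamentalGroup.fromPath m, ?_⟩
    rw [holHom_apply]
    change (hol m)⁻¹ = x
    rw [hm, h, inv_inv]

/-! ### Induced maps -/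

/-- The map `F` takes vertices to vertices as given by `φ`, and edges to paths homotopic to the edge
paths given by `ω`. -/
def Realizes (F : C(G.Space, H.Space)) (φ : G.V → H.V)
    (ω : ∀ e, H.Walk (φ (G.init e)) (φ (G.term e))) : Prop :=
  ∃ hV : ∀ v, F (G.vert v) = H.vert (φ v), ∀ e,
    ((Path.Homotopic.Quotient.mk (G.edgePath e)).map F).cast (hV _).symm (hV _).symm =
      .mk (ω e).toPath

theorem _root_.TightMap.Describes.realizes {f : TightMap G H} {F : C(G.Space, H.Space)}
    (h : f.Describes F) : Realizes F f.onV f.onE := by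
  refine ⟨h.1, fun e => ?_⟩
  obtain ⟨r, hr⟩ := h.2 e
  have h0 : r 0 = 0 := r.map_bot
  have h1 : r 1 = 1 := r.map_top
  rw [Path.Homotopic.Quotient.eq.2
    ⟨Path.Homotopy.reparam (f.onE e).toPath r r.continuous h0 h1⟩]
  refine congrArg Path.Homotopic.Quotient.mk (Path.ext (funext fun t => ?_))
  exact hr t

/-- The words of the edge paths of a map of graphs. -/
def edgeWords {φ : G.V → H.V} (ω : ∀ e, H.Walk (φ (G.init e)) (φ (G.term e))) : List NatWord :=
  List.ofFn fun e => wordCode (ω e).word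

theorem substHom_edgeWords {φ : G.V → H.V} (ω : ∀ e, H.Walk (φ (G.init e)) (φ (G.term e)))
    (e : G.E) : substHom (edgeWords ω) (FreeGroup.mk [(e.val, true)]) =
      FreeGroup.mk (wordCode (ω e).word) := by
  rw [← mk_substWord]
  congr 1
  simp [substWord, edgeWords]

/-- Both sides are multiplicative in the class, and path classes between vertices are products of
edges and their inverses, where the claim is the definition of `Realizes`. -/
theorem hol_map {F : C(G.Space, H.Space)} {φ : G.V → H.V}
    {ω : ∀ e, H.Walk (φ (G.init e)) (φ (G.term e))} (h : Realizes F φ ω) {u v : G.V}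
    (m : Path.Homotopic.Quotient (G.vert u) (G.vert v)) (hu : H.vert (φ u) = F (G.vert u))
    (hv : H.vert (φ v) = F (G.vert v)) :
    hol ((m.map F).cast hu hv) = substHom (edgeWords ω) (hol m) := by
  obtain ⟨hV, hE⟩ := h
  have key : ∀ e, hol (((Path.Homotopic.Quotient.mk (G.edgePath e)).map F).cast (hV _).symm
      (hV _).symm) = substHom (edgeWords ω) (FreeGroup.mk [(e.val, true)]) := by
    intro e
    rw [hE e, hol_walk, substHom_edgeWords]
  obtain ⟨p, rfl⟩ := isWalkClass m
  rw [hol_walk]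
  induction p with
  | nil u =>
    have : ((Path.Homotopic.Quotient.mk (Walk.nil u).toPath).map F).cast hu hv =
        .refl (H.vert (φ u)) := by
      refine congrArg Path.Homotopic.Quotient.mk (Path.ext (funext fun t => ?_))
      exact hu.symm
    rw [this, hol_refl]
    exact (map_one _).symm
  | cons d p ih =>
    rw [Walk.mk_toPath_cons, Path.Homotopic.Quotient.map_trans,
      ← Path.Homotopic.Quotient.cast_trans_cast _ _ hu (hV _).symm hv, hol_trans, ih,
      Walk.word_cons, wordCode_cons, ← List.singleton_append, ← FreeGroup.mul_mk, map_mul]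
    congr 1
    obtain ⟨⟨e, _ | _⟩, rfl, rfl⟩ := d
    · have := key e
      rw [← inv_inj, ← hol_symm, Path.Homotopic.Quotient.cast_symm,
        ← Path.Homotopic.Quotient.map_symm, ← map_inv] at this
      exact this
    · exact key e

theorem holHom_mapOfEq {F : C(G.Space, H.Space)} {φ : G.V → H.V}
    {ω : ∀ e, H.Walk (φ (G.init e)) (φ (G.term e))} (h : Realizes F φ ω) (v : G.V)
    (hv : F (G.vert v) = H.vert (φ v)) (m : FundamentalGroup G.Space (G.vert v)) :
    holHom (φ v) (FundamentalGroup.mapOfEq F hv m) = substHom (edgeWords ω) (holHom v m) := by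
  rw [FundamentalGroup.mapOfEq_apply, holHom_apply, holHom_apply, map_inv]
  exact congrArg _ (hol_map h (FundamentalGroup.toPath m) hv.symm hv.symm)

theorem map_range_mapOfEq {F : C(G.Space, H.Space)} {φ : G.V → H.V}
    {ω : ∀ e, H.Walk (φ (G.init e)) (φ (G.term e))} (h : Realizes F φ ω) (v : G.V)
    (hv : F (G.vert v) = H.vert (φ v)) :
    (FundamentalGroup.mapOfEq F hv).range.map (holHom (φ v)) =
      (walkGroup G.code.2 v.val).map (substHom (edgeWords ω)) := by
  rw [← range_holHom, MonoidHom.map_range, MonoidHom.map_range]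
  congr 1
  exact MonoidHom.ext (holHom_mapOfEq h v hv)

theorem exists_path_vert (x : G.Space) : ∃ v, Nonempty (Path (G.vert v) x) := by
  induction x using Space.ind with
  | hv v => exact ⟨v, ⟨.refl _⟩⟩
  | he e t =>
    obtain ⟨p⟩ : Nonempty (Path (0 : I) t) := PathConnectedSpace.joined _ _
    exact ⟨G.init e, ⟨(edgeSegment e p).cast (G.pt_zero e).symm rfl⟩⟩

/-- Injectivity on fundamental groups, in terms of the words of the edge paths. -/
theorem piOneInjective_iff {F : C(G.Space, H.Space)} {φ : G.V → H.V}
    {ω : ∀ e, H.Walk (φ (G.init e)) (φ (G.term e))} (h : Realizes F φ ω) :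
    PiOneInjective F ↔ ∀ v : G.V, ∀ y ∈ walkGroup G.code.2 v.val,
      substHom (edgeWords ω) y = 1 → y = 1 := by
  obtain ⟨hV, -⟩ := id h
  constructor
  · intro hF v y hy hy1
    obtain ⟨w, hw, rfl⟩ := hy
    obtain ⟨m, hm⟩ := exists_hol_eq hw
    rw [← hm, ← hol_map h m (hV v).symm (hV v).symm] at hy1
    have h1 := eq_refl_of_hol_eq_one hy1
    have h2 : FundamentalGroup.map F (G.vert v) (FundamentalGroup.fromPath m) =
        FundamentalGroup.map F (G.vert v) 1 := by
      have h3 : m.map F = .refl _ := Path.Homotopic.Quotient.eq_refl_of_cast (hV v).symm h1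
      rw [map_one]
      exact h3
    have h4 : m = .refl _ := hF _ h2
    rw [← hm, h4, hol_refl]
  · intro hF x
    rw [injective_iff_map_eq_one]
    intro m hm
    -- An arbitrary base point is joined to a vertex, and the loop is conjugated to one based at
    -- that vertex.
    obtain ⟨v, ⟨c⟩⟩ := exists_path_vert x
    let c' := Path.Homotopic.Quotient.mk c
    let m' : Path.Homotopic.Quotient x x := m
    have hm' : m'.map F = .refl _ := hm
    have h1 : ((c'.trans m').trans c'.symm).map F = .refl _ := by
      rw [Path.Homotopic.Quotient.map_trans, Path.Homotopic.Quotient.map_trans, hm',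
        Path.Homotopic.Quotient.trans_refl, Path.Homotopic.Quotient.map_symm,
        Path.Homotopic.Quotient.trans_symm]
    have h2 : hol ((c'.trans m').trans c'.symm) = 1 := by
      refine hF v _ (exists_edgeWalk_hol _) ?_
      rw [← hol_map h _ (hV v).symm (hV v).symm, h1, ← hol_refl (φ v)]
      congr 1
      refine congrArg Path.Homotopic.Quotient.mk (Path.ext (funext fun t => ?_))
      exact hV v
    have h3 := eq_refl_of_hol_eq_one h2
    have h4 : m' = (c'.symm.trans ((c'.trans m').trans c'.symm)).trans c' := by
      simp only [Path.Homotopic.Quotient.trans_assoc, Path.Homotopic.Quotient.symm_trans,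
        Path.Homotopic.Quotient.trans_refl]
      rw [← Path.Homotopic.Quotient.trans_assoc, Path.Homotopic.Quotient.symm_trans,
        Path.Homotopic.Quotient.refl_trans]
    rw [h3, Path.Homotopic.Quotient.trans_refl, Path.Homotopic.Quotient.symm_trans] at h4
    exact h4

end FinGraph

/-! ### Homotopies of maps on graphs -/

theorem Path.Homotopic.Quotient.trans_cast_eq_cast_trans {X : Type*} [TopologicalSpace X]
    {x y x' y' x'' y'' : X} {m : Path.Homotopic.Quotient x y} {b : Path.Homotopic.Quotient x x'}
    {b' : Path.Homotopic.Quotient y y'} {k : Path.Homotopic.Quotient x' y'}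
    (h : m.trans b' = b.trans k) (hx : x'' = x') (hy : y'' = y') :
    m.trans (b'.cast rfl hy) = (b.cast rfl hx).trans (k.cast hx hy) := by
  subst hx hy
  simpa using h

/-! ### Homotopies between concatenations as maps of a square -/

section Square

variable {X Y : Type*} [TopologicalSpace X] [TopologicalSpace Y]

/-- By compactness of the interval, the slices near `b x₀` lie uniformly close to `y`. Hence no
continuity of `a` is needed. -/
theorem ContinuousMap.continuousAt_of_constant_slice (Γ : C(I × I, Y)) {a b : X → I} {x₀ : X} {y : Y}
    (hb : ContinuousAt b x₀) (h : ∀ s, Γ (s, b x₀) = y) :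
    ContinuousAt (fun x => Γ (a x, b x)) x₀ := by
  intro U hU
  simp only [h] at hU
  obtain ⟨V, hVU, hV, hy⟩ := mem_nhds_iff.1 hU
  let Γ' : C(I, C(I, Y)) := (Γ.comp .prodSwap).curry
  have ho : IsOpen {f : C(I, Y) | Set.MapsTo f Set.univ V} :=
    ContinuousMap.isOpen_setOfPred_mapsTo isCompact_univ hV
  have hc : ContinuousAt (fun x => Γ' (b x)) x₀ := Γ'.continuous.continuousAt.comp hb
  have := hc.preimage_mem_nhds (ho.mem_nhds fun s _ => by
    change Γ (s, b x₀) ∈ V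
    rwa [h])
  exact Filter.mem_map.2 (Filter.mem_of_superset this fun x hx => hVU (hx (Set.mem_univ (a x))))

theorem Path.trans_half {a b c : Y} (p : Path a b) (q : Path b c) (t u : I)
    (h : (u : ℝ) = t / 2) : p.trans q u = p t := by
  rw [Path.trans_apply, dif_pos (by rw [h]; linarith [t.2.2])]
  congr 1
  exact Subtype.ext (by simp only [h]; ring)

theorem Path.trans_half' {a b c : Y} (p : Path a b) (q : Path b c) (t u : I)
    (h : (u : ℝ) = (1 + t) / 2) : p.trans q u = q t := by
  rw [Path.trans_apply]
  split_ifs with h'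
  · have ht : t = 0 := Subtype.ext (le_antisymm (by rw [h] at h'; simp; linarith) t.2.1)
    subst ht
    rw [q.source]
    refine Eq.trans (congrArg p (Subtype.ext ?_)) p.target
    simp [h]
  · congr 1
    exact Subtype.ext (by simp only [h]; ring)

/-- A homotopy between two concatenations is a square. -/
theorem Path.Homotopic.exists_square {a b c d : Y} {p : Path a b} {q : Path b d} {r : Path a c}
    {s : Path c d} (h : (p.trans q).Homotopic (r.trans s)) : ∃ K : C(I × I, Y),
      (∀ t, K (0, t) = p t) ∧ (∀ t, K (1, t) = s t) ∧ (∀ x, K (x, 0) = r x) ∧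
        ∀ x, K (x, 1) = q x := by
  obtain ⟨Γ⟩ := h
  have hnum : ∀ x : I × I, 0 ≤ (x.1 : ℝ) * (1 - x.2) := fun x =>
    mul_nonneg x.1.2.1 (by linarith [x.2.2.2])
  have hnum' : ∀ x : I × I, 0 ≤ (x.2 : ℝ) * (1 - x.1) := fun x =>
    mul_nonneg x.2.2.1 (by linarith [x.1.2.2])
  -- The homotopy time is `0` on the two sides traversed by `p` and `q` and `1` on those traversed
  -- by `r` and `s`, away from the corners `(0, 0)` and `(1, 1)`. At these corners the quotient is
  -- `0/0` and discontinuous, but the path time `β` is `0` or `1` there and the homotopy is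
  -- constant.
  let α : I × I → I := fun x => ⟨x.1 * (1 - x.2) / (x.1 * (1 - x.2) + x.2 * (1 - x.1)),
    div_nonneg (hnum x) (add_nonneg (hnum x) (hnum' x)),
    div_le_one_of_le₀ (by linarith [hnum' x]) (add_nonneg (hnum x) (hnum' x))⟩
  let β : I × I → I := fun x => ⟨(x.1 + x.2) / 2, by linarith [x.1.2.1, x.2.2.1],
    by linarith [x.1.2.2, x.2.2.2]⟩
  have hβ : Continuous β := by fun_prop
  have hc0 : ∀ x : I × I, β x = 0 → ∀ s, Γ (s, β x) = a := fun x hx s => by rw [hx, Γ.source]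
  have hc1 : ∀ x : I × I, β x = 1 → ∀ s, Γ (s, β x) = d := fun x hx s => by rw [hx, Γ.target]
  have hcont : Continuous fun x => Γ (α x, β x) := by
    refine continuous_iff_continuousAt.2 fun x => ?_
    by_cases hx : (x.1 : ℝ) * (1 - x.2) + x.2 * (1 - x.1) = 0
    · have h1 : (x.1 : ℝ) * (1 - x.2) = 0 := by linarith [hnum x, hnum' x]
      have h2 : (x.2 : ℝ) * (1 - x.1) = 0 := by linarith [hnum x, hnum' x]
      rcases mul_eq_zero.1 h1 with h3 | h3
      · have h4 : (x.2 : ℝ) = 0 := by simpa [h3] using h2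
        exact ContinuousMap.continuousAt_of_constant_slice Γ.toContinuousMap hβ.continuousAt
          (hc0 x (Subtype.ext (by simp [β, h3, h4])))
      · have h4 : (x.2 : ℝ) = 1 := by linarith
        have h5 : (x.1 : ℝ) = 1 := by rw [h4] at h2; linarith
        exact ContinuousMap.continuousAt_of_constant_slice Γ.toContinuousMap hβ.continuousAt
          (hc1 x (Subtype.ext (by simp [β, h4, h5])))
    · have hα : ContinuousAt α x := by
        rw [Topology.IsInducing.subtypeVal.continuousAt_iff]
        exact ContinuousAt.div (by fun_prop) (by fun_prop) hx
      exact Γ.continuous.continuousAt.comp (hα.prodMk hβ.continuousAt)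
  have h0 : ∀ x : I × I, (x.1 : ℝ) * (1 - x.2) = 0 → Γ (α x, β x) = p.trans q (β x) := by
    intro x hx
    have : α x = 0 := Subtype.ext (by simp only [α, hx]; simp)
    rw [this, Γ.apply_zero]
    rfl
  have h1 : ∀ x : I × I, (x.2 : ℝ) * (1 - x.1) = 0 → Γ (α x, β x) = r.trans s (β x) := by
    intro x hx
    by_cases hx' : (x.1 : ℝ) * (1 - x.2) = 0
    · rw [h0 x hx']
      rcases mul_eq_zero.1 hx with h3 | h3
      · have h4 : (x.1 : ℝ) = 0 := by simpa [h3] using hx'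
        have : β x = 0 := Subtype.ext (by simp [β, h3, h4])
        rw [this, Path.source, Path.source]
      · have h4 : (x.1 : ℝ) = 1 := by linarith
        have h5 : (x.2 : ℝ) = 1 := by rw [h4] at hx'; linarith
        have : β x = 1 := Subtype.ext (by simp [β, h4, h5])
        rw [this, Path.target, Path.target]
    · have : α x = 1 := Subtype.ext (by simp only [α, hx, add_zero]; exact div_self hx')
      rw [this, Γ.apply_one]
      rfl
  refine ⟨⟨_, hcont⟩, fun t => ?_, fun t => ?_, fun x => ?_, fun x => ?_⟩
  · exact (h0 (0, t) (by simp)).trans (Path.trans_half _ _ _ _ (by simp [β]))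
  · exact (h1 (1, t) (by simp)).trans (Path.trans_half' _ _ _ _ (by simp [β]))
  · exact (h1 (x, 0) (by simp)).trans (Path.trans_half _ _ _ _ (by simp [β]))
  · exact (h0 (x, 1) (by simp)).trans (Path.trans_half' _ _ _ _ (by simp [β, add_comm]))

end Square

namespace FinGraph

variable {G H : FinGraph} {Y : Type*} [TopologicalSpace Y]

/-- Maps on a graph are homotopic if they are related by paths at the vertices which are natural with
respect to the edges. -/
theorem homotopic_of_edges {Φ Ψ : C(G.Space, Y)}
    (δ : ∀ v, Path.Homotopic.Quotient (Φ (G.vert v)) (Ψ (G.vert v)))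
    (h : ∀ e, ((Path.Homotopic.Quotient.mk (G.edgePath e)).map Φ).trans (δ (G.term e)) =
      (δ (G.init e)).trans ((Path.Homotopic.Quotient.mk (G.edgePath e)).map Ψ)) :
    Φ.Homotopic Ψ := by
  choose d hd using fun v => Path.Homotopic.Quotient.mk_surjective (δ v)
  simp only [← hd] at h
  choose K hK0 hK1 hKi hKt using fun e =>
    Path.Homotopic.exists_square (Path.Homotopic.Quotient.eq.1 (h e))
  refine ⟨⟨liftProd (fun v => (d v).toContinuousMap) K hKi hKt, fun x => ?_, fun x => ?_⟩⟩
  · induction x using Space.ind with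
    | hv v => exact (d v).source
    | he e t => exact hK0 e t
  · induction x using Space.ind with
    | hv v => exact (d v).target
    | he e t => exact hK1 e t

/-- The map on realizations which sends edges to the given edge paths. -/
noncomputable def realize (φ : G.V → H.V) (ω : ∀ e, H.Walk (φ (G.init e)) (φ (G.term e))) :
    C(G.Space, H.Space) :=
  ⟨Space.lift (fun v => H.vert (φ v)) (fun e t => (ω e).toPath t) (fun e => (ω e).toPath.source)
    (fun e => (ω e).toPath.target), continuous_iff.2 fun e => (ω e).toPath.continuous⟩

theorem class_induction {P : ∀ u v : G.V, Path.Homotopic.Quotient (G.vert u) (G.vert v) → Prop}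
    (refl : ∀ u, P u u (.refl _)) (edge : ∀ e, P _ _ (.mk (G.edgePath e)))
    (symm : ∀ u v m, P u v m → P v u m.symm)
    (trans : ∀ u v w m m', P u v m → P v w m' → P u w (m.trans m')) {u v : G.V}
    (m : Path.Homotopic.Quotient (G.vert u) (G.vert v)) : P u v m := by
  obtain ⟨p, rfl⟩ := isWalkClass m
  induction p with
  | nil => exact refl _
  | cons d p ih =>
    rw [Walk.mk_toPath_cons]
    refine trans _ _ _ _ _ ?_ ih
    obtain ⟨⟨e, _ | _⟩, rfl, rfl⟩ := d
    · exact symm _ _ _ (edge e)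
    · exact edge e

/-- The induced map on path classes between vertices. -/
def vertMap {F : C(G.Space, H.Space)} {φ : G.V → H.V} (hV : ∀ v, F (G.vert v) = H.vert (φ v))
    {u v : G.V} (m : Path.Homotopic.Quotient (G.vert u) (G.vert v)) :
    Path.Homotopic.Quotient (H.vert (φ u)) (H.vert (φ v)) :=
  (m.map F).cast (hV u).symm (hV v).symm

section

variable {F : C(G.Space, H.Space)} {φ : G.V → H.V} (hV : ∀ v, F (G.vert v) = H.vert (φ v))

theorem vertMap_trans {u v w : G.V} (m : Path.Homotopic.Quotient (G.vert u) (G.vert v))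
    (m' : Path.Homotopic.Quotient (G.vert v) (G.vert w)) :
    vertMap hV (m.trans m') = (vertMap hV m).trans (vertMap hV m') := by
  rw [vertMap, Path.Homotopic.Quotient.map_trans]
  exact (Path.Homotopic.Quotient.cast_trans_cast _ _ _ _ _).symm

theorem vertMap_symm {u v : G.V} (m : Path.Homotopic.Quotient (G.vert u) (G.vert v)) :
    vertMap hV m.symm = (vertMap hV m).symm := by
  rw [vertMap, Path.Homotopic.Quotient.map_symm]
  exact (Path.Homotopic.Quotient.cast_symm _ _ _).symm

theorem vertMap_refl (u : G.V) : vertMap hV (.refl (G.vert u)) = .refl _ :=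
  congrArg Path.Homotopic.Quotient.mk (Path.ext (funext fun _ => hV u))

theorem map_eq_cast_vertMap {u v : G.V} (m : Path.Homotopic.Quotient (G.vert u) (G.vert v)) :
    m.map F = (vertMap hV m).cast (hV u) (hV v) := by
  rw [vertMap, Path.Homotopic.Quotient.cast_cast, Path.Homotopic.Quotient.cast_rfl_rfl]

end

/-- A map which is fully faithful on path classes of vertices, and surjective on components, is a
homotopy equivalence. -/
theorem isHomotopyEquivalence_of_vertMap {F : C(G.Space, H.Space)} {φ : G.V → H.V}
    (hV : ∀ v, F (G.vert v) = H.vert (φ v))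
    (inj : ∀ u v, Function.Injective (vertMap hV (u := u) (v := v)))
    (surj : ∀ u v, Function.Surjective (vertMap hV (u := u) (v := v)))
    (comp : ∀ w, ∃ v, Nonempty (Path.Homotopic.Quotient (H.vert w) (H.vert (φ v)))) :
    IsHomotopyEquivalence F := by
  choose ψ hψ using comp
  let β : ∀ w, Path.Homotopic.Quotient (H.vert w) (H.vert (φ (ψ w))) := fun w => (hψ w).some
  -- The homotopy inverse on edges: an edge of `H`, transported along the chosen paths `β` to the
  -- image of `G`, is lifted by fullness.
  choose κ hκ using fun e : H.E => surj (ψ (H.init e)) (ψ (H.term e))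
    (((β (H.init e)).symm.trans (.mk (H.edgePath e))).trans (β (H.term e)))
  choose ω hω using fun e => isWalkClass (κ e)
  let h : C(H.Space, G.Space) := realize ψ ω
  have hh : ∀ w, h (H.vert w) = G.vert (ψ w) := fun w => rfl
  have hE : ∀ e, vertMap hh (.mk (H.edgePath e)) = κ e := fun e => hω e
  -- Naturality of `β`, which holds on edges by the choice of `κ` and passes to all classes since
  -- edges generate them.
  have nat : ∀ {w w'} (m : Path.Homotopic.Quotient (H.vert w) (H.vert w')),
      m.trans (β w') = (β w).trans (vertMap hV (vertMap hh m)) := by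
    intro w w' m
    induction m using class_induction with
    | refl u =>
      rw [vertMap_refl, vertMap_refl, Path.Homotopic.Quotient.refl_trans,
        Path.Homotopic.Quotient.trans_refl]
    | edge e =>
      rw [hE, hκ, ← Path.Homotopic.Quotient.trans_assoc, ← Path.Homotopic.Quotient.trans_assoc,
        Path.Homotopic.Quotient.trans_symm, Path.Homotopic.Quotient.refl_trans]
    | symm u v m ih =>
      rw [vertMap_symm, vertMap_symm]
      have h1 : m.symm.trans ((m.trans (β v)).trans (vertMap hV (vertMap hh m)).symm) =
        m.symm.trans (((β u).trans (vertMap hV (vertMap hh m))).trans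
          (vertMap hV (vertMap hh m)).symm) := by rw [ih]
      rw [Path.Homotopic.Quotient.trans_assoc (β u), Path.Homotopic.Quotient.trans_symm,
        Path.Homotopic.Quotient.trans_refl, Path.Homotopic.Quotient.trans_assoc m,
        ← Path.Homotopic.Quotient.trans_assoc m.symm, Path.Homotopic.Quotient.symm_trans,
        Path.Homotopic.Quotient.refl_trans] at h1
      exact h1.symm
    | trans u v w m m' ih ih' =>
      rw [vertMap_trans, vertMap_trans, Path.Homotopic.Quotient.trans_assoc, ih',
        ← Path.Homotopic.Quotient.trans_assoc, ih, Path.Homotopic.Quotient.trans_assoc]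
  -- The other homotopy is obtained by lifting `β` through `F`; faithfulness reduces its naturality
  -- to that of `β`.
  choose γ hγ using fun v => surj v (ψ (φ v)) (β (φ v))
  have right : (F.comp h).Homotopic (ContinuousMap.id _) := by
    refine ContinuousMap.Homotopic.symm (homotopic_of_edges (fun w => (β w).cast rfl (hV _)) ?_)
    intro e
    have h1 : ((Path.Homotopic.Quotient.mk (H.edgePath e)).map (F.comp h)) =
        (vertMap hV (κ e)).cast (hV _) (hV _) := by
      rw [Path.Homotopic.Quotient.map_comp, ← map_eq_cast_vertMap hV (κ e), ← hE e]
      rfl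
    have h2 := nat (.mk (H.edgePath e))
    rw [hE] at h2
    rw [h1]
    exact Path.Homotopic.Quotient.trans_cast_eq_cast_trans h2 (hV _) (hV _)
  have left : (h.comp F).Homotopic (ContinuousMap.id _) := by
    refine ContinuousMap.Homotopic.symm (homotopic_of_edges
      (fun v => (γ v).cast rfl (congrArg h (hV v))) ?_)
    intro e
    have h1 : ((Path.Homotopic.Quotient.mk (G.edgePath e)).map (h.comp F)) =
        (vertMap hh (vertMap hV (.mk (G.edgePath e)))).cast (congrArg h (hV _))
          (congrArg h (hV _)) := by
      rw [Path.Homotopic.Quotient.map_comp, map_eq_cast_vertMap hV,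
        Path.Homotopic.Quotient.map_cast]
      rfl
    rw [h1]
    have h2 : (Path.Homotopic.Quotient.mk (G.edgePath e)).trans (γ (G.term e)) =
        (γ (G.init e)).trans (vertMap hh (vertMap hV (.mk (G.edgePath e)))) := by
      apply inj
      rw [vertMap_trans, vertMap_trans, hγ, hγ, nat]
    exact Path.Homotopic.Quotient.trans_cast_eq_cast_trans h2 (congrArg h (hV _))
      (congrArg h (hV _))
  exact ⟨⟨F, h, left, right⟩, rfl⟩

/-- A homotopy equivalence of graphs is fully faithful on path classes of vertices. -/
theorem vertMap_bijective_of_isHomotopyEquivalence {F : C(G.Space, H.Space)} {φ : G.V → H.V}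
    (hV : ∀ v, F (G.vert v) = H.vert (φ v)) (hF : IsHomotopyEquivalence F) (u v : G.V) :
    Function.Bijective (vertMap hV (u := u) (v := v)) := by
  obtain ⟨h, rfl⟩ := hF
  have hb := (FundamentalGroupoidFunctor.equivOfHomotopyEquiv h).fullyFaithfulFunctor.map_bijective
    ⟨G.vert u⟩ ⟨G.vert v⟩
  have hb' : Function.Bijective fun m : Path.Homotopic.Quotient (G.vert u) (G.vert v) =>
    m.map h.toFun := hb
  constructor
  · intro m m' hm
    apply hb'.1
    change m.map h.toFun = m'.map h.toFun
    rw [map_eq_cast_vertMap hV, map_eq_cast_vertMap hV, hm]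
  · intro m
    obtain ⟨m', hm'⟩ := hb'.2 (m.cast (hV u) (hV v))
    refine ⟨m', ?_⟩
    have hm'' : m'.map h.toFun = m.cast (hV u) (hV v) := hm'
    rw [vertMap, hm'', Path.Homotopic.Quotient.cast_cast, Path.Homotopic.Quotient.cast_rfl_rfl]

theorem exists_path_of_isHomotopyEquivalence {F : C(G.Space, H.Space)} {φ : G.V → H.V}
    (hV : ∀ v, F (G.vert v) = H.vert (φ v)) (hF : IsHomotopyEquivalence F) (w : H.V) :
    ∃ v, Nonempty (Path.Homotopic.Quotient (H.vert (φ v)) (H.vert w)) := by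
  obtain ⟨h, rfl⟩ := hF
  obtain ⟨v, ⟨p⟩⟩ := exists_path_vert (h.invFun (H.vert w))
  obtain ⟨K⟩ := h.right_inv
  refine ⟨v, ⟨.mk ?_⟩⟩
  exact (((p.map h.toFun.continuous).cast (hV v).symm rfl).trans (K.evalAt (H.vert w)))

end FinGraph

/-! ### Free bases -/

/-- Inverting every generator is an automorphism of the free group. It is needed because `holHom`
sends a closed edge path to the inverse of its word. -/
theorem isFreeBasisOf_inv {A : Type*} [Group A] {m : ℕ} {w : Fin m → A} {K : Subgroup A}
    (h : IsFreeBasisOf w K) : IsFreeBasisOf (fun i => (w i)⁻¹) K := by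
  rw [isFreeBasisOf_iff] at h ⊢
  let ι : FreeGroup (Fin m) →* FreeGroup (Fin m) := FreeGroup.lift fun i => (FreeGroup.of i)⁻¹
  have hι : ∀ x, ι (ι x) = x := by
    have : ι.comp ι = MonoidHom.id _ := FreeGroup.ext_hom _ _ fun i => by simp [ι]
    exact fun x => DFunLike.congr_fun this x
  have hl : FreeGroup.lift (fun i => (w i)⁻¹) = (FreeGroup.lift w).comp ι :=
    FreeGroup.ext_hom _ _ fun i => by simp [ι]
  rw [hl]
  refine ⟨h.1.comp (Function.LeftInverse.injective hι), ?_⟩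
  rw [MonoidHom.range_comp, MonoidHom.range_eq_top.2 (Function.RightInverse.surjective hι),
    ← MonoidHom.range_eq_map, h.2]

theorem isFreeBasisOf_of_map {A B : Type*} [Group A] [Group B] {f : A →* B}
    (hf : Function.Injective f) {m : ℕ} {w : Fin m → A} {K : Subgroup A}
    (h : IsFreeBasisOf (fun i => f (w i)) (K.map f)) : IsFreeBasisOf w K := by
  rw [isFreeBasisOf_iff] at h ⊢
  have hl : FreeGroup.lift (fun i => f (w i)) = f.comp (FreeGroup.lift w) :=
    FreeGroup.ext_hom _ _ fun i => by simp
  rw [hl] at h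
  refine ⟨fun x y hxy => h.1 (congrArg f hxy), Subgroup.map_injective hf ?_⟩
  rw [← MonoidHom.range_comp]
  exact h.2

namespace FinGraph

variable {G H : FinGraph}

theorem edgeJoined_iff_nonempty {u v : G.V} : EdgeJoined G.code.2 u.val v.val ↔
    Nonempty (Path.Homotopic.Quotient (G.vert u) (G.vert v)) := by
  constructor
  · rintro ⟨w, hw⟩
    obtain ⟨m, -⟩ := exists_hol_eq hw
    exact ⟨m⟩
  · rintro ⟨m⟩
    obtain ⟨w, hw, -⟩ := exists_edgeWalk_hol m
    exact ⟨w, hw⟩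

theorem hol_mem_walkGroup {v : G.V} (m : Path.Homotopic.Quotient (G.vert v) (G.vert v)) :
    hol m ∈ walkGroup G.code.2 v.val := exists_edgeWalk_hol m

theorem exists_hol_eq_of_mem {v : G.V} {y : FreeGroup ℕ} (h : y ∈ walkGroup G.code.2 v.val) :
    ∃ m : Path.Homotopic.Quotient (G.vert v) (G.vert v), hol m = y := by
  obtain ⟨w, hw, rfl⟩ := h
  exact exists_hol_eq hw

/-- Homotopy equivalence, in terms of the words of the edge paths. -/
theorem isHomotopyEquivalence_iff {F : C(G.Space, H.Space)} {φ : G.V → H.V}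
    {ω : ∀ e, H.Walk (φ (G.init e)) (φ (G.term e))} (h : Realizes F φ ω) :
    IsHomotopyEquivalence F ↔
      (∀ v : G.V, ∀ y ∈ walkGroup G.code.2 v.val, substHom (edgeWords ω) y = 1 → y = 1) ∧
      (∀ v : G.V, walkGroup H.code.2 (φ v).val ≤
        (walkGroup G.code.2 v.val).map (substHom (edgeWords ω))) ∧
      (∀ u v : G.V, EdgeJoined H.code.2 (φ u).val (φ v).val →
        EdgeJoined G.code.2 u.val v.val) ∧
      (∀ w : H.V, ∃ v : G.V, EdgeJoined H.code.2 w.val (φ v).val) := by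
  obtain ⟨hV, -⟩ := id h
  have hol_vm : ∀ {u v : G.V} (m : Path.Homotopic.Quotient (G.vert u) (G.vert v)),
      hol (vertMap hV m) = substHom (edgeWords ω) (hol m) := fun m =>
    hol_map h m (hV _).symm (hV _).symm
  constructor
  · intro hF
    have hb := vertMap_bijective_of_isHomotopyEquivalence hV hF
    refine ⟨fun v y hy hy1 => ?_, fun v y hy => ?_, fun u v huv => ?_, fun w => ?_⟩
    · obtain ⟨m, rfl⟩ := exists_hol_eq_of_mem hy
      rw [← hol_vm] at hy1
      have h1 := eq_refl_of_hol_eq_one hy1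
      rw [← vertMap_refl hV] at h1
      rw [(hb v v).1 h1, hol_refl]
    · obtain ⟨m', rfl⟩ := exists_hol_eq_of_mem hy
      obtain ⟨m, rfl⟩ := (hb v v).2 m'
      exact ⟨hol m, hol_mem_walkGroup m, (hol_vm m).symm⟩
    · rw [edgeJoined_iff_nonempty] at huv ⊢
      obtain ⟨m'⟩ := huv
      obtain ⟨m, -⟩ := (hb u v).2 m'
      exact ⟨m⟩
    · obtain ⟨v, ⟨m⟩⟩ := exists_path_of_isHomotopyEquivalence hV hF w
      exact ⟨v, edgeJoined_iff_nonempty.2 ⟨m.symm⟩⟩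
  · rintro ⟨h1, h2, h3, h4⟩
    refine isHomotopyEquivalence_of_vertMap hV (fun u v m m' hm => ?_) (fun u v m' => ?_)
      fun w => (h4 w).imp fun v => edgeJoined_iff_nonempty.1
    · apply hol_injective
      rw [← mul_inv_eq_one, ← hol_symm, ← hol_trans]
      refine h1 u _ (hol_mem_walkGroup _) ?_
      rw [← hol_vm, vertMap_trans, vertMap_symm, hm, Path.Homotopic.Quotient.trans_symm, hol_refl]
    · obtain ⟨m₀⟩ := edgeJoined_iff_nonempty.1 (h3 u v (edgeJoined_iff_nonempty.2 ⟨m'⟩))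
      obtain ⟨y, hy, hy'⟩ := h2 u (hol_mem_walkGroup (m'.trans (vertMap hV m₀).symm))
      obtain ⟨m₁, rfl⟩ := exists_hol_eq_of_mem hy
      refine ⟨m₁.trans m₀, hol_injective ?_⟩
      rw [vertMap_trans, hol_trans, hol_vm, hy', hol_trans, hol_symm, inv_mul_cancel_right]

/-! ### Stallings graphs -/

theorem pathConnectedSpace_of_edgeJoined {p : G.V}
    (h : ∀ v : G.V, EdgeJoined G.code.2 p.val v.val) : PathConnectedSpace G.Space := by
  have key : ∀ x, Joined (G.vert p) x := by
    intro x
    obtain ⟨v, ⟨c⟩⟩ := exists_path_vert x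
    obtain ⟨m⟩ := edgeJoined_iff_nonempty.1 (h v)
    obtain ⟨c', -⟩ := Path.Homotopic.Quotient.mk_surjective m
    exact ⟨c'.trans c⟩
  exact ⟨⟨G.vert p⟩, fun x y => (key x).symm.trans (key y)⟩

/-- Maps which send edges to edges are locally injective if edges with the same image do not have
the same initial or the same terminal vertex. -/
theorem isLocallyInjective_of_edges {F : C(G.Space, H.Space)} {φ : G.V → H.V} {ε : G.E → H.E}
    (hV : ∀ v, F (G.vert v) = H.vert (φ v)) (hE : ∀ e t, F (G.pt e t) = H.pt (ε e) t)
    (h : ∀ e e', ε e = ε e' → G.init e = G.init e' ∨ G.term e = G.term e' → e = e') :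
    IsLocallyInjective F := by
  intro x
  rcases mem_star_or_openEdge x with ⟨v, hv⟩ | ⟨e, he⟩
  · refine ⟨star v, isOpen_star v, hv, ?_⟩
    -- The centre is the only point of the star that goes to a vertex.
    have key : ∀ y ∈ star v, ∀ w, F y = H.vert w → y = G.vert v := by
      intro y hy w hyw
      induction y using Space.ind with
      | hv u => rw [vert_mem_star.1 hy]
      | he e t =>
        rw [hE] at hyw
        rw [pt_mem_star] at hy
        rcases pt_eq_vert hyw with ⟨rfl, -⟩ | ⟨rfl, -⟩
        · rw [pt_zero, (hy.resolve_right fun h => by norm_num at h).2]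
        · rw [pt_one, (hy.resolve_left fun h => by norm_num at h).2]
    intro y hy z hz hyz
    by_cases hw : ∃ w, F y = H.vert w
    · obtain ⟨w, hw⟩ := hw
      rw [key y hy w hw, key z hz w (hyz ▸ hw)]
    · push Not at hw
      induction y using Space.ind with
      | hv u => exact absurd (hV u) (hw _)
      | he e t =>
        induction z using Space.ind with
        | hv u => exact absurd (hyz.trans (hV u)) (hw _)
        | he e' t' =>
          have h0 : t ≠ 0 := by
            rintro rfl
            exact hw _ (by rw [pt_zero, hV])
          have h1 : t ≠ 1 := by
            rintro rfl
            exact hw _ (by rw [pt_one, hV])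
          rw [hE, hE] at hyz
          obtain ⟨he, rfl⟩ := pt_eq_pt hyz h0 h1
          rw [pt_mem_star] at hy hz
          rw [h e e' he]
          -- The two points have the same parameter, which cannot be near both ends, so the edges
          -- both begin at `v` or both end at `v`.
          rcases hy with hy | hy <;> rcases hz with hz | hz
          · exact .inl (hy.2.trans hz.2.symm)
          · linarith [hy.1, hz.1]
          · linarith [hy.1, hz.1]
          · exact .inr (hy.2.trans hz.2.symm)
  · refine ⟨openEdge e, isOpen_openEdge e, he, ?_⟩
    intro y hy z hz hyz
    induction y using Space.ind with
    | hv u => exact hy.elim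
    | he e₁ t =>
      induction z using Space.ind with
      | hv u => exact hz.elim
      | he e₂ t' =>
        obtain ⟨rfl, h0, h1⟩ := pt_mem_openEdge.1 hy
        obtain ⟨rfl, -⟩ := pt_mem_openEdge.1 hz
        rw [hE, hE] at hyz
        rw [(pt_eq_pt hyz h0 h1).2]

/-- A graph from its number of vertices and its list of edges. -/
def ofList (n : ℕ) (E : List (ℕ × ℕ)) (h : ∀ e ∈ E, e.1 < n ∧ e.2 < n) : FinGraph where
  numV := n
  numE := E.length
  init e := ⟨E[e].1, (h _ (List.getElem_mem e.2)).1⟩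
  term e := ⟨E[e].2, (h _ (List.getElem_mem e.2)).2⟩

theorem code_ofList (n : ℕ) (E : List (ℕ × ℕ)) (h : ∀ e ∈ E, e.1 < n ∧ e.2 < n) :
    (ofList n E h).code = (n, E) :=
  Prod.ext rfl (List.ofFn_getElem (xs := E))

theorem realize_describes (f : TightMap G H) : f.Describes (realize f.onV f.onE) :=
  ⟨fun _ => rfl, fun _ => ⟨.refl I, fun _ => rfl⟩⟩

/-- The combinatorial conditions translate one by one into geometric ones. The image subgroup is
identified after applying the injective `holHom`, where it becomes the last clause of
`IsStallingsCode`. -/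
theorem exists_isStallingsGraph {q : H.V} {L : List NatWord} {n : ℕ} {ES : List (ℕ × ℕ)}
    {lab onV : List ℕ} {p : ℕ} (h : IsStallingsCode H.numV H.code.2 q.val L n ES lab onV p)
    {K : Subgroup (FundamentalGroup H.Space (H.vert q))}
    (hK : K.map (holHom q) = wordClosure L) :
    ∃ (S : FinGraph) (g : TightMap S H) (p' : S.V),
      (g.code, p'.val) = ((((n, ES), H.code), (onV, labelWords lab)), p) ∧
      IsStallingsGraph g p' q K := by
  obtain ⟨hES, ⟨hp, hlV, hlE⟩, honV, hpq, hlab, hconn, hcore, himm, hgrp⟩ := h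
  let S := ofList n ES hES
  have hinit : ∀ e : S.E, (S.init e).val = (ES.getD e.val (0, 0)).1 := fun e => by
    rw [List.getD_eq_getElem _ _ e.2]; rfl
  have hterm : ∀ e : S.E, (S.term e).val = (ES.getD e.val (0, 0)).2 := fun e => by
    rw [List.getD_eq_getElem _ _ e.2]; rfl
  have hcode : S.code = (n, ES) := code_ofList n ES hES
  let φ : S.V → H.V := fun v => ⟨onV.getD v.val 0, by
    rw [List.getD_eq_getElem _ _ (by rw [hlV]; exact v.2)]
    exact honV _ (List.getElem_mem _)⟩
  let ε : S.E → H.E := fun e => ⟨lab.getD e.val 0, by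
    have := (hlab e.val e.2).1
    rwa [length_code] at this⟩
  have hε : ∀ e, H.init (ε e) = φ (S.init e) ∧ H.term (ε e) = φ (S.term e) := fun e => by
    have h1 := (hlab e.val e.2).2
    have h2 := getD_code (ε e)
    change H.code.2.getD (lab.getD e.val 0) (0, 0) = _ at h2
    rw [h2, ← hinit, ← hterm] at h1
    exact ⟨Fin.ext h1.1, Fin.ext h1.2⟩
  let d : ∀ e, H.Dart (φ (S.init e)) (φ (S.term e)) := fun e => ⟨(ε e, true), hε e⟩
  let g : TightMap S H := ⟨φ, fun e => .cons (d e) (.nil _), fun e => FreeGroup.IsReduced.singleton⟩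
  let p' : S.V := ⟨p, hp⟩
  obtain rfl : φ p' = q := Fin.ext hpq
  have hedge : edgeWords g.onE = labelWords lab := by
    refine List.ext_getElem (by simp [edgeWords, labelWords, hlE]; rfl) fun i h1 h2 => ?_
    have hi : i < lab.length := by simpa [labelWords] using h2
    simp only [edgeWords, labelWords, List.getElem_ofFn, List.getElem_map]
    change [(lab.getD i 0, true)] = _
    rw [List.getD_eq_getElem _ _ hi]
  have hVcode : (List.ofFn fun v => (g.onV v).val) = onV := by
    refine List.ext_getElem (by simp [hlV]; rfl) fun i h1 h2 => ?_
    simp only [List.getElem_ofFn]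
    exact List.getD_eq_getElem _ _ h2
  refine ⟨S, g, p', ?_, ?_, fun u hu => ?_, fun e => rfl, realize g.onV g.onE,
    realize_describes g, ?_, rfl, ?_⟩
  · rw [TightMap.code, hcode, hVcode]
    exact congrArg (fun l => ((((n, ES), H.code), (onV, l)), p)) hedge
  · have := pathConnectedSpace_of_edgeJoined (G := S) (p := p') fun v => by
      rw [hcode]
      exact hconn v.val v.2
    infer_instance
  · by_contra hne
    have hlt : 1 < S.valence u := by
      rw [valence, Finset.one_lt_card]
      obtain ⟨i, hi, j, hj, hij⟩ := hcore u.val u.2 fun h => hne (Fin.ext h)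
      let e : S.E := ⟨i, hi⟩
      let e' : S.E := ⟨j, hj⟩
      have h1 : (S.init e).val = _ := hinit e
      have h2 : (S.term e).val = _ := hterm e
      have h1' : (S.init e').val = _ := hinit e'
      have h2' : (S.term e').val = _ := hterm e'
      simp only [e, e'] at h1 h2 h1' h2'
      rw [← h1, ← h2, ← h1', ← h2'] at hij
      have hne : ¬ i = j → ∀ b b' : Bool, (e, b) ≠ (e', b') := fun h b b' h' =>
        h (congrArg (fun x : S.E × Bool => x.1.val) h')
      simp only [Finset.mem_filter, Finset.mem_univ, true_and]
      rcases hij with ⟨h3, h4⟩ | ⟨h, h3, h4⟩ | ⟨h, h3, h4⟩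
      · exact ⟨(e, true), Fin.ext h3, (e', false), Fin.ext h4, fun h => by simp at h⟩
      · exact ⟨(e, true), Fin.ext h3, (e', true), Fin.ext h4, hne h _ _⟩
      · exact ⟨(e, false), Fin.ext h3, (e', false), Fin.ext h4, hne h _ _⟩
    omega
  · refine isLocallyInjective_of_edges (φ := φ) (ε := ε) (fun v => rfl) (fun e t => rfl) ?_
    intro e e' he hee
    refine Fin.ext (himm e.val e.2 e'.val e'.2 (Fin.ext_iff.1 he) ?_)
    rw [← hinit, ← hterm, ← hinit, ← hterm]
    exact hee.imp (congrArg Fin.val) (congrArg Fin.val)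
  · have h1 := map_range_mapOfEq (realize_describes g).realizes p' rfl
    rw [hedge, hcode] at h1
    exact Subgroup.map_injective (holHom_injective _) (h1.trans (hgrp.trans hK.symm))

end FinGraph

/-! ### Reading off the combinatorial data -/

theorem ComputablePred.exists_decision {α : Type*} [Primcodable α] {P : α → Prop}
    (h : ComputablePred P) : ∃ A : α → Bool, Computable A ∧ ∀ a, A a = true ↔ P a := by
  obtain ⟨_, h⟩ := h
  exact ⟨_, h, fun a => decide_eq_true_iff⟩

theorem Computable.map_reduce {α : Type*} [Primcodable α] {f : α → List NatWord}
    (hf : Computable f) : Computable fun a => (f a).map FreeGroup.reduce :=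
  (Primrec.list_map (f := id) (g := fun (_ : List NatWord) a => FreeGroup.reduce a) Primrec.id
    (primrec_reduce.comp Primrec.snd)).to_comp.comp hf

theorem wordClosure_map_reduce (L : List NatWord) :
    wordClosure (L.map FreeGroup.reduce) = wordClosure L := by
  refine le_antisymm (wordClosure_le.2 fun l hl => ?_) (wordClosure_le.2 fun l hl => ?_)
  · obtain ⟨l', hl', rfl⟩ := List.mem_map.1 hl
    rw [FreeGroup.reduce.self]
    exact mk_mem_wordClosure hl'
  · rw [← FreeGroup.reduce.self]
    exact mk_mem_wordClosure (List.mem_map_of_mem hl)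

theorem mk_wordCode {n : ℕ} (w : List (Fin n × Bool)) :
    FreeGroup.mk (wordCode w) = FreeGroup.map Fin.val (FreeGroup.mk w) :=
  (FreeGroup.map.mk).symm

theorem isReduced_wordCode {n : ℕ} {w : List (Fin n × Bool)} :
    FreeGroup.IsReduced (wordCode w) ↔ FreeGroup.IsReduced w := by
  rw [FreeGroup.IsReduced, wordCode, List.isChain_map, FreeGroup.IsReduced]
  simp only [Fin.val_inj]

theorem exists_freeGroupBasis_iff {A : Type*} [Group A] {n : ℕ} (w : Fin n → A) :
    (∃ b : FreeGroupBasis (Fin n) A, ∀ i, b i = w i) ↔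
      Function.Bijective (FreeGroup.lift w) := by
  constructor
  · rintro ⟨b, hb⟩
    have h : FreeGroup.lift w = b.repr.symm.toMonoidHom := by
      refine FreeGroup.ext_hom _ _ fun i => ?_
      rw [FreeGroup.lift_apply_of]
      exact (hb i).symm
    rw [h]
    exact b.repr.symm.bijective
  · intro h
    exact ⟨.ofRepr (MulEquiv.ofBijective _ h).symm, fun i => FreeGroup.lift_apply_of⟩

theorem lift_mk_wordCode {n k : ℕ} (w : Fin k → List (Fin n × Bool)) :
    (FreeGroup.lift fun i => FreeGroup.mk (wordCode (w i))) =
      (FreeGroup.map Fin.val).comp (FreeGroup.lift fun i => FreeGroup.mk (w i)) :=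
  FreeGroup.ext_hom _ _ fun i => by simp [mk_wordCode]

theorem wordClosure_ofFn_wordCode {n k : ℕ} (w : Fin k → List (Fin n × Bool)) :
    wordClosure (List.ofFn fun i => wordCode (w i)) =
      (Subgroup.closure (Set.range fun i => FreeGroup.mk (w i))).map (FreeGroup.map Fin.val) := by
  rw [wordClosure_ofFn, lift_mk_wordCode, MonoidHom.range_comp, FreeGroup.range_lift_eq_closure]

/-- Being a free basis of the whole free group, in terms of coded words. -/
theorem exists_freeGroupBasis_iff_wordClosure {n : ℕ} (w : Fin n → List (Fin n × Bool)) :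
    (∃ b : FreeGroupBasis (Fin n) (FreeGroup (Fin n)), ∀ i, b i = FreeGroup.mk (w i)) ↔
      (∀ y ∈ wordClosure (letterWords n),
        substHom (List.ofFn fun i => wordCode (w i)) y = 1 → y = 1) ∧
      ∀ l ∈ letterWords n, FreeGroup.mk l ∈ wordClosure (List.ofFn fun i => wordCode (w i)) := by
  have hval : Function.Injective (FreeGroup.map (Fin.val (n := n))) :=
    FreeGroup.map_injective Fin.val_injective
  rw [exists_freeGroupBasis_iff, ← injective_lift_mk_iff, lift_mk_wordCode, ← wordClosure_le,
    wordClosure_ofFn_wordCode, ← FreeGroup.range_lift_eq_closure]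
  refine and_congr ⟨fun h => hval.comp h, fun h => Function.Injective.of_comp h⟩ ?_
  constructor
  · intro h x hx
    obtain ⟨y, rfl⟩ := mem_wordClosure_letterWords.1 hx
    obtain ⟨z, rfl⟩ := h y
    exact ⟨_, ⟨z, rfl⟩, rfl⟩
  · intro h y
    obtain ⟨_, ⟨z, rfl⟩, hz⟩ := h (mem_wordClosure_letterWords.2 ⟨y, rfl⟩)
    exact ⟨z, hval hz⟩

namespace TightMap

variable {G H : FinGraph} (f : TightMap G H)

theorem getD_onV (v : G.V) :
    (List.ofFn fun v => (f.onV v).val).getD v.val 0 = (f.onV v).val := by simp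

end TightMap

/-! ### The algorithms -/

section Algorithms

variable {gens : List (ℕ × ℕ) × ℕ → List NatWord}

/-- The criterion for injectivity on fundamental groups. -/
def InjectiveCode (gens : List (ℕ × ℕ) × ℕ → List NatWord) (c : TightMapCode) : Prop :=
  ∀ v < c.1.1.1, ∀ y ∈ wordClosure (gens (c.1.1.2, v)), substHom c.2.2 y = 1 → y = 1

theorem computablePred_injectiveCode (hg : Computable gens) :
    ComputablePred (InjectiveCode gens) :=
  .forall_lt (f := fun c : TightMapCode => c.1.1.1)
    (P := fun c v => ∀ y ∈ wordClosure (gens (c.1.1.2, v)), substHom c.2.2 y = 1 → y = 1)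
    (by fun_prop) (computablePred_injective_wordClosure.comp_fun
      (f := fun y : TightMapCode × ℕ => (gens (y.1.1.1.2, y.2), y.1.2.2))
      (by fun_prop))

theorem injectiveCode_iff (hg : ∀ x, wordClosure (gens x) = walkGroup x.1 x.2) {G H : FinGraph}
    (f : TightMap G H) : InjectiveCode gens f.code ↔
      ∀ v : G.V, ∀ y ∈ walkGroup G.code.2 v.val,
        substHom (FinGraph.edgeWords f.onE) y = 1 → y = 1 := by
  simp only [InjectiveCode, hg]
  exact ⟨fun h v => h v.val v.2, fun h v hv => h ⟨v, hv⟩⟩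

/-- The criterion for homotopy equivalences. -/
def EquivalenceCode (gens : List (ℕ × ℕ) × ℕ → List NatWord) (c : TightMapCode) : Prop :=
  InjectiveCode gens c ∧
  (∀ v < c.1.1.1, ∀ l ∈ gens (c.1.2.2, c.2.1.getD v 0),
    FreeGroup.mk l ∈ wordClosure ((gens (c.1.1.2, v)).map (substWord c.2.2))) ∧
  (∀ u < c.1.1.1, ∀ v < c.1.1.1, EdgeJoined c.1.2.2 (c.2.1.getD u 0) (c.2.1.getD v 0) →
    EdgeJoined c.1.1.2 u v) ∧
  ∀ w < c.1.2.1, ∃ v < c.1.1.1, EdgeJoined c.1.2.2 w (c.2.1.getD v 0)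

theorem computablePred_equivalenceCode (hg : Computable gens) :
    ComputablePred (EquivalenceCode gens) := by
  refine .and (computablePred_injectiveCode hg) (.and ?_ (.and ?_ ?_))
  · refine .forall_lt (f := fun c : TightMapCode => c.1.1.1)
      (P := fun c v => ∀ l ∈ gens (c.1.2.2, c.2.1.getD v 0),
        FreeGroup.mk l ∈ wordClosure ((gens (c.1.1.2, v)).map (substWord c.2.2))) (by fun_prop) ?_
    refine .forall_mem (f := fun y : TightMapCode × ℕ => gens (y.1.1.2.2, y.1.2.1.getD y.2 0))
      (P := fun y l => FreeGroup.mk l ∈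
        wordClosure ((gens (y.1.1.1.2, y.2)).map (substWord y.1.2.2)))
      (by fun_prop) ?_
    have h : Computable fun y : (TightMapCode × ℕ) × NatWord => gens (y.1.1.1.1.2, y.1.2) := by
      fun_prop
    have h' : Computable fun y : (TightMapCode × ℕ) × NatWord =>
        (gens (y.1.1.1.1.2, y.1.2)).map (substWord y.1.1.2.2) :=
      .map_substWord_fun (f := fun y : (TightMapCode × ℕ) × NatWord => y.1.1.2.2) (by fun_prop) h
    exact computablePred_mem_wordClosure.comp_fun
      (f := fun y : (TightMapCode × ℕ) × NatWord =>
        ((gens (y.1.1.1.1.2, y.1.2)).map (substWord y.1.1.2.2), y.2))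
      (h'.pair .snd)
  · refine .forall_lt (f := fun c : TightMapCode => c.1.1.1)
      (P := fun c u => ∀ v < c.1.1.1, EdgeJoined c.1.2.2 (c.2.1.getD u 0) (c.2.1.getD v 0) →
        EdgeJoined c.1.1.2 u v) (by fun_prop) ?_
    refine .forall_lt (f := fun y : TightMapCode × ℕ => y.1.1.1.1)
      (P := fun y v => EdgeJoined y.1.1.2.2 (y.1.2.1.getD y.2 0) (y.1.2.1.getD v 0) →
        EdgeJoined y.1.1.1.2 y.2 v) (by fun_prop) ?_
    exact .imp (computablePred_edgeJoined.comp_fun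
        (f := fun y : (TightMapCode × ℕ) × ℕ =>
          (y.1.1.1.2.2, y.1.1.2.1.getD y.1.2 0, y.1.1.2.1.getD y.2 0)) (by fun_prop))
      (computablePred_edgeJoined.comp_fun
        (f := fun y : (TightMapCode × ℕ) × ℕ => (y.1.1.1.1.2, y.1.2, y.2)) (by fun_prop))
  · refine .forall_lt (f := fun c : TightMapCode => c.1.2.1)
      (P := fun c w => ∃ v < c.1.1.1, EdgeJoined c.1.2.2 w (c.2.1.getD v 0)) (by fun_prop) ?_
    exact .exists_lt (f := fun y : TightMapCode × ℕ => y.1.1.1.1)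
      (P := fun y v => EdgeJoined y.1.1.2.2 y.2 (y.1.2.1.getD v 0)) (by fun_prop)
      (computablePred_edgeJoined.comp_fun
        (f := fun y : (TightMapCode × ℕ) × ℕ => (y.1.1.1.2.2, y.1.2, y.1.1.2.1.getD y.2 0))
        (by fun_prop))

theorem equivalenceCode_iff (hg : ∀ x, wordClosure (gens x) = walkGroup x.1 x.2) {G H : FinGraph}
    (f : TightMap G H) : EquivalenceCode gens f.code ↔
      (∀ v : G.V, ∀ y ∈ walkGroup G.code.2 v.val,
        substHom (FinGraph.edgeWords f.onE) y = 1 → y = 1) ∧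
      (∀ v : G.V, walkGroup H.code.2 (f.onV v).val ≤
        (walkGroup G.code.2 v.val).map (substHom (FinGraph.edgeWords f.onE))) ∧
      (∀ u v : G.V, EdgeJoined H.code.2 (f.onV u).val (f.onV v).val →
        EdgeJoined G.code.2 u.val v.val) ∧
      (∀ w : H.V, ∃ v : G.V, EdgeJoined H.code.2 w.val (f.onV v).val) := by
  have hv : ∀ v : G.V, f.code.2.1.getD v.val 0 = (f.onV v).val := f.getD_onV
  rw [EquivalenceCode, injectiveCode_iff hg]
  simp only [← wordClosure_le, ← map_substHom_wordClosure, hg]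
  refine and_congr_right fun _ => and_congr ⟨fun h v => ?_, fun h v hv' => ?_⟩
    (and_congr ⟨fun h u v => ?_, fun h u hu v hv' => ?_⟩ ⟨fun h w => ?_, fun h w hw => ?_⟩)
  · rw [← hv]
    exact h v.val v.2
  · have := h ⟨v, hv'⟩
    rw [← hv] at this
    exact this
  · rw [← hv, ← hv]
    exact h u.val u.2 v.val v.2
  · have := h ⟨u, hu⟩ ⟨v, hv'⟩
    rw [← hv, ← hv] at this
    exact this
  · obtain ⟨v, hv', h⟩ := h w.val w.2
    exact ⟨⟨v, hv'⟩, by rw [← hv]; exact h⟩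
  · obtain ⟨v, h⟩ := h ⟨w, hw⟩
    rw [← hv] at h
    exact ⟨v.val, v.2, h⟩

end Algorithms

/-- Stallings graphs can be computed. -/
theorem exists_computable_stallings :
    ∃ A : ℕ × List (ℕ × ℕ) × ℕ × List NatWord → ℕ × List (ℕ × ℕ) × List ℕ × List ℕ × ℕ,
      Computable A ∧ ∀ nH EH q L, (∀ e ∈ EH, e.1 < nH ∧ e.2 < nH) → q < nH →
        (∀ l ∈ L, EdgeWalk EH q l q) →
        IsStallingsCode nH EH q L (A (nH, EH, q, L)).1 (A (nH, EH, q, L)).2.1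
          (A (nH, EH, q, L)).2.2.1 (A (nH, EH, q, L)).2.2.2.1 (A (nH, EH, q, L)).2.2.2.2 := by
  obtain ⟨A, hA, h⟩ := exists_computable_search
    -- The relation is conditional on well-formed input, so that every input has an output and the
    -- search always halts.
    (R := fun (a : ℕ × List (ℕ × ℕ) × ℕ × List NatWord)
      (s : ℕ × List (ℕ × ℕ) × List ℕ × List ℕ × ℕ) =>
      ((∀ e ∈ a.2.1, e.1 < a.1 ∧ e.2 < a.1) ∧ a.2.2.1 < a.1 ∧
        ∀ l ∈ a.2.2.2, EdgeWalk a.2.1 a.2.2.1 l a.2.2.1) →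
      IsStallingsCode a.1 a.2.1 a.2.2.1 a.2.2.2 s.1 s.2.1 s.2.2.1 s.2.2.2.1 s.2.2.2.2)
    (by
      refine .imp (.and ?_ (.and ?_ ?_)) computablePred_isStallingsCode
      · exact .forall_mem (f := fun x : StallingsArgs => x.1.2.1)
          (P := fun x e => e.1 < x.1.1 ∧ e.2 < x.1.1) (by fun_prop)
          (.and (.lt (by fun_prop) (by fun_prop)) (.lt (by fun_prop) (by fun_prop)))
      · exact .lt (by fun_prop) (by fun_prop)
      · exact .forall_mem (f := fun x : StallingsArgs => x.1.2.2.2)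
          (P := fun x l => EdgeWalk x.1.2.1 x.1.2.2.1 l x.1.2.2.1) (by fun_prop)
          (.edgeWalk (by fun_prop) (by fun_prop) (by fun_prop) (by fun_prop)))
    (fun a => by
      by_cases ha : (∀ e ∈ a.2.1, e.1 < a.1 ∧ e.2 < a.1) ∧ a.2.2.1 < a.1 ∧
          ∀ l ∈ a.2.2.2, EdgeWalk a.2.1 a.2.2.1 l a.2.2.1
      · obtain ⟨n, ES, lab, onV, p, h⟩ := exists_isStallingsCode ha.1 ha.2.1 ha.2.2
        exact ⟨(n, ES, lab, onV, p), fun _ => h⟩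
      · exact ⟨default, fun h => absurd h ha⟩)
  exact ⟨A, hA, fun nH EH q L h1 h2 h3 => h (nH, EH, q, L) ⟨h1, h2, h3⟩⟩

/-! ### From reduced basis words to tight edge paths -/

namespace FinGraph

variable {G : FinGraph}

theorem code_lt (G : FinGraph) : ∀ e ∈ G.code.2, e.1 < G.code.1 ∧ e.2 < G.code.1 := by
  intro e he
  obtain ⟨i, rfl⟩ := List.mem_ofFn.1 he
  exact ⟨(G.init i).2, (G.term i).2⟩

/-- A free basis of reduced words yields a free basis of tight edge paths. -/
theorem exists_walk_basis {q : G.V} {K : Subgroup (FundamentalGroup G.Space (G.vert q))}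
    {L : List NatWord} (hK : K.map (holHom q) = wordClosure L) {m : ℕ} {u : Fin m → NatWord}
    (hu : ∀ i, FreeGroup.IsReduced (u i))
    (hb : IsFreeBasisOf (fun i => FreeGroup.mk (u i)) (wordClosure L)) :
    ∃ W : Fin m → G.Walk q q, (∀ i, wordCode (W i).word = u i) ∧ (∀ i, (W i).IsTight) ∧
      IsFreeBasisOf (fun i => (W i).toPi) K := by
  have hmem : ∀ i, FreeGroup.mk (u i) ∈ walkGroup G.code.2 q.val := fun i => by
    have h1 : FreeGroup.mk (u i) ∈ wordClosure L := by
      obtain ⟨b, hb⟩ := hb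
      have h := (b i).2
      rwa [hb] at h
    rw [← hK] at h1
    rw [← range_holHom]
    exact Subgroup.map_le_range _ _ h1
  choose W hW using fun i => exists_walk_of_edgeWalk' (EdgeWalk.of_mk_mem_walkGroup (hu i) (hmem i))
  refine ⟨W, hW, fun i => isReduced_wordCode.1 (by rw [hW]; exact hu i),
    isFreeBasisOf_of_map (holHom_injective q) ?_⟩
  have h : (fun i => holHom q (W i).toPi) = fun i => (FreeGroup.mk (u i))⁻¹ :=
    funext fun i => by rw [holHom_toPi, hW]
  rw [h, hK]
  exact isFreeBasisOf_inv hb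

end FinGraph

theorem mainTheorem10 :
    -- deciding whether a tight map of finite graphs is injective on fundamental groups
    (∃ A : TightMapCode → Bool, Computable A ∧
      ∀ (G H : FinGraph) (f : TightMap G H) (F : C(G.Space, H.Space)), f.Describes F →
        (A f.code = true ↔ PiOneInjective F)) ∧
    -- deciding whether a tight map of finite graphs is a homotopy equivalence
    (∃ A : TightMapCode → Bool, Computable A ∧
      ∀ (G H : FinGraph) (f : TightMap G H) (F : C(G.Space, H.Space)), f.Describes F →
        (A f.code = true ↔ IsHomotopyEquivalence F)) ∧
    -- deciding whether an n-tuple of elements of the free group of rank n is a free basis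
    (∃ A : List (List (ℕ × Bool)) → Bool, Computable A ∧
      ∀ (n : ℕ) (w : Fin n → List (Fin n × Bool)),
        (A (List.ofFn fun i => wordCode (w i)) = true ↔
          ∃ b : FreeGroupBasis (Fin n) (FreeGroup (Fin n)), ∀ i, b i = FreeGroup.mk (w i))) ∧
    -- computing a Stallings graph and a free basis of the image on fundamental groups of a tight map
    (∃ A : TightMapCode × ℕ → (TightMapCode × ℕ) × List (List (ℕ × Bool)), Computable A ∧
      ∀ (G H : FinGraph) (f : TightMap G H) (v : G.V) (F : C(G.Space, H.Space))
        (hF : f.Describes F),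
        ∃ (S : FinGraph) (g : TightMap S H) (p : S.V) (m : ℕ)
          (u : Fin m → H.Walk (f.onV v) (f.onV v)),
          A (f.code, v.val) = ((g.code, p.val), List.ofFn fun i => wordCode (u i).word) ∧
          IsStallingsGraph g p (f.onV v) (FundamentalGroup.mapOfEq F (hF.1 v)).range ∧
          (∀ i, (u i).IsTight) ∧
          IsFreeBasisOf (fun i => (u i).toPi) (FundamentalGroup.mapOfEq F (hF.1 v)).range) ∧
    -- computing a free basis of the subgroup generated by finitely many elements of a free group
    (∃ A : ℕ × List (List (ℕ × Bool)) → List (List (ℕ × Bool)), Computable A ∧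
      ∀ (n k : ℕ) (w : Fin k → List (Fin n × Bool)),
        ∃ (m : ℕ) (u : Fin m → List (Fin n × Bool)),
          A (n, List.ofFn fun i => wordCode (w i)) = List.ofFn (fun i => wordCode (u i)) ∧
          (∀ i, FreeGroup.IsReduced (u i)) ∧
          IsFreeBasisOf (fun i => FreeGroup.mk (u i))
            (Subgroup.closure (Set.range fun i => FreeGroup.mk (w i)))) := by

  obtain ⟨gens, hgens, hg⟩ := exists_computable_walkGroup_generators
  obtain ⟨basis, hbasis, hb⟩ := exists_computable_basis
  refine ⟨?_, ?_, ?_, ?_, ?_⟩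
  · obtain ⟨A, hA, h⟩ := (computablePred_injectiveCode hgens).exists_decision
    refine ⟨A, hA, fun G H f F hF => ?_⟩
    rw [h, injectiveCode_iff hg, FinGraph.piOneInjective_iff hF.realizes]
  · obtain ⟨A, hA, h⟩ := (computablePred_equivalenceCode hgens).exists_decision
    refine ⟨A, hA, fun G H f F hF => ?_⟩
    rw [h, equivalenceCode_iff hg, FinGraph.isHomotopyEquivalence_iff hF.realizes]
  -- The rank is read off as the length of the tuple. A basis of the whole group means that the
  -- substitution is injective on the first `n` letters and its image contains these letters.
  · have hP : ComputablePred fun L : List NatWord =>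
        (∀ y ∈ wordClosure (letterWords L.length), substHom L y = 1 → y = 1) ∧
          ∀ l ∈ letterWords L.length, FreeGroup.mk l ∈ wordClosure L :=
      .and (computablePred_injective_wordClosure.comp_fun
          (f := fun L : List NatWord => (letterWords L.length, L)) (by fun_prop))
        (.forall_mem (f := fun L : List NatWord => letterWords L.length)
          (P := fun L l => FreeGroup.mk l ∈ wordClosure L) (by fun_prop)
          (computablePred_mem_wordClosure.comp_fun (f := fun x : List NatWord × NatWord => x)
            (by fun_prop)))
    obtain ⟨A, hA, h⟩ := hP.exists_decision
    refine ⟨A, hA, fun n w => ?_⟩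
    rw [h, exists_freeGroupBasis_iff_wordClosure, List.length_ofFn]
  · obtain ⟨stallings, hstallings, hs⟩ := exists_computable_stallings
    -- Generators of the image subgroup: the images of generators of the closed edge paths at the
    -- given vertex. They are reduced so that `EdgeWalk.of_mk_mem_walkGroup` shows them to be edge
    -- paths of `H`.
    let Lf : TightMapCode × ℕ → List NatWord := fun x =>
      ((gens (x.1.1.1.2, x.2)).map (substWord x.1.2.2)).map FreeGroup.reduce
    have hLf : Computable Lf := by
      have h : Computable fun x : TightMapCode × ℕ => gens (x.1.1.1.2, x.2) := by
        fun_prop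
      exact .map_reduce (.map_substWord_fun (f := fun x : TightMapCode × ℕ => x.1.2.2)
        (by fun_prop) h)
    let Sf : TightMapCode × ℕ → ℕ × List (ℕ × ℕ) × List ℕ × List ℕ × ℕ := fun x =>
      stallings (x.1.1.2.1, x.1.1.2.2, x.1.2.1.getD x.2 0, Lf x)
    have hSf : Computable Sf := by fun_prop
    have hlab : Computable fun x => labelWords (Sf x).2.2.1 := .labelWords (by fun_prop)
    have hbf : Computable fun x => basis (Lf x) := hbasis.comp hLf
    refine ⟨fun x => ((((((Sf x).1, (Sf x).2.1), x.1.1.2), ((Sf x).2.2.2.1,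
      labelWords (Sf x).2.2.1)), (Sf x).2.2.2.2), basis (Lf x)), by fun_prop,
      fun G H f v F hF => ?_⟩
    let K := (FundamentalGroup.mapOfEq F (hF.1 v)).range
    have hK : K.map (FinGraph.holHom (f.onV v)) = wordClosure (Lf (f.code, v.val)) := by
      rw [wordClosure_map_reduce, ← map_substHom_wordClosure, hg]
      exact FinGraph.map_range_mapOfEq hF.realizes v (hF.1 v)
    have hL : ∀ l ∈ Lf (f.code, v.val), EdgeWalk H.code.2 (f.onV v).val l (f.onV v).val := by
      intro l hl
      obtain ⟨l', hl', rfl⟩ := List.mem_map.1 hl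
      refine EdgeWalk.of_mk_mem_walkGroup (FreeGroup.IsReduced.of_reduce_eq
        FreeGroup.reduce.idem) ?_
      rw [← FinGraph.range_holHom]
      refine Subgroup.map_le_range _ K ?_
      rw [hK]
      exact mk_mem_wordClosure hl
    have hS : IsStallingsCode H.numV H.code.2 (f.onV v).val (Lf (f.code, v.val))
        (Sf (f.code, v.val)).1 (Sf (f.code, v.val)).2.1 (Sf (f.code, v.val)).2.2.1
        (Sf (f.code, v.val)).2.2.2.1 (Sf (f.code, v.val)).2.2.2.2 := by
      have hq : f.code.2.1.getD v.val 0 = (f.onV v).val := f.getD_onV v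
      simp only [Sf, hq]
      exact hs _ _ _ _ H.code_lt (f.onV v).2 hL
    obtain ⟨S, g, p, hcode, hgS⟩ := FinGraph.exists_isStallingsGraph hS hK
    obtain ⟨m, u, hu, hred, hbu⟩ := hb (Lf (f.code, v.val))
    obtain ⟨W, hW, htight, hbW⟩ := FinGraph.exists_walk_basis hK hred hbu
    refine ⟨S, g, p, m, W, ?_, hgS, htight, hbW⟩
    rw [hcode, funext hW, ← hu]
    rfl
  · refine ⟨fun x => basis x.2, hbasis.comp (by fun_prop), fun n k w => ?_⟩
    obtain ⟨m, u, hu, hred, hbu⟩ := hb (List.ofFn fun i => wordCode (w i))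
    have hval : Function.Injective (FreeGroup.map (Fin.val (n := n))) :=
      FreeGroup.map_injective Fin.val_injective
    have hcl := wordClosure_ofFn_wordCode w
    rw [hcl] at hbu
    -- The subgroup lies in the image of `FreeGroup (Fin n)`. A reduced word representing an element
    -- of that image agrees with the reduced word of its preimage, so only the first `n` letters
    -- occur.
    have hex : ∀ i, ∃ U : List (Fin n × Bool), FreeGroup.IsReduced U ∧ wordCode U = u i := by
      intro i
      obtain ⟨b, hb⟩ := id hbu
      obtain ⟨y, -, hy⟩ := (b i).2
      rw [hb i] at hy
      refine ⟨y.toWord, FreeGroup.isReduced_toWord, ?_⟩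
      have h1 : FreeGroup.IsReduced (wordCode y.toWord) :=
        isReduced_wordCode.2 FreeGroup.isReduced_toWord
      rw [← h1.reduce_eq, ← (hred i).reduce_eq]
      refine FreeGroup.reduce.sound ?_
      rw [mk_wordCode, FreeGroup.mk_toWord, hy]
    choose U hU hU' using hex
    refine ⟨m, U, hu.trans (by rw [funext hU']), hU, isFreeBasisOf_of_map hval ?_⟩
    have h : (fun i => FreeGroup.map Fin.val (FreeGroup.mk (U i))) = fun i =>
      FreeGroup.mk (u i) := funext fun i => by rw [← mk_wordCode, hU']
    rw [h]
    exact hbu
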